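/- Let $(\mathcal Z_n)_{n\ge 0}$ be a branching random walk on $\mathbb R$ started from one particle at the origin: every individual $u$ has a random number $N(u)\in\{0,1,2,\dots\}\cup\{\infty\}$ of children, displaced from $u$ by $X_1(u),X_2(u),\dots$, where the reproduction data $(N(u),X_1(u),X_2(u),\dots)$ of different individuals are independent and identically distributed, while their joint law for one individual is arbitrary. Let $S(u)$ be the position of $u$, let $\mathcal Z=\sum_{j=1}^{N}\delta_{X_j}$ be the point process of the ancestor's children, and assume $\mathbb E[N]>1$. Put $$m(\theta)=\mathbb E\Big[\int e^{-\theta x}\,\mathcal Z(\mathrm dx)\Big]\in[0,\infty],\qquad W_n(\theta)=\frac1{m(\theta)^n}\sum_{|u|=n}e^{-\theta S(u)},$$ and let $W(\theta)$ be the almost sure limit of $W_n(\theta)$ as $n\to\infty$ (which exists whenever $m(\theta)<\infty$). Let $\theta\in\mathbb R$ with $m(\theta)<\infty$, and suppose that there are $\alpha\in(1,2)$ and $c>0$ such that $$\kappa:=\frac{m(\alpha\theta)}{m(\theta)^\alpha}<1\qquad\text{and}\qquad \mathbb P(W_1(\theta)>x)\sim c\,x^{-\alpha}\quad(x\to\infty).$$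 Let $(U_k)_{k\ge0}$ be a stationary autoregressive process of order one, $U_k=\kappa^{1/\alpha}U_{k-1}+Q_k$ for $k\ge1$, where $U_0$ is independent of the i.i.d. sequence $Q_1,Q_2,\dots$, whose members have characteristic function $$\mathbb E\big[e^{\mathrm i tQ_k}\big]=\exp\Big(\frac{\Gamma(2-\alpha)}{\alpha-1}\,c|t|^\alpha\Big(\cos\Big(\frac{\pi\alpha}2\Big)-\mathrm i\sin\Big(\frac{\pi\alpha}2\Big)\operatorname{sign}(t)\Big)\Big),\qquad t\in\mathbb R,$$ and let $(U_k)_{k\ge0}$ be independent of (a copy of) $W(\alpha\theta)$. Then $$\kappa^{-n/\alpha}\big(W(\theta)-W_n(\theta)\big)\ \xrightarrow{\ \mathrm d\ }\ W(\alpha\theta)^{1/\alpha}\,U_0\qquad(n\to\infty),$$ and, for every $t\in\mathbb R$, $$\mathbb E\big[e^{\mathrm i tW(\alpha\theta)^{1/\alpha}U_0}\big]=\mathbb E\bigg[\exp\bigg(\frac{\Gamma(2-\alpha)}{\alpha-1}\,\frac{c\,W(\alpha\theta)}{1-\kappa}\,|t|^\alpha\Big(\cos\Big(\frac{\pi\alpha}2\Big)-\mathrm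 i\sin\Big(\frac{\pi\alpha}2\Big)\operatorname{sign}(t)\Big)\bigg)\bigg].$$ -/

import Mathlib

open MeasureTheory ProbabilityTheory Filter Topology
open scoped ENNReal

namespace BRW

noncomputable section

/-! Individuals are finite words over `ℕ`.  A word is stored with its last letter first: `[]` is the
ancestor and `j :: u` is the `j`-th child of `u`, children being numbered from `0`.
`N u` is the number of children of `u` (possibly infinite) and `X u j`, for `j < N u`, is the
displacement of the `j`-th child of `u` relative to `u`. -/

section Trees

variable {Ω : Type*}

/-- The reproduction data of the individual `u`: the number of children together with their
displacements.  The irrelevant values `X u j` with `j ≥ N u` are replaced by `0`. -/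
def mark (N : List ℕ → Ω → ℕ∞) (X : List ℕ → ℕ → Ω → ℝ) (u : List ℕ) (ω : Ω) : ℕ∞ × (ℕ → ℝ) :=
  open Classical in (N u ω, fun j => if (j : ℕ∞) < N u ω then X u j ω else 0)

/-- The position of an individual. -/
def S (X : List ℕ → ℕ → Ω → ℝ) : List ℕ → Ω → ℝ
  | [], _ => 0
  | j :: u, ω => S X u ω + X u j ω

/-- The word `u` is an individual that is actually born. -/
def Born (N : List ℕ → Ω → ℕ∞) : List ℕ → Ω → Prop
  | [], _ => True
  | j :: u, ω => Born N u ω ∧ (j : ℕ∞) < N u ω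

/-- The offspring point process of the individual `u`, relative to the position of `u`. -/
def offspring (N : List ℕ → Ω → ℕ∞) (X : List ℕ → ℕ → Ω → ℝ) (u : List ℕ) (ω : Ω) : Measure ℝ :=
  Measure.sum fun j : {j : ℕ // (j : ℕ∞) < N u ω} => Measure.dirac (X u j ω)

/-- The point process of the positions of the individuals of generation `n`. -/
def generation (N : List ℕ → Ω → ℕ∞) (X : List ℕ → ℕ → Ω → ℝ) (n : ℕ) (ω : Ω) : Measure ℝ :=
  Measure.sum fun u : {u : List ℕ // u.length = n ∧ Born N u ω} => Measure.dirac (S X u ω)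

end Trees

section Martingale

variable {Ω : Type*} [MeasurableSpace Ω]

/-- The reproduction data of the different individuals are independent and identically distributed.
Nothing is assumed about the joint law of the data of one individual. -/
structure IsBranchingRandomWalk (P : Measure Ω) (N : List ℕ → Ω → ℕ∞)
    (X : List ℕ → ℕ → Ω → ℝ) : Prop where
  measurable_mark : ∀ u, Measurable (mark N X u)
  indep_mark : iIndepFun (mark N X) P
  identDistrib_mark : ∀ u, IdentDistrib (mark N X u) (mark N X []) P P

/-- The Laplace transform `m(θ) = E ∫ exp(-θ x) 𝒵(dx) ∈ [0, ∞]` of the intensity measure of the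
offspring point process. -/
def m (P : Measure Ω) (N : List ℕ → Ω → ℕ∞) (X : List ℕ → ℕ → Ω → ℝ) (θ : ℝ) : ℝ≥0∞ :=
  ∫⁻ ω, ∫⁻ x, ENNReal.ofReal (Real.exp (-θ * x)) ∂(offspring N X [] ω) ∂P

/-- The additive martingale `W_n(θ) = m(θ)^{-n} ∫ exp(-θ x) 𝒵_n(dx)`, with values in `[0, ∞]`. -/
def Wext (P : Measure Ω) (N : List ℕ → Ω → ℕ∞) (X : List ℕ → ℕ → Ω → ℝ) (θ : ℝ) (n : ℕ)
    (ω : Ω) : ℝ≥0∞ :=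
  (∫⁻ x, ENNReal.ofReal (Real.exp (-θ * x)) ∂(generation N X n ω)) / (m P N X θ) ^ n

/-- The additive martingale `W_n(θ)`, as a real random variable. -/
def W (P : Measure Ω) (N : List ℕ → Ω → ℕ∞) (X : List ℕ → ℕ → Ω → ℝ) (θ : ℝ) (n : ℕ)
    (ω : Ω) : ℝ :=
  (Wext P N X θ n ω).toReal

/-- The almost sure limit `W(θ)` of the additive martingale; it is written as an upper limit, so
that it is defined everywhere. -/
def Wlim (P : Measure Ω) (N : List ℕ → Ω → ℕ∞) (X : List ℕ → ℕ → Ω → ℝ) (θ : ℝ) (ω : Ω) : ℝ :=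
  (limsup (fun n => Wext P N X θ n ω) atTop).toReal

/-- `κ = m(αθ) / m(θ)^α`, with values in `[0, ∞]`. -/
def kappa (P : Measure Ω) (N : List ℕ → Ω → ℕ∞) (X : List ℕ → ℕ → Ω → ℝ) (α θ : ℝ) : ℝ≥0∞ :=
  m P N X (α * θ) / (m P N X θ) ^ α

end Martingale

/-- The exponent `Γ(2-α)/(α-1) · a · |t|^α (cos(πα/2) - i sin(πα/2) sign t)`. -/
def stableExponent (α a t : ℝ) : ℂ :=
  ((Real.Gamma (2 - α) / (α - 1) * a * |t| ^ α : ℝ) : ℂ) *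
    ((Real.cos (Real.pi * α / 2) : ℂ) -
      Complex.I * (Real.sin (Real.pi * α / 2) : ℂ) * (Real.sign t : ℂ))

/-- `U` is a stationary autoregressive process of order one with parameter `φ`, driven by i.i.d.
spectrally positive `α`-stable innovations with scale constant `c`: `U (k+1) = φ U k + Q k`, so that
`Q k` is the `(k+1)`-st innovation. -/
structure IsStationaryStableAR {Ω' : Type*} [MeasurableSpace Ω'] (P' : Measure Ω') (α c φ : ℝ)
    (U Q : ℕ → Ω' → ℝ) : Prop where
  measurable_U : ∀ k, Measurable (U k)
  measurable_Q : ∀ k, Measurable (Q k)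
  recursion : ∀ k, ∀ᵐ ω ∂P', U (k + 1) ω = φ * U k ω + Q k ω
  indep_Q : iIndepFun Q P'
  charFun_Q : ∀ k t, charFun (P'.map (Q k)) t = Complex.exp (stableExponent α c t)
  indep_U_zero : IndepFun (U 0) (fun ω k => Q k ω) P'
  stationary : ∀ l, IdentDistrib (fun ω k => U (k + l) ω) (fun ω k => U k ω) P' P'

end

end BRW

/-!
Write `e^{-θ S(u)} / m(θ)^n` as the product of the factors `e^{-θ X_j(v)} / m(θ)` along the ancestral
line of `u`; children that are not born get the factor zero.  Then `W_n(θ)` is the total weight of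
generation `n` of a multiplicative cascade with mean factor sum one, a nonnegative martingale.  Raising
the factors to the power `α` and dividing by `κ` gives the cascade of `W_n(αθ)`, so that the `α`-th
powers of the weights of generation `n` sum up to `κ^n W_n(αθ)`.

Given the first `n` generations, `W_{n+1}(θ) - W_n(θ) = ∑_{|u|=n} w_u (ξ_u - 1)`, with `w_u` the
weights and `ξ_u` independent copies of `W_1(θ)`.  The tail assumption yields
`E e^{is(ξ-1)} = exp(Ψ(s)) + o(|s|^α)` as `s → 0`, with `Ψ` the exponent of the stable law of `Q_k`:
the Taylor remainder is an integral against the tail, and after rescaling it converges to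
`∫ (e^{iy} - 1) y^{-α} dy`, which is computed with the Gamma function
(`norm_integral_expI_sub_exp_stableExponent_le`).  Since `Ψ(rs) = r^α Ψ(s)` for `r ≥ 0`, the product of
these characteristic functions at the arguments `κ^{-n/α} t w_u` is close to `exp(Ψ(t) W_n(αθ))`,
provided that the largest weight is small (`IsCascade.norm_integral_mul_step_le`).

The largest weight of the tilted cascade does tend to zero in probability
(`IsCascade.tendsto_exists_le_weight`).  A weighted first moment turns the logarithms of the weights
along a line of descent into a random walk.  Its steps do not vanish because the mean number of
children exceeds one, so it leaves every bounded interval; and by Markov's inequality no weight is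
large.

Removing the increments one at a time, the last one first, and using that `W_n(αθ)` converges, the
characteristic function of `κ^{-n/α} (W_{n+K}(θ) - W_n(θ))` tends to that of the mixture with exponent
`Ψ(t) (1 + κ + ⋯ + κ^{K-1}) W(αθ)` (`tendsto_integral_expI_increment`).  The generations after `n + K`
change it by `O(κ^K)` uniformly in `n`, since `|E e^{is(ξ-1)} - 1| ≤ C |s|^α` for all `s`
(`norm_integral_expI_limTotal_sub_le`); hence the limit as `K → ∞` may be taken.  On the other side,
iterating the autoregressive recursion shows that `U_0` has the exponent `Ψ / (1 - κ)`
(`IsStationaryStableAR.charFun_zero`).  Both characteristic functions agree, and Lévy's continuity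
theorem finishes the proof.
-/

set_option linter.unusedSectionVars false

namespace BRW

open scoped NNReal

/-! ### An oscillatory integral -/

theorem integrableOn_min_mul_rpow {α : ℝ} (hα : α ∈ Set.Ioo (1 : ℝ) 2) :
    IntegrableOn (fun y : ℝ => min y 1 * y ^ (-α)) (Set.Ioi 0) := by
  rw [← Set.Ioc_union_Ioi_eq_Ioi (zero_le_one (α := ℝ))]
  refine IntegrableOn.union ?_ ?_
  · have h : IntegrableOn (fun y : ℝ => y ^ (1 - α)) (Set.Ioc 0 1) := by
      rw [← intervalIntegrable_iff_integrableOn_Ioc_of_le zero_le_one]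
      exact intervalIntegral.intervalIntegrable_rpow' (by linarith [hα.2])
    refine h.congr_fun (fun y hy => ?_) measurableSet_Ioc
    simp only [min_eq_left hy.2]
    rw [sub_eq_add_neg, Real.rpow_add hy.1, Real.rpow_one]
  · have h : IntegrableOn (fun y : ℝ => y ^ (-α)) (Set.Ioi 1) :=
      integrableOn_Ioi_rpow_of_lt (by linarith [hα.1]) zero_lt_one
    refine h.congr_fun (fun y hy => ?_) measurableSet_Ioi
    simp only [min_eq_right (le_of_lt (Set.mem_Ioi.1 hy)), one_mul]

theorem norm_exp_sub_one_le_min {z : ℂ} (hz : z.re ≤ 0) :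
    ‖Complex.exp z - 1‖ ≤ 2 * min ‖z‖ 1 := by
  rcases le_total ‖z‖ 1 with h | h
  · rw [min_eq_left h]; exact Complex.norm_exp_sub_one_le h
  · rw [min_eq_right h]
    have : ‖Complex.exp z‖ ≤ 1 := by rw [Complex.norm_exp]; exact Real.exp_le_one_iff.2 hz
    calc _ ≤ ‖Complex.exp z‖ + ‖(1 : ℂ)‖ := norm_sub_le _ _
      _ ≤ _ := by rw [norm_one]; linarith

theorem norm_exp_sub_one_mul_rpow_le {α : ℝ} {r : ℂ} (hr : 0 ≤ r.re) {R : ℝ} (hR : ‖r‖ ≤ R)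
    (hR1 : 1 ≤ R) {y : ℝ} (hy : 0 < y) :
    ‖(Complex.exp (-(r * y)) - 1) * ((y ^ (-α) : ℝ) : ℂ)‖ ≤ 2 * R * (min y 1 * y ^ (-α)) := by
  have hy' : 0 ≤ y ^ (-α) := Real.rpow_nonneg hy.le _
  rw [norm_mul, Complex.norm_of_nonneg hy', ← mul_assoc]
  refine mul_le_mul_of_nonneg_right ?_ hy'
  refine (norm_exp_sub_one_le_min ?_).trans ?_
  · simp only [Complex.neg_re, Complex.re_mul_ofReal]
    have := mul_nonneg hr hy.le
    linarith
  · rw [norm_neg, norm_mul, Complex.norm_of_nonneg hy.le, mul_assoc]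
    refine mul_le_mul_of_nonneg_left ?_ (by norm_num)
    rcases le_total y 1 with h | h
    · rw [min_eq_left h]
      exact (min_le_left _ _).trans (mul_le_mul_of_nonneg_right hR hy.le)
    · rw [min_eq_right h]
      exact (min_le_right _ _).trans (by linarith)

theorem aestronglyMeasurable_exp_sub_one_mul_rpow (α : ℝ) (r : ℂ) (μ : Measure ℝ) :
    AEStronglyMeasurable
      (fun y : ℝ => (Complex.exp (-(r * y)) - 1) * ((y ^ (-α) : ℝ) : ℂ)) μ := by
  refine Measurable.aestronglyMeasurable ?_
  fun_prop

/-- The integral `∫₀^∞ (e^{-ry} - 1) y^{-α} dy` for real `r > 0`, by integration by parts. -/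
theorem integral_exp_sub_one_mul_rpow_of_pos {α : ℝ} (hα : α ∈ Set.Ioo (1 : ℝ) 2) {r : ℝ}
    (hr : 0 < r) :
    ∫ y in Set.Ioi (0 : ℝ), (Real.exp (-(r * y)) - 1) * y ^ (-α) =
      Real.Gamma (2 - α) / (1 - α) * r ^ (α - 1) := by
  have h1 : 1 - α ≠ 0 := by linarith [hα.1]
  have hbd : IntegrableOn (fun y : ℝ => (Real.exp (-(r * y)) - 1) * y ^ (-α)) (Set.Ioi 0) := by
    refine ((integrableOn_min_mul_rpow hα).const_mul (2 * max r 1)).mono'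
      (by refine Measurable.aestronglyMeasurable ?_; fun_prop) ?_
    filter_upwards [ae_restrict_mem measurableSet_Ioi] with y hy
    have := norm_exp_sub_one_mul_rpow_le (α := α) (r := r) (R := max r 1) (by simpa using hr.le)
      (by rw [Complex.norm_of_nonneg hr.le]; exact le_max_left _ _) (le_max_right _ _) hy
    refine le_trans (le_of_eq ?_) this
    rw [← Complex.norm_real]; push_cast; rfl
  have hGint : IntegrableOn (fun y : ℝ => (-r * Real.exp (-(r * y))) * (y ^ (1 - α) / (1 - α)))
      (Set.Ioi 0) := by
    have : IntegrableOn (fun y : ℝ => -r / (1 - α) * (y ^ (1 - α) * Real.exp (-r * y ^ (1 : ℝ))))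
        (Set.Ioi 0) := (integrableOn_rpow_mul_exp_neg_mul_rpow (p := 1) (s := 1 - α) (b := r)
      (by linarith [hα.2]) zero_lt_one hr).const_mul (-r / (1 - α))
    refine this.congr_fun (fun y hy => ?_) measurableSet_Ioi
    simp only [Real.rpow_one]
    ring_nf
  have key := integral_Ioi_mul_deriv_eq_deriv_mul (a := (0 : ℝ)) (a' := (0 : ℝ)) (b' := (0 : ℝ))
    (u := fun y : ℝ => Real.exp (-(r * y)) - 1) (u' := fun y : ℝ => -r * Real.exp (-(r * y)))
    (v := fun y : ℝ => y ^ (1 - α) / (1 - α)) (v' := fun y : ℝ => y ^ (-α))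
    (fun y _ => by
      have : HasDerivAt (fun y : ℝ => -(r * y)) (-r) y := by
        simpa using ((hasDerivAt_id y).const_mul r).fun_neg
      have := this.exp.sub_const 1
      rw [mul_comm (-r)]; exact this)
    (fun y hy => by
      have := (Real.hasDerivAt_rpow_const (x := y) (p := 1 - α)
        (Or.inl (ne_of_gt hy))).div_const (1 - α)
      convert this using 1
      rw [mul_comm, mul_div_assoc, div_self h1, mul_one]
      congr 1; ring)
    hbd hGint ?_ ?_
  · rw [key]
    have hG := Real.integral_rpow_mul_exp_neg_mul_Ioi (a := 2 - α) (r := r)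
      (by linarith [hα.2]) hr
    have e : ∫ y in Set.Ioi (0 : ℝ), -r * Real.exp (-(r * y)) * (y ^ (1 - α) / (1 - α)) =
        (-r / (1 - α)) * ∫ y in Set.Ioi (0 : ℝ), y ^ (2 - α - 1) * Real.exp (-(r * y)) := by
      rw [← integral_const_mul]
      refine setIntegral_congr_fun measurableSet_Ioi (fun y hy => ?_)
      rw [show 2 - α - 1 = 1 - α by ring]; ring
    rw [e, hG, one_div, Real.inv_rpow hr.le, ← Real.rpow_neg hr.le]
    have : r ^ (α - 1) = r * r ^ (-(2 - α)) := by
      conv_rhs => rw [← Real.rpow_one_add' hr.le (by intro h; linarith [hα.1])]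
      congr 1; ring
    rw [this]; ring
  · -- near `0` the product is at most a constant times `y ^ (2 - α)`
    have hlim : Tendsto (fun y : ℝ => (2 * max r 1 / (α - 1)) * y ^ (2 - α)) (𝓝[>] 0) (𝓝 0) := by
      have : Tendsto (fun y : ℝ => y ^ (2 - α)) (𝓝[>] 0) (𝓝 0) := by
        have := (Real.continuousAt_rpow_const 0 (2 - α) (Or.inr (by linarith [hα.2]))).tendsto
        rw [Real.zero_rpow (by linarith [hα.2])] at this
        exact this.mono_left nhdsWithin_le_nhds
      simpa using this.const_mul (2 * max r 1 / (α - 1))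
    refine squeeze_zero_norm' ?_ hlim
    filter_upwards [self_mem_nhdsWithin, Ioo_mem_nhdsGT (zero_lt_one (α := ℝ))] with y hy hy1
    have hy0 : (0 : ℝ) < y := hy
    have := norm_exp_sub_one_mul_rpow_le (α := α) (r := r) (R := max r 1) (by simpa using hr.le)
      (by rw [Complex.norm_of_nonneg hr.le]; exact le_max_left _ _) (le_max_right _ _) hy0
    rw [min_eq_left hy1.2.le] at this
    have e : ((Real.exp (-(r * y)) - 1) * y ^ (-α)) * (y / (1 - α)) =
        (Real.exp (-(r * y)) - 1) * (y ^ (1 - α) / (1 - α)) := by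
      rw [sub_eq_add_neg 1 α, Real.rpow_add hy0, Real.rpow_one]; ring
    simp only [Pi.mul_apply]
    rw [← e, norm_mul]
    have e2 : ‖(Real.exp (-(r * y)) - 1) * y ^ (-α)‖ =
        ‖(Complex.exp (-((r : ℂ) * y)) - 1) * ((y ^ (-α) : ℝ) : ℂ)‖ := by
      rw [← Complex.norm_real]; push_cast; rfl
    have e3 : ‖y / (1 - α)‖ = y / (α - 1) := by
      rw [norm_div, Real.norm_of_nonneg hy0.le, Real.norm_eq_abs, abs_of_neg (by linarith [hα.1])]
      ring
    rw [e2, e3]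
    calc _ ≤ 2 * max r 1 * (y * y ^ (-α)) * (y / (α - 1)) := by
          refine mul_le_mul_of_nonneg_right this (div_nonneg hy0.le (by linarith [hα.1]))
      _ = _ := by
        rw [show 2 - α = 1 + (1 + -α) by ring, Real.rpow_add hy0, Real.rpow_add hy0,
          Real.rpow_one]; ring
  · have h2 : Tendsto (fun y : ℝ => y ^ (1 - α) / (1 - α)) atTop (𝓝 0) := by
      have := (tendsto_rpow_neg_atTop (y := α - 1) (by linarith [hα.1])).div_const (1 - α)
      simpa [neg_sub] using this
    have h3 : Tendsto (fun y : ℝ => Real.exp (-(r * y)) - 1) atTop (𝓝 (0 - 1)) := by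
      refine Tendsto.sub_const ?_ 1
      exact Real.tendsto_exp_neg_atTop_nhds_zero.comp (tendsto_id.const_mul_atTop hr)
    have := h3.mul h2
    rwa [mul_zero] at this

/-- The integral `∫₀^∞ (e^{-ry} - 1) y^{-α} dy` for complex `r` with positive real part, by analytic
continuation from the positive half-line. -/
theorem integral_exp_sub_one_mul_rpow_of_re_pos {α : ℝ} (hα : α ∈ Set.Ioo (1 : ℝ) 2) {r : ℂ}
    (hr : 0 < r.re) :
    ∫ y in Set.Ioi (0 : ℝ), (Complex.exp (-(r * y)) - 1) * ((y ^ (-α) : ℝ) : ℂ) =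
      ((Real.Gamma (2 - α) / (1 - α) : ℝ) : ℂ) * r ^ ((α - 1 : ℝ) : ℂ) := by
  set F : ℂ → ℂ := fun r =>
    ∫ y in Set.Ioi (0 : ℝ), (Complex.exp (-(r * y)) - 1) * ((y ^ (-α) : ℝ) : ℂ) with hF
  set G : ℂ → ℂ := fun r => ((Real.Gamma (2 - α) / (1 - α) : ℝ) : ℂ) * r ^ ((α - 1 : ℝ) : ℂ) with hG
  set H : Set ℂ := {z | 0 < z.re} with hH
  have hHo : IsOpen H := isOpen_lt continuous_const Complex.continuous_re
  have hint : ∀ r : ℂ, 0 ≤ r.re → IntegrableOn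
      (fun y : ℝ => (Complex.exp (-(r * y)) - 1) * ((y ^ (-α) : ℝ) : ℂ)) (Set.Ioi 0) := by
    intro r hr
    refine ((integrableOn_min_mul_rpow hα).const_mul (2 * max ‖r‖ 1)).mono'
      (aestronglyMeasurable_exp_sub_one_mul_rpow α r _) ?_
    filter_upwards [ae_restrict_mem measurableSet_Ioi] with y hy
    exact norm_exp_sub_one_mul_rpow_le hr (le_max_left _ _) (le_max_right _ _) hy
  have hFd : DifferentiableOn ℂ F H := by
    intro r0 hr0
    have hr0' : 0 < r0.re := hr0
    have hball : Metric.ball r0 (r0.re / 2) ∈ 𝓝 r0 := Metric.ball_mem_nhds _ (by linarith)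
    have hre : ∀ x ∈ Metric.ball r0 (r0.re / 2), r0.re / 2 ≤ x.re := by
      intro x hx
      have h1 : |(x - r0).re| ≤ ‖x - r0‖ := Complex.abs_re_le_norm _
      rw [Metric.mem_ball, dist_eq_norm] at hx
      have := (abs_le.1 (h1.trans hx.le)).1
      simp only [Complex.sub_re] at this
      linarith
    have := hasDerivAt_integral_of_dominated_loc_of_deriv_le (μ := volume.restrict (Set.Ioi (0:ℝ)))
      (F := fun (r : ℂ) (y : ℝ) => (Complex.exp (-(r * y)) - 1) * ((y ^ (-α) : ℝ) : ℂ))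
      (F' := fun (r : ℂ) (y : ℝ) => (Complex.exp (-(r * y)) * (-y)) * ((y ^ (-α) : ℝ) : ℂ))
      (x₀ := r0) (bound := fun y : ℝ => y ^ (1 - α) * Real.exp (-(r0.re / 2) * y ^ (1 : ℝ)))
      hball
      (Eventually.of_forall fun r => aestronglyMeasurable_exp_sub_one_mul_rpow α r _)
      (hint r0 hr0'.le)
      (by refine Measurable.aestronglyMeasurable ?_; fun_prop)
      (by
        filter_upwards [ae_restrict_mem measurableSet_Ioi] with y hy x hx
        have hy0 : (0 : ℝ) < y := hy
        rw [norm_mul, norm_mul, norm_neg, Complex.norm_of_nonneg hy0.le,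
          Complex.norm_of_nonneg (Real.rpow_nonneg hy0.le _), Complex.norm_exp, Real.rpow_one]
        have e : y ^ (1 - α) = y * y ^ (-α) := by
          rw [sub_eq_add_neg, Real.rpow_add hy0, Real.rpow_one]
        rw [e, mul_assoc, mul_comm]
        refine mul_le_mul_of_nonneg_left (Real.exp_le_exp.2 ?_)
          (mul_nonneg hy0.le (Real.rpow_nonneg hy0.le _))
        simp only [Complex.neg_re, Complex.re_mul_ofReal]
        have := mul_le_mul_of_nonneg_right (hre x hx) hy0.le
        linarith)
      (integrableOn_rpow_mul_exp_neg_mul_rpow (by linarith [hα.2]) zero_lt_one (by linarith))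
      (by
        filter_upwards with y x _
        refine HasDerivAt.mul_const ?_ _
        refine HasDerivAt.sub_const _ ?_
        refine HasDerivAt.cexp ?_
        simpa using ((hasDerivAt_id x).mul_const (y : ℂ)).fun_neg)
    exact this.2.differentiableAt.differentiableWithinAt
  have hGd : DifferentiableOn ℂ G H := by
    intro z hz
    refine DifferentiableAt.differentiableWithinAt ?_
    refine DifferentiableAt.const_mul ?_ _
    exact differentiableAt_id.cpow_const (Or.inl hz)
  have hpre : IsPreconnected H := (convex_halfSpace_re_gt 0).isPreconnected
  have hmem : (1 : ℂ) ∈ H := by simp [hH]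
  have hreal : ∀ x : ℝ, 0 < x → F x = G x := by
    intro x hx
    have h := integral_exp_sub_one_mul_rpow_of_pos hα hx
    simp only [hF, hG]
    rw [← Complex.ofReal_cpow hx.le, ← Complex.ofReal_mul, ← h, ← integral_complex_ofReal]
    refine setIntegral_congr_fun measurableSet_Ioi (fun y _ => ?_)
    push_cast; rfl
  have hfreq : ∃ᶠ z in 𝓝[≠] (1 : ℂ), F z = G z := by
    have ht : Tendsto (fun x : ℝ => (x : ℂ)) (𝓝[≠] (1 : ℝ)) (𝓝[≠] (1 : ℂ)) := by
      refine tendsto_nhdsWithin_of_tendsto_nhds_of_eventually_within _ ?_ ?_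
      · have := Complex.continuous_ofReal.tendsto (1 : ℝ)
        rw [Complex.ofReal_one] at this
        exact this.mono_left nhdsWithin_le_nhds
      · filter_upwards [self_mem_nhdsWithin] with x hx
        simpa using hx
    refine ht.frequently (Eventually.frequently ?_)
    filter_upwards [nhdsWithin_le_nhds (Ioi_mem_nhds (zero_lt_one (α := ℝ)))] with x hx
    exact hreal x hx
  exact (hFd.analyticOnNhd hHo).eqOn_of_preconnected_of_frequently_eq (hGd.analyticOnNhd hHo)
    hpre hmem hfreq hr

/-- The oscillatory integral `∫₀^∞ (e^{iy} - 1) y^{-α} dy` for `1 < α < 2`, as the limit `r → -i` of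
the integrals with damping factor. -/
theorem integral_exp_I_sub_one_mul_rpow {α : ℝ} (hα : α ∈ Set.Ioo (1 : ℝ) 2) :
    ∫ y in Set.Ioi (0 : ℝ), (Complex.exp (Complex.I * y) - 1) * ((y ^ (-α) : ℝ) : ℂ) =
      ((Real.Gamma (2 - α) / (1 - α) : ℝ) : ℂ) * (-Complex.I) ^ ((α - 1 : ℝ) : ℂ) := by
  have hr : Tendsto (fun n : ℕ => ((1 / ((n : ℝ) + 1) : ℝ) : ℂ) - Complex.I) atTop
      (𝓝 (-Complex.I)) := by
    have := (Complex.continuous_ofReal.tendsto 0).comp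
      (tendsto_one_div_add_atTop_nhds_zero_nat (𝕜 := ℝ))
    simpa using this.sub_const Complex.I
  have hpos : ∀ n : ℕ, 0 < (((1 / ((n : ℝ) + 1) : ℝ) : ℂ) - Complex.I).re := by
    intro n
    simp only [Complex.sub_re, Complex.ofReal_re, Complex.I_re, sub_zero]
    positivity
  have hnorm : ∀ n : ℕ, ‖((1 / ((n : ℝ) + 1) : ℝ) : ℂ) - Complex.I‖ ≤ 2 := by
    intro n
    refine (norm_sub_le _ _).trans ?_
    rw [Complex.norm_I, Complex.norm_of_nonneg (by positivity)]
    have : 1 / ((n : ℝ) + 1) ≤ 1 := by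
      rw [div_le_one (by positivity)]; linarith [Nat.cast_nonneg (α := ℝ) n]
    linarith
  have hL := tendsto_integral_of_dominated_convergence (μ := volume.restrict (Set.Ioi (0:ℝ)))
    (F := fun (n : ℕ) (y : ℝ) =>
      (Complex.exp (-((((1 / ((n : ℝ) + 1) : ℝ) : ℂ) - Complex.I) * y)) - 1) *
        ((y ^ (-α) : ℝ) : ℂ))
    (f := fun y : ℝ => (Complex.exp (Complex.I * y) - 1) * ((y ^ (-α) : ℝ) : ℂ))
    (fun y => 2 * 2 * (min y 1 * y ^ (-α)))
    (fun n => aestronglyMeasurable_exp_sub_one_mul_rpow α _ _)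
    ((integrableOn_min_mul_rpow hα).const_mul _)
    (fun n => by
      filter_upwards [ae_restrict_mem measurableSet_Ioi] with y hy
      exact norm_exp_sub_one_mul_rpow_le (hpos n).le (hnorm n) one_le_two hy)
    (by
      filter_upwards with y
      refine Tendsto.mul_const _ ?_
      refine Tendsto.sub_const ?_ 1
      refine (Complex.continuous_exp.tendsto _).comp ?_
      have := (hr.mul_const (y : ℂ)).neg
      simpa using this)
  have hR : Tendsto (fun n : ℕ => ((Real.Gamma (2 - α) / (1 - α) : ℝ) : ℂ) *
      (((1 / ((n : ℝ) + 1) : ℝ) : ℂ) - Complex.I) ^ ((α - 1 : ℝ) : ℂ)) atTop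
      (𝓝 (((Real.Gamma (2 - α) / (1 - α) : ℝ) : ℂ) * (-Complex.I) ^ ((α - 1 : ℝ) : ℂ))) := by
    refine Tendsto.const_mul _ ?_
    refine ((continuousAt_cpow_const (b := ((α - 1 : ℝ) : ℂ)) ?_).tendsto).comp hr
    simp [Complex.mem_slitPlane_iff]
  refine tendsto_nhds_unique hL (hR.congr fun n => ?_)
  exact (integral_exp_sub_one_mul_rpow_of_re_pos hα (hpos n)).symm

/-- The oscillatory integral in terms of the stable exponent, since
`(-i)^{α-1} = i (cos (πα/2) - i sin (πα/2))`. -/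
theorem I_mul_integral_exp_I_sub_one_mul_rpow {α : ℝ} (hα : α ∈ Set.Ioo (1 : ℝ) 2) (c : ℝ) :
    Complex.I * (c * ∫ y in Set.Ioi (0 : ℝ),
      (Complex.exp (Complex.I * y) - 1) * ((y ^ (-α) : ℝ) : ℂ)) = stableExponent α c 1 := by
  have h1 : 1 - α ≠ 0 := by linarith [hα.1]
  have h2 : α - 1 ≠ 0 := by linarith [hα.1]
  rw [integral_exp_I_sub_one_mul_rpow hα, stableExponent]
  have e : (-Complex.I) ^ ((α - 1 : ℝ) : ℂ) =
      Complex.I * ((Real.cos (Real.pi * α / 2) : ℂ) - Complex.I * (Real.sin (Real.pi * α / 2) : ℂ)) := by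
    rw [Complex.cpow_def_of_ne_zero (by simp), Complex.log_neg_I]
    have : -(Real.pi / 2 : ℂ) * Complex.I * ((α - 1 : ℝ) : ℂ) =
      (Real.pi / 2 : ℂ) * Complex.I + ((-(Real.pi * α / 2) : ℝ) : ℂ) * Complex.I := by
      push_cast; ring
    rw [this, Complex.exp_add, Complex.exp_pi_div_two_mul_I, Complex.exp_mul_I,
      ← Complex.ofReal_cos, ← Complex.ofReal_sin, Real.cos_neg, Real.sin_neg]
    push_cast; ring
  rw [e]
  have hG : Real.Gamma (2 - α) / (1 - α) = -(Real.Gamma (2 - α) / (α - 1)) := by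
    rw [← neg_sub α 1, div_neg]
  rw [hG]
  simp only [Real.sign_one, abs_one, Real.one_rpow]
  push_cast
  have hI : Complex.I * Complex.I = -1 := Complex.I_mul_I
  linear_combination (-(c : ℂ) * ((Real.Gamma (2 - α) : ℝ) / (α - 1)) *
    (Complex.cos (Real.pi * α / 2) - Complex.I * Complex.sin (Real.pi * α / 2))) * hI

/-! ### Characteristic functions of positive variables with regularly varying tails -/

/-- The character `x ↦ e^{ix}` of the real line. -/
noncomputable def expI (x : ℝ) : ℂ := Complex.exp (x * Complex.I)

@[simp] theorem norm_expI (x : ℝ) : ‖expI x‖ = 1 := Complex.norm_exp_ofReal_mul_I x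

@[simp] theorem expI_zero : expI 0 = 1 := by simp [expI]

theorem expI_add (x y : ℝ) : expI (x + y) = expI x * expI y := by
  simp [expI, add_mul, Complex.exp_add]

theorem expI_neg (x : ℝ) : expI (-x) = (starRingEnd ℂ) (expI x) := by
  rw [expI, expI, ← Complex.exp_conj]; simp

theorem continuous_expI : Continuous expI := by unfold expI; fun_prop

@[fun_prop] theorem measurable_expI : Measurable expI := continuous_expI.measurable

theorem integrable_expI {Ω : Type*} [MeasurableSpace Ω] {P : Measure Ω} [IsFiniteMeasure P]
    {f : Ω → ℝ} (hf : AEMeasurable f P) : Integrable (fun ω => expI (f ω)) P :=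
  (integrable_const (1 : ℝ)).mono' (measurable_expI.comp_aemeasurable hf).aestronglyMeasurable
    (ae_of_all _ fun ω => by simp)

theorem norm_integral_expI_le {Ω : Type*} [MeasurableSpace Ω] {P : Measure Ω}
    [IsProbabilityMeasure P] (f : Ω → ℝ) : ‖∫ ω, expI (f ω) ∂P‖ ≤ 1 := by
  refine (norm_integral_le_of_norm_le_const (C := 1) (ae_of_all _ fun ω => by simp)).trans ?_
  simp

theorem charFun_map_eq_integral_expI {Ω : Type*} [MeasurableSpace Ω] {P : Measure Ω} {f : Ω → ℝ}
    (hf : AEMeasurable f P) (t : ℝ) : charFun (P.map f) t = ∫ ω, expI (t * f ω) ∂P := by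
  rw [charFun_apply_real, integral_map hf (Measurable.aestronglyMeasurable (by fun_prop))]
  refine integral_congr_ae (ae_of_all _ fun ω => ?_)
  simp [expI]

theorem stableExponent_mul (α a b t : ℝ) :
    stableExponent α (a * b) t = b * stableExponent α a t := by
  simp only [stableExponent]; push_cast; ring

theorem stableExponent_scale (α a : ℝ) {r : ℝ} (hr : 0 ≤ r) (hα : α ≠ 0) (t : ℝ) :
    stableExponent α a (r * t) = (r ^ α : ℝ) * stableExponent α a t := by
  rcases hr.eq_or_lt with rfl | hr'
  · simp [stableExponent, Real.zero_rpow hα]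
  · have : Real.sign (r * t) = Real.sign t := by
      rcases lt_trichotomy t 0 with h | h | h
      · rw [Real.sign_of_neg h, Real.sign_of_neg (mul_neg_of_pos_of_neg hr' h)]
      · simp [h]
      · rw [Real.sign_of_pos h, Real.sign_of_pos (mul_pos hr' h)]
    simp only [stableExponent, this, abs_mul, abs_of_nonneg hr, Real.mul_rpow hr (abs_nonneg t)]
    push_cast; ring

theorem stableExponent_neg (α a t : ℝ) :
    stableExponent α a (-t) = (starRingEnd ℂ) (stableExponent α a t) := by
  simp only [stableExponent, abs_neg, Real.sign_neg, map_mul, map_sub, Complex.conj_ofReal,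
    Complex.conj_I]
  push_cast; ring

theorem stableExponent_zero {α : ℝ} (hα : α ≠ 0) (a : ℝ) : stableExponent α a 0 = 0 := by
  simp [stableExponent, Real.zero_rpow hα]

/-- The angle `πα/2` lies in `[π/2, π]`, where the cosine is nonpositive. -/
theorem stableExponent_re_nonpos {α a : ℝ} (hα : α ∈ Set.Ioo (1 : ℝ) 2) (ha : 0 ≤ a) (t : ℝ) :
    (stableExponent α a t).re ≤ 0 := by
  have h : (stableExponent α a t).re =
      (Real.Gamma (2 - α) / (α - 1) * a * |t| ^ α) * Real.cos (Real.pi * α / 2) := by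
    rw [stableExponent, Complex.re_ofReal_mul, mul_assoc Complex.I, ← Complex.ofReal_mul]
    simp only [Complex.sub_re, Complex.ofReal_re, Complex.I_mul_re, Complex.ofReal_im]
    ring
  rw [h]
  refine mul_nonpos_of_nonneg_of_nonpos ?_ ?_
  · have h1 : 0 < Real.Gamma (2 - α) := Real.Gamma_pos_of_pos (by linarith [hα.2])
    have h2 : 0 < α - 1 := by linarith [hα.1]
    positivity
  · refine Real.cos_nonpos_of_pi_div_two_le_of_le ?_ ?_
    · nlinarith [Real.pi_pos, hα.1]
    · nlinarith [Real.pi_pos, hα.2]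

theorem stableExponent_of_pos (α a : ℝ) (hα : α ≠ 0) {t : ℝ} (ht : 0 < t) :
    stableExponent α a t = (t ^ α : ℝ) * stableExponent α a 1 := by
  simpa using stableExponent_scale α a ht.le hα 1

theorem norm_stableExponent {α : ℝ} (hα : α ≠ 0) (a t : ℝ) :
    ‖stableExponent α a t‖ = |t| ^ α * ‖stableExponent α a 1‖ := by
  have key : ∀ t : ℝ, 0 ≤ t → ‖stableExponent α a t‖ = |t| ^ α * ‖stableExponent α a 1‖ := by
    intro t ht
    have := stableExponent_scale α a ht hα 1
    rw [mul_one] at this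
    rw [this, norm_mul, Complex.norm_of_nonneg (Real.rpow_nonneg ht _), abs_of_nonneg ht]
  rcases le_total 0 t with ht | ht
  · exact key t ht
  · have := key (-t) (by linarith)
    rwa [stableExponent_neg, RCLike.norm_conj, abs_neg] at this

theorem integral_expI_neg {Ω : Type*} [MeasurableSpace Ω] {P : Measure Ω} (f : Ω → ℝ) :
    ∫ ω, expI (-f ω) ∂P = (starRingEnd ℂ) (∫ ω, expI (f ω) ∂P) := by
  rw [← integral_conj]; simp_rw [expI_neg]

theorem tendsto_mul_rpow_of_isEquivalent {α c : ℝ} (hc : 0 < c) {g : ℝ → ℝ}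
    (hg : Asymptotics.IsEquivalent atTop g (fun x : ℝ => c * x ^ (-α))) :
    Tendsto (fun x : ℝ => g x * x ^ α) atTop (𝓝 c) := by
  have h := (Asymptotics.isEquivalent_iff_tendsto_one (by
    filter_upwards [eventually_gt_atTop 0] with x hx
    exact (mul_pos hc (Real.rpow_pos_of_pos hx _)).ne')).1 hg
  have := h.mul_const c
  rw [one_mul] at this
  refine this.congr' ?_
  filter_upwards [eventually_gt_atTop 0] with x hx
  have hx' : 0 < x ^ α := Real.rpow_pos_of_pos hx _
  simp only [Pi.div_apply]
  rw [Real.rpow_neg hx.le]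
  field_simp

theorem tendsto_rpow_mul_sq {α : ℝ} (hα : α < 2) :
    Tendsto (fun s : ℝ => s ^ (-α) * (2 * s ^ 2)) (𝓝[>] 0) (𝓝 0) := by
  have h1 : Tendsto (fun s : ℝ => 2 * s ^ (2 - α)) (𝓝[>] 0) (𝓝 0) := by
    have := (Real.continuousAt_rpow_const 0 (2 - α) (Or.inr (by linarith))).tendsto
    rw [Real.zero_rpow (by linarith)] at this
    simpa using (this.mono_left nhdsWithin_le_nhds).const_mul 2
  refine h1.congr' ?_
  filter_upwards [self_mem_nhdsWithin] with s hs
  have hs0 : (0 : ℝ) < s := hs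
  rw [show 2 - α = -α + 2 by ring, Real.rpow_add hs0, Real.rpow_two]; ring

section OneVariable

variable {Ω : Type*} [MeasurableSpace Ω] {P : Measure Ω} [IsProbabilityMeasure P] {ξ : Ω → ℝ}

theorem measurableSet_tail_section (hξ : Measurable ξ) :
    MeasurableSet {p : Ω × ℝ | p.2 < ξ p.1} :=
  measurableSet_lt measurable_snd (hξ.comp measurable_fst)

/-- Taylor expansion of the characteristic function of a nonnegative random variable, with the
remainder written as an integral against its tail. -/
theorem integral_expI_taylor_eq_integral_tail (hξ : Measurable ξ) (hξ0 : ∀ ω, 0 ≤ ξ ω)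
    (hint : Integrable ξ P) (s : ℝ) :
    ∫ ω, (expI (s * ξ ω) - 1 - (s * ξ ω : ℝ) * Complex.I) ∂P =
      ∫ x in Set.Ioi (0 : ℝ), (s * Complex.I) * (expI (s * x) - 1) * (P.real {ω | x < ξ ω} : ℂ) := by
  set A : Set (Ω × ℝ) := {p | p.2 < ξ p.1} with hA
  have hAm : MeasurableSet A := measurableSet_tail_section hξ
  set h : ℝ → ℂ := fun x => (s * Complex.I) * (expI (s * x) - 1) with hh
  have hhc : Continuous h := by
    have := continuous_expI
    simp only [hh]; fun_prop
  have hhb : ∀ x, ‖h x‖ ≤ 2 * |s| := by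
    intro x
    simp only [hh, norm_mul, Complex.norm_real, Complex.norm_I, mul_one, Real.norm_eq_abs]
    have : ‖expI (s * x) - 1‖ ≤ 2 := by
      refine (norm_sub_le _ _).trans ?_
      rw [norm_expI, norm_one]; norm_num
    nlinarith [abs_nonneg s]
  have hint2 : Integrable (A.indicator fun p => h p.2)
      (P.prod (volume.restrict (Set.Ioi (0 : ℝ)))) := by
    rw [integrable_indicator_iff hAm]
    refine Measure.integrableOn_of_bounded (M := 2 * |s|) ?_
      (hhc.measurable.comp measurable_snd).aestronglyMeasurable (ae_of_all _ fun p => hhb p.2)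
    rw [Measure.prod_apply hAm]
    have : ∀ ω, (volume.restrict (Set.Ioi (0 : ℝ))) (Prod.mk ω ⁻¹' A) = ENNReal.ofReal (ξ ω) := by
      intro ω
      rw [Measure.restrict_apply (measurable_prodMk_left hAm)]
      have : Prod.mk ω ⁻¹' A ∩ Set.Ioi 0 = Set.Ioo 0 (ξ ω) := by
        ext x; simp [hA, and_comm]
      rw [this, Real.volume_Ioo, sub_zero]
    simp_rw [this]
    exact hint.lintegral_lt_top.ne
  have hswap := integral_integral_swap (f := fun ω x => A.indicator (fun p => h p.2) (ω, x)) hint2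
  have hd : ∀ x : ℝ, HasDerivAt
      (fun x : ℝ => expI (s * x) - 1 - (s * x : ℝ) * Complex.I) (h x) x := by
    intro x
    have h1 : HasDerivAt (fun x : ℝ => ((s * x : ℝ) : ℂ) * Complex.I) (s * Complex.I) x := by
      have := (((hasDerivAt_id x).const_mul s).ofReal_comp).mul_const Complex.I
      simpa using this
    have h2 := (h1.cexp.sub_const 1).fun_sub h1
    have e : h x = Complex.exp (((s * x : ℝ) : ℂ) * Complex.I) * (s * Complex.I) - s * Complex.I := by
      simp only [hh, expI]; ring
    rw [e]; exact h2
  have e1 : ∀ ω, ∫ x in Set.Ioi (0 : ℝ), A.indicator (fun p => h p.2) (ω, x) =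
      expI (s * ξ ω) - 1 - (s * ξ ω : ℝ) * Complex.I := by
    intro ω
    have : (fun x => A.indicator (fun p => h p.2) (ω, x)) = (Set.Iio (ξ ω)).indicator h := by
      ext x; simp [Set.indicator, hA]
    rw [this, setIntegral_indicator measurableSet_Iio, Set.Ioi_inter_Iio,
      ← integral_Ioc_eq_integral_Ioo, ← intervalIntegral.integral_of_le (hξ0 ω),
      intervalIntegral.integral_eq_sub_of_hasDerivAt (fun x _ => hd x)
        (hhc.intervalIntegrable _ _)]
    simp
  have e2 : ∀ x, ∫ ω, A.indicator (fun p => h p.2) (ω, x) ∂P =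
      h x * (P.real {ω | x < ξ ω} : ℂ) := by
    intro x
    have : (fun ω => A.indicator (fun p => h p.2) (ω, x)) =
        {ω | x < ξ ω}.indicator fun _ => h x := by
      ext ω; simp [Set.indicator, hA]
    rw [this, integral_indicator_const _ (measurableSet_lt measurable_const hξ), mul_comm]
    exact Complex.real_smul
  simp_rw [e1, e2] at hswap
  exact hswap

theorem exists_tail_mul_rpow_le {α c : ℝ} (hα : 0 < α)
    (h : Tendsto (fun x : ℝ => P.real {ω | x < ξ ω} * x ^ α) atTop (𝓝 c)) :
    ∃ C : ℝ, ∀ x : ℝ, 0 < x → P.real {ω | x < ξ ω} * x ^ α ≤ C := by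
  obtain ⟨x0, hx0⟩ := eventually_atTop.1 (h.eventually (Iic_mem_nhds (lt_add_one c)))
  refine ⟨max (c + 1) (max x0 0 ^ α), fun x hx => ?_⟩
  rcases le_total x0 x with h1 | h1
  · exact (hx0 x h1).trans (le_max_left _ _)
  · refine le_trans ?_ (le_max_right _ _)
    calc _ ≤ 1 * x ^ α := mul_le_mul_of_nonneg_right measureReal_le_one (Real.rpow_nonneg hx.le _)
      _ ≤ _ := by
        rw [one_mul]
        exact Real.rpow_le_rpow hx.le (h1.trans (le_max_left _ _)) hα.le

/-- The remainder of the first order Taylor expansion of the characteristic function of a random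
variable with tail `c x^{-α}` is asymptotically the exponent of a stable law. -/
theorem tendsto_taylor_remainder_div_rpow {α c : ℝ} (hα : α ∈ Set.Ioo (1 : ℝ) 2)
    (hξ : Measurable ξ) (hξ0 : ∀ ω, 0 ≤ ξ ω) (hint : Integrable ξ P)
    (htail : Tendsto (fun x : ℝ => P.real {ω | x < ξ ω} * x ^ α) atTop (𝓝 c)) :
    Tendsto (fun s : ℝ => ((s ^ (-α) : ℝ) : ℂ) *
        ∫ ω, (expI (s * ξ ω) - 1 - (s * ξ ω : ℝ) * Complex.I) ∂P)
      (𝓝[>] 0) (𝓝 (stableExponent α c 1)) := by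
  obtain ⟨C, hC⟩ := exists_tail_mul_rpow_le (P := P) (ξ := ξ) (by linarith [hα.1]) htail
  have hC0 : 0 ≤ C := le_trans (by positivity) (hC 1 one_pos)
  set G : ℝ → ℝ := fun x => P.real {ω | x < ξ ω} * x ^ α with hG
  have hgm : Measurable fun x : ℝ => P.real {ω | x < ξ ω} := by
    refine Antitone.measurable (fun x y hxy => measureReal_mono (fun ω hω => ?_))
    exact lt_of_le_of_lt hxy hω
  have hGm : Measurable G := by simp only [hG]; fun_prop
  have hform : ∀ s : ℝ, 0 < s → ((s ^ (-α) : ℝ) : ℂ) *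
        ∫ ω, (expI (s * ξ ω) - 1 - (s * ξ ω : ℝ) * Complex.I) ∂P =
      Complex.I * ∫ y in Set.Ioi (0 : ℝ), (expI y - 1) * ((G (y / s) * y ^ (-α) : ℝ) : ℂ) := by
    intro s hs
    rw [integral_expI_taylor_eq_integral_tail hξ hξ0 hint]
    have hcv := integral_comp_mul_left_Ioi
      (fun y : ℝ => (expI y - 1) * ((G (y / s) * y ^ (-α) : ℝ) : ℂ)) 0 hs
    rw [mul_zero] at hcv
    have hcv' : ∫ y in Set.Ioi (0 : ℝ), (expI y - 1) * ((G (y / s) * y ^ (-α) : ℝ) : ℂ) =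
        (s : ℂ) * ∫ x in Set.Ioi (0 : ℝ),
          (expI (s * x) - 1) * ((G (s * x / s) * (s * x) ^ (-α) : ℝ) : ℂ) := by
      rw [hcv, Complex.real_smul, ← mul_assoc, ← Complex.ofReal_mul, mul_inv_cancel₀ hs.ne',
        Complex.ofReal_one, one_mul]
    rw [hcv', ← integral_const_mul, ← integral_const_mul, ← integral_const_mul]
    refine setIntegral_congr_fun measurableSet_Ioi (fun x hx => ?_)
    have hx0 : (0 : ℝ) < x := hx
    have : G (s * x / s) * (s * x) ^ (-α) = s ^ (-α) * P.real {ω | x < ξ ω} := by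
      rw [mul_div_cancel_left₀ _ hs.ne', Real.mul_rpow hs.le hx0.le]
      simp only [hG]
      rw [Real.rpow_neg hx0.le]
      have := (Real.rpow_pos_of_pos hx0 α).ne'
      field_simp
    simp only [this]
    push_cast; ring
  have hlim : Tendsto (fun s : ℝ => Complex.I *
      ∫ y in Set.Ioi (0 : ℝ), (expI y - 1) * ((G (y / s) * y ^ (-α) : ℝ) : ℂ)) (𝓝[>] 0)
      (𝓝 (Complex.I * ∫ y in Set.Ioi (0 : ℝ), (expI y - 1) * ((c * y ^ (-α) : ℝ) : ℂ))) := by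
    refine Tendsto.const_mul _ ?_
    refine tendsto_integral_filter_of_dominated_convergence
      (fun y => C * (2 * 1 * (min y 1 * y ^ (-α)))) ?_ ?_
      (((integrableOn_min_mul_rpow hα).const_mul _).const_mul _) ?_
    · refine Eventually.of_forall fun s => Measurable.aestronglyMeasurable ?_
      fun_prop
    · filter_upwards [self_mem_nhdsWithin] with s hs
      filter_upwards [ae_restrict_mem measurableSet_Ioi] with y hy
      have hy0 : (0 : ℝ) < y := hy
      have hs0 : (0 : ℝ) < s := hs
      have h1 := norm_exp_sub_one_mul_rpow_le (α := α) (r := -Complex.I) (R := 1) (by simp)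
        (by simp) le_rfl hy0
      have e : expI y = Complex.exp (-(-Complex.I * y)) := by
        simp only [expI]; ring_nf
      have hGn : 0 ≤ G (y / s) := by simp only [hG]; positivity
      have h2 : ‖(expI y - 1) * ((G (y / s) * y ^ (-α) : ℝ) : ℂ)‖ = G (y / s) *
          ‖(Complex.exp (-(-Complex.I * y)) - 1) * ((y ^ (-α) : ℝ) : ℂ)‖ := by
        rw [e, norm_mul, norm_mul, Complex.ofReal_mul, norm_mul, Complex.norm_of_nonneg hGn]; ring
      rw [h2]
      exact mul_le_mul (hC _ (div_pos hy0 hs0)) h1 (norm_nonneg _) hC0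
    · filter_upwards [ae_restrict_mem measurableSet_Ioi] with y hy
      refine Tendsto.const_mul _ ?_
      refine (Complex.continuous_ofReal.tendsto _).comp ?_
      refine Tendsto.mul_const _ ?_
      refine htail.comp ?_
      have : Tendsto (fun s : ℝ => y * s⁻¹) (𝓝[>] 0) atTop :=
        Tendsto.const_mul_atTop hy tendsto_inv_nhdsGT_zero
      exact this.congr fun s => (div_eq_mul_inv y s).symm
  have hval : Complex.I * ∫ y in Set.Ioi (0 : ℝ), (expI y - 1) * ((c * y ^ (-α) : ℝ) : ℂ) =
      stableExponent α c 1 := by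
    rw [← I_mul_integral_exp_I_sub_one_mul_rpow hα c, ← integral_const_mul (c : ℂ)]
    congr 1
    refine integral_congr_ae (ae_of_all _ fun y => ?_)
    simp only [expI, mul_comm Complex.I]
    push_cast; ring
  rw [← hval]
  refine hlim.congr' ?_
  filter_upwards [self_mem_nhdsWithin] with s hs
  exact (hform s hs).symm

/-- Near the origin the characteristic function of `ξ - 1`, where `ξ ≥ 0` has mean one and tail
`c x^{-α}`, agrees with that of the stable law up to `o(|s|^α)`. -/
theorem norm_integral_expI_sub_exp_stableExponent_le {α c : ℝ} (hα : α ∈ Set.Ioo (1 : ℝ) 2)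
    (hξ : Measurable ξ) (hξ0 : ∀ ω, 0 ≤ ξ ω) (hint : Integrable ξ P) (hmean : ∫ ω, ξ ω ∂P = 1)
    (htail : Tendsto (fun x : ℝ => P.real {ω | x < ξ ω} * x ^ α) atTop (𝓝 c))
    {ε : ℝ} (hε : 0 < ε) :
    ∃ δ > 0, ∀ s : ℝ, |s| ≤ δ →
      ‖∫ ω, expI (s * (ξ ω - 1)) ∂P - Complex.exp (stableExponent α c s)‖ ≤ ε * |s| ^ α := by
  have hα0 : α ≠ 0 := by linarith [hα.1]
  set z := stableExponent α c 1 with hz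
  have hR := tendsto_taylor_remainder_div_rpow hα hξ hξ0 hint htail
  set R : ℝ → ℂ := fun s => ∫ ω, (expI (s * ξ ω) - 1 - (s * ξ ω : ℝ) * Complex.I) ∂P with hRdef
  have hφ : ∀ s : ℝ, ∫ ω, expI (s * (ξ ω - 1)) ∂P =
      expI (-s) * (1 + s * Complex.I + R s) := by
    intro s
    have i1 : Integrable (fun ω => expI (s * ξ ω)) P :=
      integrable_expI (hξ.const_mul s).aemeasurable
    have i2 : Integrable (fun ω => ((s * ξ ω : ℝ) : ℂ) * Complex.I) P :=
      ((hint.const_mul s).ofReal).mul_const _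
    have e1 : R s = ∫ ω, expI (s * ξ ω) ∂P - 1 - s * Complex.I := by
      simp only [hRdef]
      have i3 : Integrable (fun ω => expI (s * ξ ω) - 1) P := i1.sub (integrable_const _)
      rw [integral_sub i3 i2, integral_sub i1 (integrable_const _),
        integral_mul_const, integral_complex_ofReal, integral_const_mul, hmean]
      simp
    rw [e1]
    have e2 : ∀ ω, expI (s * (ξ ω - 1)) = expI (-s) * expI (s * ξ ω) := by
      intro ω; rw [← expI_add]; congr 1; ring
    simp_rw [e2]
    rw [integral_const_mul]; ring
  -- the three contributions to the difference, each divided by `s ^ α`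
  have l1 : Tendsto (fun s : ℝ => ((s ^ (-α) : ℝ) : ℂ) * (expI (-s) * (1 + s * Complex.I) - 1))
      (𝓝[>] 0) (𝓝 0) := by
    refine squeeze_zero_norm' ?_ (tendsto_rpow_mul_sq hα.2)
    filter_upwards [Ioc_mem_nhdsGT (zero_lt_one (α := ℝ))] with s hs
    rw [norm_mul, Complex.norm_of_nonneg (Real.rpow_nonneg hs.1.le _)]
    refine mul_le_mul_of_nonneg_left ?_ (Real.rpow_nonneg hs.1.le _)
    set w : ℂ := ((-s : ℝ) : ℂ) * Complex.I with hw
    have hwn : ‖w‖ = s := by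
      rw [hw, norm_mul, Complex.norm_I, mul_one, Complex.norm_real, norm_neg,
        Real.norm_of_nonneg hs.1.le]
    have hw1 : ‖w‖ ≤ 1 := hwn ▸ hs.2
    have e : expI (-s) * (1 + s * Complex.I) - 1 =
        Complex.exp w * (1 - w) - 1 := by
      simp only [expI, hw]; push_cast; ring
    have n1 := Complex.norm_exp_sub_one_sub_id_le hw1
    have n2 : ‖w * (Complex.exp w - 1)‖ ≤ s * s := by
      have : ‖Complex.exp w - 1‖ ≤ s := by
        have := Real.norm_exp_I_mul_ofReal_sub_one_le (x := -s)
        rw [norm_neg, Real.norm_of_nonneg hs.1.le, mul_comm] at this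
        exact this
      rw [norm_mul, hwn]
      exact mul_le_mul_of_nonneg_left this hs.1.le
    have e' : Complex.exp w * (1 - w) - 1 = (Complex.exp w - 1 - w) - w * (Complex.exp w - 1) := by
      ring
    rw [e, e']
    refine (norm_sub_le _ _).trans ?_
    rw [hwn] at n1
    nlinarith
  have l2 : Tendsto (fun s : ℝ => expI (-s) * (((s ^ (-α) : ℝ) : ℂ) * R s)) (𝓝[>] 0) (𝓝 z) := by
    have : Tendsto (fun s : ℝ => expI (-s)) (𝓝[>] 0) (𝓝 1) := by
      have := (continuous_expI.comp continuous_neg).tendsto (0 : ℝ)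
      simp only [Function.comp, neg_zero, expI_zero] at this
      exact this.mono_left nhdsWithin_le_nhds
    have := this.mul hR
    rwa [one_mul] at this
  have hsα : Tendsto (fun s : ℝ => s ^ α) (𝓝[>] 0) (𝓝[>] 0) := by
    refine tendsto_nhdsWithin_of_tendsto_nhds_of_eventually_within _ ?_ ?_
    · have := (Real.continuousAt_rpow_const 0 α (Or.inr (by linarith [hα.1]))).tendsto
      rw [Real.zero_rpow hα0] at this
      exact this.mono_left nhdsWithin_le_nhds
    · filter_upwards [self_mem_nhdsWithin] with s hs
      exact Real.rpow_pos_of_pos hs _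
  have l3 : Tendsto (fun s : ℝ => ((s ^ (-α) : ℝ) : ℂ) *
      (Complex.exp (stableExponent α c s) - 1)) (𝓝[>] 0) (𝓝 z) := by
    have hd : HasDerivAt (fun x : ℝ => Complex.exp (x * z)) z 0 := by
      have h1 : HasDerivAt (fun x : ℝ => (x : ℂ) * z) z 0 := by
        simpa using ((hasDerivAt_id (0 : ℝ)).ofReal_comp).mul_const z
      simpa using h1.cexp
    have h2 := (hd.tendsto_slope_zero_right).comp hsα
    refine h2.congr' ?_
    filter_upwards [self_mem_nhdsWithin] with s hs
    have hs0 : (0 : ℝ) < s := hs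
    simp only [Function.comp, zero_add, Complex.ofReal_zero, zero_mul, Complex.exp_zero]
    rw [Complex.real_smul, stableExponent_of_pos α c hα0 hs0, Real.rpow_neg hs0.le]
  have l4 : Tendsto (fun s : ℝ => ((s ^ (-α) : ℝ) : ℂ) *
      (∫ ω, expI (s * (ξ ω - 1)) ∂P - Complex.exp (stableExponent α c s))) (𝓝[>] 0) (𝓝 0) := by
    have := (l1.add l2).sub l3
    rw [zero_add, sub_self] at this
    refine this.congr fun s => ?_
    rw [hφ s]; ring
  have l5 := l4.norm
  rw [norm_zero] at l5
  obtain ⟨δ, hδ0, hδ⟩ := mem_nhdsGT_iff_exists_Ioc_subset.1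
    (l5.eventually (Iic_mem_nhds hε))
  have hpos : ∀ s : ℝ, 0 < s → s ≤ δ →
      ‖∫ ω, expI (s * (ξ ω - 1)) ∂P - Complex.exp (stableExponent α c s)‖ ≤ ε * |s| ^ α := by
    intro s hs hsδ
    have : ‖((s ^ (-α) : ℝ) : ℂ) * (∫ ω, expI (s * (ξ ω - 1)) ∂P -
        Complex.exp (stableExponent α c s))‖ ≤ ε := hδ ⟨hs, hsδ⟩
    have hp := Real.rpow_pos_of_pos hs α
    rw [norm_mul, Complex.norm_of_nonneg (Real.rpow_nonneg hs.le _), Real.rpow_neg hs.le,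
      inv_mul_le_iff₀ hp] at this
    rw [abs_of_pos hs, mul_comm]; exact this
  refine ⟨δ, hδ0, fun s hs => ?_⟩
  rcases lt_trichotomy s 0 with h | h | h
  · have := hpos (-s) (by linarith) (by rwa [abs_of_neg h] at hs)
    have e : ∫ ω, expI (-s * (ξ ω - 1)) ∂P =
        (starRingEnd ℂ) (∫ ω, expI (s * (ξ ω - 1)) ∂P) := by
      simp_rw [neg_mul]; exact integral_expI_neg _
    rw [e, stableExponent_neg, Complex.exp_conj, ← map_sub, RCLike.norm_conj, abs_neg] at this
    exact this
  · simp [h, stableExponent_zero hα0, Real.zero_rpow hα0]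
  · exact hpos s h (by rwa [abs_of_pos h] at hs)

/-- A bound for all arguments, close to the origin or not; it controls the generations that are not
treated by the local approximation. -/
theorem exists_norm_integral_expI_sub_one_le {α c : ℝ} (hα : α ∈ Set.Ioo (1 : ℝ) 2) (hc : 0 ≤ c)
    (hξ : Measurable ξ) (hξ0 : ∀ ω, 0 ≤ ξ ω) (hint : Integrable ξ P) (hmean : ∫ ω, ξ ω ∂P = 1)
    (htail : Tendsto (fun x : ℝ => P.real {ω | x < ξ ω} * x ^ α) atTop (𝓝 c)) :
    ∃ C : ℝ, 0 ≤ C ∧ ∀ s : ℝ, ‖∫ ω, expI (s * (ξ ω - 1)) ∂P - 1‖ ≤ C * |s| ^ α := by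
  have hα0 : α ≠ 0 := by linarith [hα.1]
  obtain ⟨δ, hδ0, hδ⟩ :=
    norm_integral_expI_sub_exp_stableExponent_le hα hξ hξ0 hint hmean htail one_pos
  have hδα : 0 < δ ^ α := Real.rpow_pos_of_pos hδ0 _
  refine ⟨max (1 + 2 * ‖stableExponent α c 1‖) (2 / δ ^ α),
    le_max_of_le_right (by positivity), fun s => ?_⟩
  have hs0 : 0 ≤ |s| ^ α := by positivity
  rcases le_total |s| δ with h | h
  · refine le_trans ?_ (mul_le_mul_of_nonneg_right (le_max_left _ _) hs0)
    have h1 := hδ s h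
    have h2 : ‖Complex.exp (stableExponent α c s) - 1‖ ≤ 2 * ‖stableExponent α c s‖ :=
      (norm_exp_sub_one_le_min (stableExponent_re_nonpos hα hc s)).trans
        (mul_le_mul_of_nonneg_left (min_le_left _ _) (by norm_num))
    rw [norm_stableExponent hα0] at h2
    calc _ ≤ _ := norm_sub_le_norm_sub_add_norm_sub _ (Complex.exp (stableExponent α c s)) _
      _ ≤ _ := add_le_add h1 h2
      _ = _ := by ring
  · refine le_trans ?_ (mul_le_mul_of_nonneg_right (le_max_right _ _) hs0)
    have h1 : ‖∫ ω, expI (s * (ξ ω - 1)) ∂P - 1‖ ≤ 2 := by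
      refine (norm_sub_le _ _).trans ?_
      have := norm_integral_expI_le (P := P) fun ω => s * (ξ ω - 1)
      rw [norm_one]; linarith
    refine h1.trans ?_
    rw [div_mul_eq_mul_div, le_div_iff₀ hδα]
    exact mul_le_mul_of_nonneg_left (Real.rpow_le_rpow hδ0.le h (by linarith [hα.1])) (by norm_num)

end OneVariable

/-! ### Local mass of convolution powers -/

section RandomWalk

theorem eq_dirac_of_ae_eq {ν : Measure ℝ} [IsProbabilityMeasure ν] {r : ℝ} (h : ∀ᵐ x ∂ν, x = r) :
    ν = Measure.dirac r := by
  have h1 : ν.map id = ν.map (fun _ => r) := Measure.map_congr h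
  rwa [Measure.map_id, Measure.map_const, measure_univ, one_smul] at h1

theorem volume_cos_mul_eq_one {x : ℝ} (hx : x ≠ 0) : volume {t : ℝ | Real.cos (t * x) = 1} = 0 := by
  refine Set.Countable.measure_zero (Set.Countable.mono ?_
    (Set.countable_range fun n : ℤ => n * (2 * Real.pi) / x)) _
  rintro t ht
  obtain ⟨n, hn⟩ := (Real.cos_eq_one_iff _).1 ht
  exact ⟨n, by simp only; rw [hn, mul_div_cancel_right₀ _ hx]⟩

/-- The characteristic function of a probability measure that is not a point mass has modulus
smaller than one almost everywhere. -/
theorem ae_norm_charFun_lt_one {ν : Measure ℝ} [IsProbabilityMeasure ν]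
    (hν : ∀ r, ν ≠ Measure.dirac r) : ∀ᵐ t : ℝ, ‖charFun ν t‖ < 1 := by
  -- the law of the difference of two independent variables with law `ν`
  set ρ : Measure ℝ := (ν.prod ν).map (fun p => p.1 - p.2) with hρ
  have hm : Measurable fun p : ℝ × ℝ => p.1 - p.2 := by fun_prop
  have hρp : IsProbabilityMeasure ρ := Measure.isProbabilityMeasure_map hm.aemeasurable
  have hρ0 : ρ {0}ᶜ ≠ 0 := by
    intro h
    rw [hρ, Measure.map_apply hm (measurableSet_singleton 0).compl] at h
    have h2 : ∀ᵐ p ∂(ν.prod ν), p.1 - p.2 = 0 := by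
      rw [ae_iff]; exact h
    have h3 := Measure.ae_ae_of_ae_prod h2
    obtain ⟨r, hr⟩ := h3.exists
    refine hν r (eq_dirac_of_ae_eq ?_)
    filter_upwards [hr] with y hy
    linarith
  have hS : MeasurableSet {p : ℝ × ℝ | p.2 ≠ 0 ∧ Real.cos (p.1 * p.2) = 1} := by
    refine MeasurableSet.inter ?_ ?_
    · exact (measurableSet_eq_fun measurable_snd measurable_const).compl
    · exact measurableSet_eq_fun (by fun_prop) measurable_const
  have hfub : ∀ᵐ t : ℝ, ρ {x | x ≠ 0 ∧ Real.cos (t * x) = 1} = 0 := by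
    have h1 : (ρ.prod volume) {p : ℝ × ℝ | p.1 ≠ 0 ∧ Real.cos (p.2 * p.1) = 1} = 0 := by
      have hS' : MeasurableSet {p : ℝ × ℝ | p.1 ≠ 0 ∧ Real.cos (p.2 * p.1) = 1} :=
        measurable_swap hS
      rw [Measure.measure_prod_null hS']
      refine ae_of_all _ fun x => ?_
      by_cases hx : x = 0
      · simp [hx]
      · have := volume_cos_mul_eq_one hx
        refine measure_mono_null (fun t ht => ?_) this
        exact ht.2
    have h2 : (volume.prod ρ) {p : ℝ × ℝ | p.2 ≠ 0 ∧ Real.cos (p.1 * p.2) = 1} = 0 := by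
      rw [← Measure.prod_swap, Measure.map_apply measurable_swap hS]
      exact h1
    exact (Measure.measure_prod_null hS).1 h2
  filter_upwards [hfub] with t ht
  refine lt_of_le_of_ne (norm_charFun_le_one t) fun heq => hρ0 ?_
  -- `|ν̂(t)|² = ∫ cos (t x) ρ(dx)`, so modulus one forces `cos (t x) = 1` for `ρ`-almost every `x`
  have hsq : (∫ x, Real.cos (t * x) ∂ρ) = 1 := by
    have e1 : ∫ x, expI (t * x) ∂ρ = 1 := by
      rw [hρ, integral_map hm.aemeasurable (f := fun x => expI (t * x))
        (Measurable.aestronglyMeasurable (by fun_prop))]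
      have e2 : ∀ p : ℝ × ℝ, expI (t * (p.1 - p.2)) =
          expI (t * p.1) * (starRingEnd ℂ) (expI (t * p.2)) := by
        intro p; rw [← expI_neg, ← expI_add]; congr 1; ring
      simp_rw [e2]
      rw [integral_prod_mul (fun x => expI (t * x)) (fun x => (starRingEnd ℂ) (expI (t * x))),
        integral_conj, Complex.mul_conj, Complex.normSq_eq_norm_sq]
      have e3 : ∫ x, expI (t * x) ∂ν = charFun ν t := by
        simpa using (charFun_map_eq_integral_expI (P := ν) aemeasurable_id t).symm
      rw [e3, heq]; simp
    have e4 : Integrable (fun x => expI (t * x)) ρ := integrable_expI (by fun_prop)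
    have := congrArg Complex.re e1
    rw [Complex.one_re] at this
    rw [← this]
    have h5 := integral_re e4
    refine Eq.trans ?_ h5
    refine integral_congr_ae (ae_of_all _ fun x => ?_)
    simp only [expI, RCLike.re_to_complex]
    rw [Complex.exp_ofReal_mul_I_re]
  have hcos : Integrable (fun x => Real.cos (t * x)) ρ :=
    (integrable_const (1 : ℝ)).mono' (by fun_prop) (ae_of_all _ fun x => Real.abs_cos_le_one _)
  have h0 : ∫ x, (1 - Real.cos (t * x)) ∂ρ = 0 := by
    rw [integral_sub (integrable_const _) hcos, hsq]; simp
  have h1 := (integral_eq_zero_iff_of_nonneg (fun x => sub_nonneg.2 (Real.cos_le_one _))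
    ((integrable_const _).sub hcos)).1 h0
  have h2 : ∀ᵐ x ∂ρ, ¬ (x ≠ 0) := by
    have h3 : ∀ᵐ x ∂ρ, ¬ (x ≠ 0 ∧ Real.cos (t * x) = 1) := by
      rw [ae_iff]; simpa using ht
    filter_upwards [h1, h3] with x hx hx3 hx0
    exact hx3 ⟨hx0, by simp only [Pi.zero_apply] at hx; linarith⟩
  rw [ae_iff] at h2
  simpa [Set.compl_def] using h2

/-- The Gaussian kernel integrated against a probability measure, by Parseval's identity. -/
theorem integral_exp_neg_sq_eq_integral_charFun (μ : Measure ℝ) [IsProbabilityMeasure μ] :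
    ((∫ x, Real.exp (-(x ^ 2 / 2)) ∂μ : ℝ) : ℂ) = ∫ t, charFun μ t ∂(gaussianReal 0 1) := by
  have hint : Integrable (fun p : ℝ × ℝ => expI (p.1 * p.2)) ((gaussianReal 0 1).prod μ) :=
    integrable_expI (by fun_prop)
  have h := integral_integral_swap (f := fun t x => expI (t * x)) hint
  have e1 : ∀ t, ∫ x, expI (t * x) ∂μ = charFun μ t := fun t => by
    simpa using (charFun_map_eq_integral_expI (P := μ) aemeasurable_id t).symm
  have e2 : ∀ x, ∫ t, expI (t * x) ∂(gaussianReal 0 1) = (Real.exp (-(x ^ 2 / 2)) : ℂ) := by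
    intro x
    have := charFun_gaussianReal (μ := 0) (v := 1) x
    rw [charFun_apply_real] at this
    rw [Complex.ofReal_exp]
    convert this using 1
    · refine integral_congr_ae (ae_of_all _ fun t => ?_)
      simp [expI, mul_comm]
    · congr 1; push_cast; ring
  simp_rw [e1, e2] at h
  rw [h, integral_complex_ofReal]

/-- A random walk on the line whose steps do not vanish almost surely leaves every bounded
interval, in probability.  The walk is given by its one-dimensional laws `μ n = ν ∗ ⋯ ∗ ν`.  A
deterministic step is treated separately; otherwise the characteristic functions tend to zero almost
everywhere, and so do the integrals of the Gaussian kernel. -/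
theorem tendsto_conv_pow_Icc {ν : Measure ℝ} [IsProbabilityMeasure ν] (hν : ν ≠ Measure.dirac 0)
    {μ : ℕ → Measure ℝ} (h0 : μ 0 = Measure.dirac 0) (hsucc : ∀ n, μ (n + 1) = μ n ∗ ν) (a b : ℝ) :
    Tendsto (fun n => μ n (Set.Icc a b)) atTop (𝓝 0) := by
  have hprob : ∀ n, IsProbabilityMeasure (μ n) := by
    intro n
    induction n with
    | zero => rw [h0]; infer_instance
    | succ n ih => rw [hsucc]; infer_instance
  by_cases hd : ∃ r, ν = Measure.dirac r
  · obtain ⟨r, rfl⟩ := hd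
    have hr : r ≠ 0 := fun h => hν (by rw [h])
    have hμ : ∀ n : ℕ, μ n = Measure.dirac (n * r) := by
      intro n
      induction n with
      | zero => rw [h0]; simp
      | succ n ih => rw [hsucc, ih, Measure.dirac_conv_dirac]; push_cast; congr 1; ring
    have hout : ∀ᶠ n : ℕ in atTop, (n : ℝ) * r ∉ Set.Icc a b := by
      have hn : Tendsto (fun n : ℕ => (n : ℝ)) atTop atTop := tendsto_natCast_atTop_atTop
      rcases lt_or_gt_of_ne hr with h | h
      · filter_upwards [(hn.atTop_mul_const_of_neg h).eventually (eventually_lt_atBot a)] with n hn' hm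
        exact absurd hm.1 (not_le.2 hn')
      · filter_upwards [(hn.atTop_mul_const h).eventually (eventually_gt_atTop b)] with n hn' hm
        exact absurd hm.2 (not_le.2 hn')
    refine tendsto_const_nhds.congr' ?_
    filter_upwards [hout] with n hn
    rw [hμ, Measure.dirac_apply' _ measurableSet_Icc, Set.indicator_of_notMem hn]
  · have hlt := ae_norm_charFun_lt_one (ν := ν) fun r h => hd ⟨r, h⟩
    have hcf : ∀ n t, charFun (μ n) t = charFun ν t ^ n := by
      intro n t
      induction n with
      | zero => rw [h0]; simp
      | succ n ih => rw [hsucc, charFun_conv, ih, pow_succ]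
    have hlim : Tendsto (fun n => ∫ t, charFun (μ n) t ∂(gaussianReal 0 1)) atTop (𝓝 0) := by
      have hlt' : ∀ᵐ t ∂(gaussianReal 0 1), ‖charFun ν t‖ < 1 :=
        (gaussianReal_absolutelyContinuous 0 one_ne_zero).ae_le hlt
      have := tendsto_integral_of_dominated_convergence (μ := gaussianReal 0 1)
        (F := fun n t => charFun (μ n) t) (f := fun _ => 0) (fun _ => 1)
        (fun n => measurable_charFun.aestronglyMeasurable) (integrable_const _)
        (fun n => ae_of_all _ fun t => norm_charFun_le_one t)
        (by
          filter_upwards [hlt'] with t ht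
          simp_rw [hcf]
          exact tendsto_pow_atTop_nhds_zero_of_norm_lt_one ht)
      simpa using this
    have hlim2 : Tendsto (fun n => ∫ x, Real.exp (-(x ^ 2 / 2)) ∂(μ n)) atTop (𝓝 0) := by
      have h1 : Tendsto (fun n => ((∫ x, Real.exp (-(x ^ 2 / 2)) ∂(μ n) : ℝ) : ℂ)) atTop (𝓝 0) :=
        hlim.congr fun n => (integral_exp_neg_sq_eq_integral_charFun (μ n)).symm
      exact (Complex.continuous_re.tendsto 0).comp h1
    set B := max |a| |b| with hB
    have hle : ∀ n, μ n (Set.Icc a b) ≤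
        ENNReal.ofReal (Real.exp (B ^ 2 / 2) * ∫ x, Real.exp (-(x ^ 2 / 2)) ∂(μ n)) := by
      intro n
      have hi : Integrable (fun x : ℝ => Real.exp (-(x ^ 2 / 2))) (μ n) := by
        refine (integrable_const (1 : ℝ)).mono'
          (by refine Measurable.aestronglyMeasurable ?_; fun_prop) (ae_of_all _ fun x => ?_)
        rw [Real.norm_of_nonneg (Real.exp_nonneg _)]
        exact Real.exp_le_one_iff.2 (by nlinarith [sq_nonneg x])
      rw [← ofReal_measureReal]
      refine ENNReal.ofReal_le_ofReal ?_
      have h1 : Real.exp (-(B ^ 2 / 2)) * (μ n).real (Set.Icc a b) ≤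
          ∫ x, Real.exp (-(x ^ 2 / 2)) ∂(μ n) := by
        calc _ = ∫ x in Set.Icc a b, Real.exp (-(B ^ 2 / 2)) ∂(μ n) := by
              rw [setIntegral_const, smul_eq_mul, mul_comm]
          _ ≤ ∫ x in Set.Icc a b, Real.exp (-(x ^ 2 / 2)) ∂(μ n) := by
              refine setIntegral_mono_on (integrable_const _).integrableOn hi.integrableOn
                measurableSet_Icc fun x hx => Real.exp_le_exp.2 ?_
              have : |x| ≤ B := abs_le_max_abs_abs hx.1 hx.2
              have : x ^ 2 ≤ B ^ 2 := sq_le_sq' (by linarith [neg_abs_le x]) (by linarith [le_abs_self x])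
              linarith
          _ ≤ _ := setIntegral_le_integral hi (ae_of_all _ fun x => Real.exp_nonneg _)
      rw [Real.exp_neg, inv_mul_le_iff₀ (Real.exp_pos _)] at h1
      exact h1
    have hlim3 : Tendsto (fun n => ENNReal.ofReal
        (Real.exp (B ^ 2 / 2) * ∫ x, Real.exp (-(x ^ 2 / 2)) ∂(μ n))) atTop (𝓝 0) := by
      have := ENNReal.tendsto_ofReal (hlim2.const_mul (Real.exp (B ^ 2 / 2)))
      simpa using this
    exact tendsto_of_tendsto_of_tendsto_of_le_of_le tendsto_const_nhds hlim3
      (fun _ => zero_le) hle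

end RandomWalk

/-! ### Multiplicative cascades and their martingale -/

section Cascade

variable {Ω : Type*}

/-- The individuals of generation `n`, born or not. -/
abbrev Gen (n : ℕ) : Type := {u : List ℕ // u.length = n}

/-- The weight of an individual: the product of the factors `A` along its ancestral line. -/
def weight (A : List ℕ → Ω → ℕ → ℝ≥0) : List ℕ → Ω → ℝ≥0
  | [], _ => 1
  | j :: u, ω => weight A u ω * A u ω j

/-- The total weight of generation `n`. -/
noncomputable def total (A : List ℕ → Ω → ℕ → ℝ≥0) (n : ℕ) (ω : Ω) : ℝ≥0∞ :=
  ∑' u : Gen n, (weight A u ω : ℝ≥0∞)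

/-- The sum of the factors of the children of `u`. -/
noncomputable def childSum (A : List ℕ → Ω → ℕ → ℝ≥0) (u : List ℕ) (ω : Ω) : ℝ≥0∞ :=
  ∑' j, (A u ω j : ℝ≥0∞)

theorem measurable_tsum_coe_nnreal {ι : Type*} [Countable ι] {_ : MeasurableSpace Ω}
    {f : ι → Ω → ℝ≥0} (hf : ∀ i, Measurable (f i)) :
    Measurable fun ω => ∑' i, (f i ω : ℝ≥0∞) :=
  Measurable.tsum fun i => measurable_coe_nnreal_ennreal.comp (hf i)

theorem tsum_gen_succ (f : List ℕ → ℝ≥0∞) (n : ℕ) :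
    ∑' u : Gen (n + 1), f u = ∑' u : Gen n, ∑' j : ℕ, f (j :: u) := by
  rw [← ENNReal.tsum_prod (f := fun (u : Gen n) (j : ℕ) => f (j :: u))]
  let e : Gen n × ℕ ≃ Gen (n + 1) :=
    { toFun := fun p => ⟨p.2 :: p.1.1, by simp [p.1.2]⟩
      invFun := fun u => match u with
        | ⟨j :: v, h⟩ => (⟨v, by simpa using h⟩, j)
      left_inv := fun p => rfl
      right_inv := fun u => match u with
        | ⟨j :: v, h⟩ => rfl }
  exact (e.tsum_eq (fun u : Gen (n + 1) => f u)).symm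

theorem tsum_gen_zero (f : List ℕ → ℝ≥0∞) : ∑' u : Gen 0, f u = f [] := by
  rw [tsum_eq_single (⟨[], rfl⟩ : Gen 0)]
  rintro ⟨u, hu⟩ h
  exact absurd (Subtype.ext (List.length_eq_zero_iff.1 hu)) h

theorem total_zero (A : List ℕ → Ω → ℕ → ℝ≥0) (ω : Ω) : total A 0 ω = 1 := by
  rw [total, tsum_gen_zero (fun u => (weight A u ω : ℝ≥0∞))]; simp [weight]

theorem total_succ (A : List ℕ → Ω → ℕ → ℝ≥0) (n : ℕ) (ω : Ω) :
    total A (n + 1) ω = ∑' u : Gen n, (weight A u ω : ℝ≥0∞) * childSum A u ω := by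
  rw [total, tsum_gen_succ (fun u => (weight A u ω : ℝ≥0∞))]
  refine tsum_congr fun u => ?_
  rw [childSum, ← ENNReal.tsum_mul_left]
  simp [weight]

theorem total_one (A : List ℕ → Ω → ℕ → ℝ≥0) (ω : Ω) : total A 1 ω = childSum A [] ω := by
  rw [total_succ, tsum_gen_zero (fun u => (weight A u ω : ℝ≥0∞) * childSum A u ω)]
  simp [weight]

variable [MeasurableSpace Ω]

/-- A multiplicative cascade: the sequences of factors of the individuals are independent and
identically distributed, and the mean sum of the factors is one. -/
structure IsCascade (P : Measure Ω) (A : List ℕ → Ω → ℕ → ℝ≥0) : Prop where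
  measurable : ∀ u, Measurable (A u)
  indep : iIndepFun A P
  ident : ∀ u, IdentDistrib (A u) (A []) P P
  mean : ∫⁻ ω, childSum A [] ω ∂P = 1

/-- The information contained in the factors of the individuals of the generations before `n`. -/
@[reducible] def past (A : List ℕ → Ω → ℕ → ℝ≥0) (n : ℕ) : MeasurableSpace Ω :=
  ⨆ u ∈ {u : List ℕ | u.length < n}, MeasurableSpace.comap (A u) inferInstance

theorem measurable_past (A : List ℕ → Ω → ℕ → ℝ≥0) {n : ℕ} {u : List ℕ} (hu : u.length < n) :
    Measurable[past A n] (A u) := by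
  have : MeasurableSpace.comap (A u) inferInstance ≤ past A n :=
    le_iSup₂_of_le (f := fun (u : List ℕ) (_ : u ∈ {u : List ℕ | u.length < n}) =>
      MeasurableSpace.comap (A u) inferInstance) u hu le_rfl
  exact measurable_iff_comap_le.2 this

theorem past_mono (A : List ℕ → Ω → ℕ → ℝ≥0) : Monotone (past A) := by
  intro n m hnm
  refine iSup₂_le fun u hu => ?_
  exact measurable_iff_comap_le.1 (measurable_past A (lt_of_lt_of_le hu hnm))

theorem measurable_weight_past (A : List ℕ → Ω → ℕ → ℝ≥0) {n : ℕ} :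
    ∀ {u : List ℕ}, u.length ≤ n → Measurable[past A n] (weight A u)
  | [], _ => measurable_const
  | j :: u, h => by
    have h' : u.length < n := by simpa using h
    have h1 : Measurable[past A n] (weight A u) := measurable_weight_past A h'.le
    have h2 : Measurable[past A n] (fun ω => A u ω j) :=
      (measurable_pi_apply j).comp (measurable_past A h')
    exact Measurable.mul h1 h2

theorem measurable_total_past (A : List ℕ → Ω → ℕ → ℝ≥0) {n k : ℕ} (h : k ≤ n) :
    Measurable[past A n] (total A k) :=
  measurable_tsum_coe_nnreal fun u : Gen k => measurable_weight_past A (u.2.le.trans h)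

/-- Integrating a function of two independent variables, one after the other. -/
theorem lintegral_indepFun {P : Measure Ω} [IsProbabilityMeasure P] {E F : Type*}
    [MeasurableSpace E] [MeasurableSpace F] {p : Ω → E} {q : Ω → F} (hp : Measurable p)
    (hq : Measurable q) (h : IndepFun p q P) {H : E → F → ℝ≥0∞}
    (hH : Measurable (Function.uncurry H)) :
    ∫⁻ ω, H (p ω) (q ω) ∂P = ∫⁻ ω, ∫⁻ ω', H (p ω) (q ω') ∂P ∂P := by
  have h1 := (indepFun_iff_map_prod_eq_prod_map_map hp.aemeasurable hq.aemeasurable).1 h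
  have h2 : ∫⁻ ω, H (p ω) (q ω) ∂P =
      ∫⁻ z, Function.uncurry H z ∂(P.map fun ω => (p ω, q ω)) :=
    (lintegral_map hH (hp.prodMk hq)).symm
  have := Measure.isProbabilityMeasure_map (μ := P) hq.aemeasurable
  have := Measure.isProbabilityMeasure_map (μ := P) hp.aemeasurable
  rw [h2, h1, lintegral_prod _ hH.aemeasurable,
    lintegral_map (Measurable.lintegral_prod_right' hH) hp]
  refine lintegral_congr fun ω => ?_
  exact lintegral_map (hH.comp measurable_prodMk_left) hq

theorem measurable_present (A : List ℕ → Ω → ℕ → ℝ≥0) {n : ℕ} {u : List ℕ} (hu : u.length = n) :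
    Measurable[⨆ u ∈ {u : List ℕ | u.length = n},
      MeasurableSpace.comap (A u) inferInstance] (A u) := by
  refine measurable_iff_comap_le.2 ?_
  exact le_iSup₂_of_le (f := fun (u : List ℕ) (_ : u ∈ {u : List ℕ | u.length = n}) =>
      MeasurableSpace.comap (A u) inferInstance) u hu le_rfl

theorem measurable_tsum_coe : Measurable fun a : ℕ → ℝ≥0 => ∑' j, (a j : ℝ≥0∞) :=
  measurable_tsum_coe_nnreal fun j => measurable_pi_apply j

namespace IsCascade

variable {P : Measure Ω} [IsProbabilityMeasure P] {A : List ℕ → Ω → ℕ → ℝ≥0}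

theorem past_le (hA : IsCascade P A) (n : ℕ) : past A n ≤ ‹MeasurableSpace Ω› :=
  iSup₂_le fun u _ => measurable_iff_comap_le.1 (hA.measurable u)

theorem measurable_weight (hA : IsCascade P A) (u : List ℕ) : Measurable (weight A u) :=
  (measurable_weight_past A le_rfl).mono (hA.past_le _) le_rfl

theorem measurable_total (hA : IsCascade P A) (n : ℕ) : Measurable (total A n) :=
  (measurable_total_past A le_rfl).mono (hA.past_le n) le_rfl

theorem measurable_childSum (hA : IsCascade P A) (u : List ℕ) : Measurable (childSum A u) :=
  measurable_tsum_coe_nnreal fun j => (measurable_pi_apply j).comp (hA.measurable u)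

/-- The factors of generation `n` are independent of the preceding generations. -/
theorem indepFun_past (hA : IsCascade P A) {n : ℕ} {E F : Type*} [MeasurableSpace E]
    [MeasurableSpace F] {p : Ω → E} (hp : Measurable[past A n] p) {q : Ω → F}
    (hq : Measurable[⨆ u ∈ {u : List ℕ | u.length = n},
      MeasurableSpace.comap (A u) inferInstance] q) : IndepFun p q P := by
  have h := indep_iSup_of_disjoint (m := fun u => MeasurableSpace.comap (A u) inferInstance)
    (fun u => measurable_iff_comap_le.1 (hA.measurable u)) hA.indep
    (S := {u : List ℕ | u.length < n}) (T := {u : List ℕ | u.length = n})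
    (Set.disjoint_left.2 fun u h1 h2 => (ne_of_lt h1) h2)
  rw [IndepFun_iff_Indep]
  exact indep_of_indep_of_le_right (indep_of_indep_of_le_left h (measurable_iff_comap_le.1 hp))
    (measurable_iff_comap_le.1 hq)

/-- Given the past, the factors of an individual of generation `n` have the law of the factors of the
ancestor. -/
theorem lintegral_past_present (hA : IsCascade P A) {n : ℕ} {u : List ℕ} (hu : u.length = n)
    {E : Type*} [MeasurableSpace E] {p : Ω → E} (hp : Measurable[past A n] p)
    {H : E → (ℕ → ℝ≥0) → ℝ≥0∞} (hH : Measurable (Function.uncurry H)) :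
    ∫⁻ ω, H (p ω) (A u ω) ∂P = ∫⁻ ω, ∫⁻ ω', H (p ω) (A [] ω') ∂P ∂P := by
  rw [lintegral_indepFun (hp.mono (hA.past_le n) le_rfl) (hA.measurable u)
    (hA.indepFun_past hp (measurable_present A hu)) hH]
  refine lintegral_congr fun ω => ?_
  exact ((hA.ident u).comp (u := H (p ω)) (hH.comp measurable_prodMk_left)).lintegral_eq

/-- The martingale property of the total weight, tested against nonnegative functions of the past. -/
theorem lintegral_mul_total_succ (hA : IsCascade P A) {n : ℕ} {f : Ω → ℝ≥0∞}
    (hf : Measurable[past A n] f) :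
    ∫⁻ ω, f ω * total A (n + 1) ω ∂P = ∫⁻ ω, f ω * total A n ω ∂P := by
  have hf' := hf.mono (hA.past_le n) le_rfl
  have hw := fun u : Gen n => measurable_coe_nnreal_ennreal.comp (hA.measurable_weight u)
  simp_rw [total_succ]
  simp_rw [total, ← ENNReal.tsum_mul_left]
  rw [lintegral_tsum (f := fun (u : Gen n) ω => f ω * ((weight A u ω : ℝ≥0∞) * childSum A u ω))
      fun u => (hf'.mul ((hw u).mul (hA.measurable_childSum u))).aemeasurable,
    lintegral_tsum (f := fun (u : Gen n) ω => f ω * (weight A u ω : ℝ≥0∞))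
      fun u => (hf'.mul (hw u)).aemeasurable]
  refine tsum_congr fun u => ?_
  have hp : Measurable[past A n] fun ω => f ω * (weight A u ω : ℝ≥0∞) :=
    Measurable.mul hf (measurable_coe_nnreal_ennreal.comp (measurable_weight_past A u.2.le))
  have h := hA.lintegral_past_present u.2 hp
    (H := fun x a => x * ∑' j, (a j : ℝ≥0∞))
    (measurable_fst.mul (measurable_tsum_coe.comp measurable_snd))
  simp_rw [← mul_assoc]
  refine h.trans (lintegral_congr fun ω => ?_)
  exact (lintegral_const_mul _ (hA.measurable_childSum [])).trans (by rw [hA.mean, mul_one])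

theorem lintegral_total (hA : IsCascade P A) (n : ℕ) : ∫⁻ ω, total A n ω ∂P = 1 := by
  induction n with
  | zero => simp [total_zero]
  | succ n ih =>
    have := hA.lintegral_mul_total_succ (n := n) (f := fun _ => 1) measurable_const
    simpa [ih] using this

theorem ae_total_lt_top (hA : IsCascade P A) : ∀ᵐ ω ∂P, ∀ n, total A n ω < ∞ :=
  ae_all_iff.2 fun n => ae_lt_top (hA.measurable_total n) (by rw [hA.lintegral_total]; simp)

/-- The generations of a cascade as a filtration. -/
def filtration (hA : IsCascade P A) : Filtration ℕ ‹MeasurableSpace Ω› where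
  seq := past A
  mono' := past_mono A
  le' := hA.past_le

theorem integrable_total (hA : IsCascade P A) (n : ℕ) :
    Integrable (fun ω => (total A n ω).toReal) P :=
  integrable_toReal_of_lintegral_ne_top (hA.measurable_total n).aemeasurable
    (by rw [hA.lintegral_total]; simp)

theorem martingale_total (hA : IsCascade P A) :
    Martingale (fun n ω => (total A n ω).toReal) hA.filtration P := by
  refine martingale_of_setIntegral_eq_succ (fun n => ?_) hA.integrable_total fun n s hs => ?_
  · exact (measurable_total_past A le_rfl).ennreal_toReal.stronglyMeasurable
  · have hs' : MeasurableSet s := hA.past_le n s hs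
    have hfin := hA.ae_total_lt_top
    rw [integral_toReal (hA.measurable_total _).aemeasurable
        (ae_restrict_of_ae (hfin.mono fun ω h => h n)),
      integral_toReal (hA.measurable_total _).aemeasurable
        (ae_restrict_of_ae (hfin.mono fun ω h => h (n + 1)))]
    congr 1
    have h := hA.lintegral_mul_total_succ (n := n) (f := s.indicator 1)
      (Measurable.indicator measurable_const hs)
    have e : ∀ k, ∫⁻ ω in s, total A k ω ∂P = ∫⁻ ω, s.indicator 1 ω * total A k ω ∂P := by
      intro k
      rw [← lintegral_indicator hs']
      refine lintegral_congr fun ω => ?_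
      by_cases hω : ω ∈ s <;> simp [hω]
    rw [e, e, h]

/-- The total weights of the generations converge almost surely to a finite limit. -/
theorem ae_tendsto_total (hA : IsCascade P A) :
    ∀ᵐ ω ∂P, Tendsto (fun n => total A n ω) atTop (𝓝 (limsup (fun n => total A n ω) atTop)) ∧
      limsup (fun n => total A n ω) atTop < ∞ := by
  have hb : ∀ n, eLpNorm (fun ω => (total A n ω).toReal) 1 P ≤ ((1 : ℝ≥0) : ℝ≥0∞) := by
    intro n
    rw [eLpNorm_one_eq_lintegral_enorm]
    calc ∫⁻ ω, ‖(total A n ω).toReal‖ₑ ∂P ≤ ∫⁻ ω, total A n ω ∂P := by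
          refine lintegral_mono fun ω => ?_
          rw [Real.enorm_of_nonneg ENNReal.toReal_nonneg]
          exact ENNReal.ofReal_toReal_le
      _ = _ := by rw [hA.lintegral_total]; simp
  have h := hA.martingale_total.submartingale.exists_ae_tendsto_of_bdd hb
  filter_upwards [h, hA.ae_total_lt_top] with ω ⟨l, hl⟩ hfin
  have h1 : Tendsto (fun n => total A n ω) atTop (𝓝 (ENNReal.ofReal l)) := by
    refine (ENNReal.tendsto_ofReal hl).congr fun n => ?_
    exact ENNReal.ofReal_toReal (hfin n).ne
  rw [h1.limsup_eq]
  exact ⟨h1, ENNReal.ofReal_lt_top⟩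

end IsCascade

end Cascade

/-! ### The maximal weight of a generation -/

section MaximalWeight

variable {Ω : Type*} [MeasurableSpace Ω]

/-- The law of the position of the spine: the intensity measure of the logarithms of the weights of
generation `n`, each individual counted with its weight.  Individuals of weight zero do not
contribute, so that the value `log 0 = 0` is harmless. -/
noncomputable def logIntensity (P : Measure Ω) (A : List ℕ → Ω → ℕ → ℝ≥0) (n : ℕ) : Measure ℝ :=
  Measure.sum fun u : Gen n => (P.withDensity fun ω => (weight A u ω : ℝ≥0∞)).map
    fun ω => Real.log (weight A u ω)

namespace IsCascade

variable {P : Measure Ω} [IsProbabilityMeasure P] {A : List ℕ → Ω → ℕ → ℝ≥0}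

theorem lintegral_logIntensity (hA : IsCascade P A) (n : ℕ) {f : ℝ → ℝ≥0∞} (hf : Measurable f) :
    ∫⁻ x, f x ∂(logIntensity P A n) =
      ∑' u : Gen n, ∫⁻ ω, (weight A u ω : ℝ≥0∞) * f (Real.log (weight A u ω)) ∂P := by
  rw [logIntensity, lintegral_sum_measure]
  refine tsum_congr fun u => ?_
  have h1 : Measurable fun ω => Real.log (weight A u ω) :=
    Real.measurable_log.comp (measurable_coe_nnreal_real.comp (hA.measurable_weight u))
  rw [lintegral_map hf h1]
  exact lintegral_withDensity_eq_lintegral_mul _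
    (measurable_coe_nnreal_ennreal.comp (hA.measurable_weight u)) (hf.comp h1)

theorem logIntensity_zero (hA : IsCascade P A) : logIntensity P A 0 = Measure.dirac 0 := by
  refine Measure.ext_of_lintegral _ fun f hf => ?_
  rw [hA.lintegral_logIntensity 0 hf, lintegral_dirac' _ hf,
    tsum_gen_zero (fun u => ∫⁻ ω, (weight A u ω : ℝ≥0∞) * f (Real.log (weight A u ω)) ∂P)]
  simp [weight]

theorem lintegral_logIntensity_one (hA : IsCascade P A) {f : ℝ → ℝ≥0∞} (hf : Measurable f) :
    ∫⁻ x, f x ∂(logIntensity P A 1) =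
      ∫⁻ ω, ∑' j, (A [] ω j : ℝ≥0∞) * f (Real.log (A [] ω j)) ∂P := by
  have hm : ∀ j, Measurable fun ω => A [] ω j := fun j =>
    (measurable_pi_apply j).comp (hA.measurable [])
  rw [hA.lintegral_logIntensity 1 hf,
    tsum_gen_succ (fun u => ∫⁻ ω, (weight A u ω : ℝ≥0∞) * f (Real.log (weight A u ω)) ∂P),
    tsum_gen_zero (fun u => ∑' j, ∫⁻ ω, (weight A (j :: u) ω : ℝ≥0∞) *
      f (Real.log (weight A (j :: u) ω)) ∂P),
    lintegral_tsum (f := fun j ω => (A [] ω j : ℝ≥0∞) * f (Real.log (A [] ω j)))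
      fun j => ((measurable_coe_nnreal_ennreal.comp (hm j)).mul (hf.comp (Real.measurable_log.comp
        (measurable_coe_nnreal_real.comp (hm j))))).aemeasurable]
  simp [weight]

theorem isProbabilityMeasure_logIntensity_one (hA : IsCascade P A) :
    IsProbabilityMeasure (logIntensity P A 1) := by
  refine ⟨?_⟩
  have := hA.lintegral_logIntensity_one (f := fun _ => 1) measurable_const
  simp only [lintegral_one, mul_one] at this
  rw [this]
  exact hA.mean

/-- The spine performs a random walk. -/
theorem logIntensity_succ (hA : IsCascade P A) (n : ℕ) :
    logIntensity P A (n + 1) = logIntensity P A n ∗ logIntensity P A 1 := by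
  have := hA.isProbabilityMeasure_logIntensity_one
  refine Measure.ext_of_lintegral _ fun f hf => ?_
  have hg : Measurable fun x => ∫⁻ y, f (x + y) ∂(logIntensity P A 1) :=
    Measurable.lintegral_prod_right' (f := fun p : ℝ × ℝ => f (p.1 + p.2))
      (hf.comp (measurable_fst.add measurable_snd))
  rw [Measure.lintegral_conv hf, hA.lintegral_logIntensity n hg,
    hA.lintegral_logIntensity (n + 1) hf,
    tsum_gen_succ (fun u => ∫⁻ ω, (weight A u ω : ℝ≥0∞) * f (Real.log (weight A u ω)) ∂P)]
  refine tsum_congr fun u => ?_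
  have hm : ∀ j, Measurable fun ω => weight A (j :: u) ω := fun j => hA.measurable_weight _
  rw [← lintegral_tsum (f := fun j ω => (weight A (j :: u) ω : ℝ≥0∞) *
    f (Real.log (weight A (j :: u) ω))) fun j =>
      ((measurable_coe_nnreal_ennreal.comp (hm j)).mul (hf.comp (Real.measurable_log.comp
        (measurable_coe_nnreal_real.comp (hm j))))).aemeasurable]
  -- the formula for `log (x y)` needs nonzero arguments, but zero factors contribute nothing
  have e1 : ∀ ω, ∑' j, (weight A (j :: u) ω : ℝ≥0∞) * f (Real.log (weight A (j :: u) ω)) =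
      (weight A u ω : ℝ≥0∞) * ∑' j, (A u ω j : ℝ≥0∞) *
        f (Real.log (weight A u ω) + Real.log (A u ω j)) := by
    intro ω
    rw [← ENNReal.tsum_mul_left]
    refine tsum_congr fun j => ?_
    by_cases h1 : weight A u ω = 0
    · simp [weight, h1]
    by_cases h2 : A u ω j = 0
    · simp [weight, h2]
    simp only [weight, NNReal.coe_mul, ENNReal.coe_mul]
    rw [Real.log_mul (by exact_mod_cast h1) (by exact_mod_cast h2), mul_assoc]
  simp_rw [e1]
  have hH : Measurable (Function.uncurry fun (x : ℝ≥0) (a : ℕ → ℝ≥0) =>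
      (x : ℝ≥0∞) * ∑' j, (a j : ℝ≥0∞) * f (Real.log x + Real.log (a j))) := by
    refine Measurable.mul (measurable_coe_nnreal_ennreal.comp measurable_fst)
      (Measurable.tsum fun j => Measurable.mul
        (measurable_coe_nnreal_ennreal.comp ((measurable_pi_apply j).comp measurable_snd))
        (hf.comp (Measurable.add ?_ ?_)))
    · exact Real.measurable_log.comp (measurable_coe_nnreal_real.comp measurable_fst)
    · exact Real.measurable_log.comp (measurable_coe_nnreal_real.comp
        ((measurable_pi_apply j).comp measurable_snd))
  refine (hA.lintegral_past_present u.2 (measurable_weight_past A u.2.le) hH).trans ?_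
  refine lintegral_congr fun ω => ?_
  rw [hA.lintegral_logIntensity_one (f := fun y => f (Real.log (weight A u ω) + y))
    (hf.comp (measurable_const.add measurable_id))]
  refine lintegral_const_mul _ (Measurable.tsum fun j => ?_)
  have hmj : Measurable fun ω => A [] ω j := (measurable_pi_apply j).comp (hA.measurable [])
  exact (measurable_coe_nnreal_ennreal.comp hmj).mul (hf.comp (measurable_const.add
    (Real.measurable_log.comp (measurable_coe_nnreal_real.comp hmj))))

/-- If the steps of the spine vanished, all nonzero factors would be equal to one, and their mean number
would be the mean sum of the factors, which is one. -/
theorem logIntensity_one_ne_dirac (hA : IsCascade P A)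
    (hN : 1 < ∫⁻ ω, ∑' j, (if A [] ω j = 0 then 0 else 1 : ℝ≥0∞) ∂P) :
    logIntensity P A 1 ≠ Measure.dirac 0 := by
  intro h
  have hms : MeasurableSet ({0}ᶜ : Set ℝ) := (measurableSet_singleton 0).compl
  have hf : Measurable (({0}ᶜ : Set ℝ).indicator (1 : ℝ → ℝ≥0∞)) := measurable_one.indicator hms
  have h1 := hA.lintegral_logIntensity_one hf
  have hm : ∀ j, Measurable fun ω => A [] ω j := fun j =>
    (measurable_pi_apply j).comp (hA.measurable [])
  have hmeas : Measurable fun ω => ∑' j, (A [] ω j : ℝ≥0∞) *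
      ({0}ᶜ : Set ℝ).indicator 1 (Real.log (A [] ω j)) :=
    Measurable.tsum fun j => (measurable_coe_nnreal_ennreal.comp (hm j)).mul
      (hf.comp (Real.measurable_log.comp (measurable_coe_nnreal_real.comp (hm j))))
  rw [h, lintegral_dirac' _ hf, Set.indicator_of_notMem (by simp), eq_comm,
    lintegral_eq_zero_iff hmeas] at h1
  have h2 : ∫⁻ ω, ∑' j, (if A [] ω j = 0 then 0 else 1 : ℝ≥0∞) ∂P = 1 := by
    refine Eq.trans ?_ hA.mean
    refine lintegral_congr_ae ?_
    filter_upwards [h1] with ω hω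
    refine tsum_congr fun j => ?_
    have h3 := ENNReal.tsum_eq_zero.1 hω j
    by_cases h0 : A [] ω j = 0
    · simp [h0]
    · have h4 : Real.log (A [] ω j) = 0 := by
        by_contra hne
        rw [Set.indicator_of_mem (by simpa using hne)] at h3
        simp [h0] at h3
      have h5 : (A [] ω j : ℝ) = 1 :=
        Real.eq_one_of_pos_of_log_eq_zero (by exact_mod_cast pos_iff_ne_zero.2 h0) h4
      have h6 : A [] ω j = 1 := by exact_mod_cast h5
      simp [h6]
  exact absurd h2 hN.ne'

theorem measurableSet_exists_le_weight (hA : IsCascade P A) (n : ℕ) (ε : ℝ≥0) :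
    MeasurableSet {ω | ∃ u : Gen n, ε ≤ weight A u ω} := by
  have : {ω | ∃ u : Gen n, ε ≤ weight A u ω} = ⋃ u : Gen n, {ω | ε ≤ weight A u ω} := by
    ext ω; simp
  rw [this]
  exact MeasurableSet.iUnion fun u => measurableSet_le measurable_const (hA.measurable_weight u)

/-- The largest weight of generation `n` tends to zero in probability.  A weight in `[ε, M]`
contributes at least `ε` to the weighted intensity of `[log ε, log M]`, which is the probability
that the spine is in this interval; a weight above `M` forces the total weight, of mean one, to
exceed `M`. -/
theorem tendsto_exists_le_weight (hA : IsCascade P A)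
    (hN : 1 < ∫⁻ ω, ∑' j, (if A [] ω j = 0 then 0 else 1 : ℝ≥0∞) ∂P) {ε : ℝ≥0} (hε : 0 < ε) :
    Tendsto (fun n => P {ω | ∃ u : Gen n, ε ≤ weight A u ω}) atTop (𝓝 0) := by
  have := hA.isProbabilityMeasure_logIntensity_one
  have hbound : ∀ (M : ℝ≥0), 0 < M → ∀ n, P {ω | ∃ u : Gen n, ε ≤ weight A u ω} ≤
      (M : ℝ≥0∞)⁻¹ + (ε : ℝ≥0∞)⁻¹ *
        logIntensity P A n (Set.Icc (Real.log ε) (Real.log M)) := by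
    intro M hM n
    set f : ℝ → ℝ≥0∞ := (Set.Icc (Real.log ε) (Real.log M)).indicator 1 with hf
    have hfm : Measurable f := measurable_one.indicator measurableSet_Icc
    have hgm : ∀ u : Gen n, Measurable fun ω =>
        (weight A u ω : ℝ≥0∞) * f (Real.log (weight A u ω)) := fun u =>
      (measurable_coe_nnreal_ennreal.comp (hA.measurable_weight u)).mul
        (hfm.comp (Real.measurable_log.comp
          (measurable_coe_nnreal_real.comp (hA.measurable_weight u))))
    have hsub : {ω | ∃ u : Gen n, ε ≤ weight A u ω} ⊆ {ω | (M : ℝ≥0∞) ≤ total A n ω} ∪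
        {ω | (ε : ℝ≥0∞) ≤ ∑' u : Gen n, (weight A u ω : ℝ≥0∞) *
          f (Real.log (weight A u ω))} := by
      rintro ω ⟨u, hu⟩
      rcases le_total (M : ℝ≥0) (weight A u ω) with h | h
      · left
        exact (ENNReal.coe_le_coe.2 h).trans
          (ENNReal.le_tsum (f := fun u : Gen n => (weight A u ω : ℝ≥0∞)) u)
      · right
        refine le_trans ?_ (ENNReal.le_tsum u)
        have hpos : (0 : ℝ) < weight A u ω := by exact_mod_cast hε.trans_le hu
        have hmem : Real.log (weight A u ω) ∈ Set.Icc (Real.log ε) (Real.log M) :=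
          ⟨Real.log_le_log (by exact_mod_cast hε) (by exact_mod_cast hu),
            Real.log_le_log hpos (by exact_mod_cast h)⟩
        rw [hf, Set.indicator_of_mem hmem, Pi.one_apply, mul_one]
        exact ENNReal.coe_le_coe.2 hu
    refine (measure_mono hsub).trans ((measure_union_le _ _).trans (add_le_add ?_ ?_))
    · have h := meas_ge_le_lintegral_div (μ := P) (hA.measurable_total n).aemeasurable
        (ε := (M : ℝ≥0∞)) (by exact_mod_cast hM.ne') ENNReal.coe_ne_top
      rwa [hA.lintegral_total, one_div] at h
    · have hsm : Measurable fun ω => ∑' u : Gen n, (weight A u ω : ℝ≥0∞) *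
          f (Real.log (weight A u ω)) := Measurable.tsum hgm
      have h := meas_ge_le_lintegral_div (μ := P) hsm.aemeasurable
        (ε := (ε : ℝ≥0∞)) (by exact_mod_cast hε.ne') ENNReal.coe_ne_top
      rw [lintegral_tsum fun u => (hgm u).aemeasurable, ← hA.lintegral_logIntensity n hfm, hf,
        lintegral_indicator_one measurableSet_Icc, ENNReal.div_eq_inv_mul] at h
      exact h
  rw [ENNReal.tendsto_nhds_zero]
  intro η hη
  obtain ⟨η', hη'0, hη'⟩ := ENNReal.lt_iff_exists_nnreal_btwn.1 hη
  have hη'0' : (0 : ℝ≥0) < η' := by exact_mod_cast hη'0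
  have hwalk := tendsto_conv_pow_Icc (hA.logIntensity_one_ne_dirac hN) hA.logIntensity_zero
    hA.logIntensity_succ (Real.log ε) (Real.log ((2 / η' : ℝ≥0)))
  have h2 := ENNReal.Tendsto.const_mul (a := (ε : ℝ≥0∞)⁻¹) hwalk
    (Or.inr (ENNReal.inv_ne_top.2 (by exact_mod_cast hε.ne')))
  rw [mul_zero, ENNReal.tendsto_nhds_zero] at h2
  filter_upwards [h2 ((η' / 2 : ℝ≥0) : ℝ≥0∞) (by exact_mod_cast (half_pos hη'0'))] with n hn
  refine (hbound (2 / η') (by positivity) n).trans (le_trans (add_le_add le_rfl hn) ?_)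
  rw [← ENNReal.coe_inv (by positivity), inv_div, ← ENNReal.coe_add, add_halves]
  exact hη'.le

end IsCascade

end MaximalWeight

/-! ### One branching step and the tilted cascade -/

section FixedWeights

theorem norm_prod_sub_prod_le_sum {ι : Type*} (F : Finset ι) {z w : ι → ℂ}
    (hz : ∀ i, ‖z i‖ ≤ 1) (hw : ∀ i, ‖w i‖ ≤ 1) :
    ‖∏ i ∈ F, z i - ∏ i ∈ F, w i‖ ≤ ∑ i ∈ F, ‖z i - w i‖ := by
  classical
  induction F using Finset.induction_on with
  | empty => simp
  | insert i F hi ih =>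
    rw [Finset.prod_insert hi, Finset.prod_insert hi, Finset.sum_insert hi]
    have e : z i * ∏ i ∈ F, z i - w i * ∏ i ∈ F, w i =
        (z i - w i) * ∏ i ∈ F, z i + w i * (∏ i ∈ F, z i - ∏ i ∈ F, w i) := by ring
    have h1 : ‖∏ i ∈ F, z i‖ ≤ 1 := by
      rw [norm_prod]
      exact Finset.prod_le_one (fun _ _ => norm_nonneg _) fun i _ => hz i
    rw [e]
    refine (norm_add_le _ _).trans (add_le_add ?_ ?_)
    · rw [norm_mul]
      exact mul_le_of_le_one_right (norm_nonneg _) h1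
    · rw [norm_mul]
      exact (mul_le_of_le_one_left (norm_nonneg _) (hw i)).trans ih

theorem norm_cexp_mul_le_one {z : ℂ} (hz : z.re ≤ 0) {b : ℝ} (hb : 0 ≤ b) :
    ‖Complex.exp (z * b)‖ ≤ 1 := by
  rw [Complex.norm_exp, Complex.re_mul_ofReal]
  exact Real.exp_le_one_iff.2 (mul_nonpos_of_nonpos_of_nonneg hz hb)

variable {Ω : Type*} [MeasurableSpace Ω] {P : Measure Ω} [IsProbabilityMeasure P]

theorem integral_expI_finset_sum {ι : Type*} {X : ι → Ω → ℝ} (hX : ∀ i, Measurable (X i))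
    (hind : iIndepFun X P) (F : Finset ι) :
    ∫ ω, expI (∑ i ∈ F, X i ω) ∂P = ∏ i ∈ F, ∫ ω, expI (X i ω) ∂P := by
  have key : ∀ f : Ω → ℝ, Measurable f → charFun (P.map f) 1 = ∫ ω, expI (f ω) ∂P :=
    fun f hf => by simpa using charFun_map_eq_integral_expI hf.aemeasurable 1
  have h := congrFun ((hind.restrict F).charFun_map_fun_finsetSum_eq_prod
    (fun i _ => (hX i).aemeasurable)) 1
  rw [key _ (Finset.measurable_fun_sum F fun i _ => hX i), Finset.prod_apply] at h
  rw [h]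
  exact Finset.prod_congr rfl fun i _ => key _ (hX i)

/-- Comparison of the characteristic function of a centred weighted sum `∑ a i (ξ i - 1)` of
independent variables with `exp (z ∑ b i)`, when each summand is comparable with `exp (z b i)`. -/
theorem norm_integral_expI_weighted_sum_sub_le {ι : Type*} [Countable ι] {ξ : ι → Ω → ℝ≥0∞}
    (hξ : ∀ i, Measurable (ξ i)) (hind : iIndepFun ξ P) (hmean : ∀ i, ∫⁻ ω, ξ i ω ∂P = 1)
    {φ : ℝ → ℂ} (hφ : ∀ i s, ∫ ω, expI (s * ((ξ i ω).toReal - 1)) ∂P = φ s)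
    {a : ι → ℝ≥0} (ha : ∑' i, (a i : ℝ≥0∞) ≠ ∞) {b : ι → ℝ} (hb0 : ∀ i, 0 ≤ b i)
    (hb : Summable b) {s : ℝ} {z : ℂ} (hz : z.re ≤ 0) {B : ℝ}
    (hB : ∀ i, ‖φ (s * a i) - Complex.exp (z * b i)‖ ≤ B * b i) :
    ‖∫ ω, expI (s * ((∑' i, (a i : ℝ≥0∞) * ξ i ω).toReal - (∑' i, (a i : ℝ≥0∞)).toReal)) ∂P -
      Complex.exp (z * ((∑' i, b i : ℝ) : ℂ))‖ ≤ B * ∑' i, b i := by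
  have hsum : ∀ᵐ ω ∂P, ∑' i, (a i : ℝ≥0∞) * ξ i ω ≠ ∞ := by
    have hm : Measurable fun ω => ∑' i, (a i : ℝ≥0∞) * ξ i ω :=
      Measurable.tsum fun i => (hξ i).const_mul _
    refine (ae_lt_top hm ?_).mono fun ω h => h.ne
    rw [lintegral_tsum fun i => ((hξ i).const_mul _).aemeasurable]
    simp_rw [lintegral_const_mul _ (hξ _), hmean, mul_one]
    exact ha
  have hfin : ∀ F : Finset ι, ‖∫ ω, expI (∑ i ∈ F, s * a i * ((ξ i ω).toReal - 1)) ∂P -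
      Complex.exp (z * ((∑ i ∈ F, b i : ℝ) : ℂ))‖ ≤ B * ∑ i ∈ F, b i := by
    intro F
    have hX : ∀ i, Measurable fun ω => s * a i * ((ξ i ω).toReal - 1) := fun i =>
      ((hξ i).ennreal_toReal.sub_const 1).const_mul _
    have hi : iIndepFun (fun i ω => s * a i * ((ξ i ω).toReal - 1)) P :=
      hind.comp (fun i x => s * a i * (x.toReal - 1)) fun i =>
        (ENNReal.measurable_toReal.sub_const 1).const_mul _
    rw [integral_expI_finset_sum hX hi]
    have e : Complex.exp (z * ((∑ i ∈ F, b i : ℝ) : ℂ)) = ∏ i ∈ F, Complex.exp (z * b i) := by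
      rw [← Complex.exp_sum, Complex.ofReal_sum, Finset.mul_sum]
    rw [e]
    refine (norm_prod_sub_prod_le_sum F (fun i => norm_integral_expI_le _)
      fun i => norm_cexp_mul_le_one hz (hb0 i)).trans ?_
    rw [Finset.mul_sum]
    refine Finset.sum_le_sum fun i _ => ?_
    rw [hφ]
    exact hB i
  have hl : Tendsto (fun F : Finset ι => ∫ ω, expI (∑ i ∈ F, s * a i * ((ξ i ω).toReal - 1)) ∂P)
      atTop (𝓝 (∫ ω, expI (s * ((∑' i, (a i : ℝ≥0∞) * ξ i ω).toReal -
        (∑' i, (a i : ℝ≥0∞)).toReal)) ∂P)) := by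
    refine tendsto_integral_filter_of_dominated_convergence (fun _ => 1) ?_ ?_
      (integrable_const _) ?_
    · refine Eventually.of_forall fun F => Measurable.aestronglyMeasurable ?_
      refine measurable_expI.comp (Finset.measurable_fun_sum F fun i _ => ?_)
      exact ((hξ i).ennreal_toReal.sub_const 1).const_mul _
    · exact Eventually.of_forall fun F => ae_of_all _ fun ω => by simp
    · filter_upwards [hsum] with ω hω
      refine (continuous_expI.tendsto _).comp ?_
      have h1 : HasSum (fun i => ((a i : ℝ≥0∞) * ξ i ω).toReal)
          (∑' i, (a i : ℝ≥0∞) * ξ i ω).toReal := by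
        rw [ENNReal.tsum_toReal_eq fun i => ENNReal.ne_top_of_tsum_ne_top hω i]
        exact ENNReal.hasSum_toReal hω
      have h2 : HasSum (fun i => ((a i : ℝ≥0∞)).toReal) (∑' i, (a i : ℝ≥0∞)).toReal := by
        rw [ENNReal.tsum_toReal_eq fun i => ENNReal.coe_ne_top]
        exact ENNReal.hasSum_toReal ha
      have h3 := (h1.sub h2).mul_left s
      refine h3.congr fun F => ?_
      refine Finset.sum_congr rfl fun i _ => ?_
      simp only [ENNReal.toReal_mul, ENNReal.coe_toReal]; ring
  have hr : Tendsto (fun F : Finset ι => Complex.exp (z * ((∑ i ∈ F, b i : ℝ) : ℂ))) atTop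
      (𝓝 (Complex.exp (z * ((∑' i, b i : ℝ) : ℂ)))) :=
    (Complex.continuous_exp.tendsto _).comp
      (((Complex.continuous_ofReal.tendsto _).comp hb.hasSum).const_mul z)
  exact le_of_tendsto_of_tendsto (hl.sub hr).norm (hb.hasSum.const_mul B)
    (Eventually.of_forall hfin)

/-- Integrating a bounded function of two independent variables, one after the other. -/
theorem integral_indepFun {E F : Type*} [MeasurableSpace E] [MeasurableSpace F] {p : Ω → E}
    {q : Ω → F} (hp : Measurable p) (hq : Measurable q) (h : IndepFun p q P) {H : E → F → ℂ}
    (hH : Measurable (Function.uncurry H)) {M : ℝ} (hM : ∀ x y, ‖H x y‖ ≤ M) :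
    ∫ ω, H (p ω) (q ω) ∂P = ∫ ω, ∫ ω', H (p ω) (q ω') ∂P ∂P := by
  have h1 := (indepFun_iff_map_prod_eq_prod_map_map hp.aemeasurable hq.aemeasurable).1 h
  have h2 : ∫ ω, H (p ω) (q ω) ∂P =
      ∫ z, Function.uncurry H z ∂(P.map fun ω => (p ω, q ω)) :=
    (integral_map (hp.prodMk hq).aemeasurable hH.aestronglyMeasurable).symm
  have := Measure.isProbabilityMeasure_map (μ := P) hq.aemeasurable
  have := Measure.isProbabilityMeasure_map (μ := P) hp.aemeasurable
  have hi : Integrable (Function.uncurry H) ((P.map p).prod (P.map q)) :=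
    (integrable_const M).mono' hH.aestronglyMeasurable (ae_of_all _ fun z => hM _ _)
  rw [h2, h1, integral_prod _ hi, integral_map hp.aemeasurable
    hH.stronglyMeasurable.integral_prod_right'.aestronglyMeasurable]
  refine integral_congr_ae (ae_of_all _ fun ω => ?_)
  exact integral_map hq.aemeasurable (hH.comp measurable_prodMk_left).aestronglyMeasurable

theorem measurable_family {ι E : Type*} [MeasurableSpace E] {_ : MeasurableSpace Ω}
    {f : ι → Ω → E} (hf : ∀ i, Measurable (f i)) : Measurable fun ω i => f i ω :=
  measurable_pi_lambda _ hf

/-- A bound for the conditional expectation of `h p q` given `(G, p)` bounds the integral of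
`G * h p q`, if `q` is independent of `(G, p)` and `|G| ≤ 1`. -/
theorem norm_integral_mul_le_of_indepFun {E F : Type*} [MeasurableSpace E] [MeasurableSpace F]
    {p : Ω → E} {q : Ω → F} {G : Ω → ℂ} (hp : Measurable p) (hq : Measurable q)
    (hG : Measurable G) (hG1 : ∀ ω, ‖G ω‖ ≤ 1) (hind : IndepFun (fun ω => (G ω, p ω)) q P)
    {h : E → F → ℂ} (hh : Measurable (Function.uncurry h)) {M : ℝ} (hM : ∀ x y, ‖h x y‖ ≤ M)
    {bound : Ω → ℝ} (hbi : Integrable bound P)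
    (hbound : ∀ᵐ ω ∂P, ‖∫ ω', h (p ω) (q ω') ∂P‖ ≤ bound ω) :
    ‖∫ ω, G ω * h (p ω) (q ω) ∂P‖ ≤ ∫ ω, bound ω ∂P := by
  -- truncating `G`, which changes nothing, makes the integrand bounded on the whole product space
  set T : ℂ → ℂ := fun x => if ‖x‖ ≤ 1 then x else 0 with hT
  have hTm : Measurable T :=
    Measurable.ite (measurableSet_le measurable_norm measurable_const) measurable_id
      measurable_const
  have hT1 : ∀ x, ‖T x‖ ≤ 1 := by
    intro x
    simp only [hT]
    split_ifs with h
    · exact h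
    · simp
  have hTG : ∀ ω, T (G ω) = G ω := fun ω => if_pos (hG1 ω)
  have hm1 : Measurable fun w : (ℂ × E) × F => T w.1.1 :=
    hTm.comp (measurable_fst.comp measurable_fst)
  have hm2 : Measurable fun w : (ℂ × E) × F => h w.1.2 w.2 :=
    hh.comp ((measurable_snd.comp measurable_fst).prodMk measurable_snd)
  have hsplit := integral_indepFun (hG.prodMk hp) hq hind
    (H := fun (x : ℂ × E) y => T x.1 * h x.2 y) (hm1.mul hm2) (M := M) fun x y => by
      rw [norm_mul]
      exact (mul_le_of_le_one_left (norm_nonneg _) (hT1 _)).trans (hM _ _)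
  simp only [hTG] at hsplit
  rw [hsplit]
  refine norm_integral_le_of_norm_le hbi ?_
  filter_upwards [hbound] with ω hω
  rw [integral_const_mul, norm_mul]
  exact (mul_le_of_le_one_left (norm_nonneg _) (hG1 ω)).trans hω

end FixedWeights

section Tilting

variable {Ω : Type*} [MeasurableSpace Ω]

/-- The cascade with factors `A ^ α / κ`.  It is normalized when `κ` is the mean of the sum of the
`α`-th powers of the factors. -/
noncomputable def tilt (α : ℝ) (κ : ℝ≥0) (A : List ℕ → Ω → ℕ → ℝ≥0) (u : List ℕ) (ω : Ω) (j : ℕ) :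
    ℝ≥0 :=
  A u ω j ^ α / κ

theorem weight_tilt (α : ℝ) (κ : ℝ≥0) (A : List ℕ → Ω → ℕ → ℝ≥0) (ω : Ω) :
    ∀ u : List ℕ, weight (tilt α κ A) u ω = weight A u ω ^ α / κ ^ u.length
  | [] => by simp [weight]
  | j :: u => by
    rw [weight, weight, weight_tilt α κ A ω u, tilt, NNReal.mul_rpow, List.length_cons, pow_succ,
      div_mul_div_comm]

theorem weight_rpow {α : ℝ} {κ : ℝ≥0} (hκ : κ ≠ 0) (A : List ℕ → Ω → ℕ → ℝ≥0) (ω : Ω)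
    {n : ℕ} (u : Gen n) : weight A u ω ^ α = κ ^ n * weight (tilt α κ A) u ω := by
  rw [weight_tilt, u.2, mul_div_cancel₀ _ (pow_ne_zero n hκ)]

theorem measurable_tilt_map (α : ℝ) (κ : ℝ≥0) :
    Measurable fun (a : ℕ → ℝ≥0) (j : ℕ) => a j ^ α / κ := by
  refine measurable_pi_lambda _ fun j => ?_
  simp only [div_eq_mul_inv]
  exact ((measurable_pi_apply j).pow_const α).mul_const _

end Tilting

section OneStep

variable {Ω : Type*} [MeasurableSpace Ω] {P : Measure Ω} [IsProbabilityMeasure P]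
  {A : List ℕ → Ω → ℕ → ℝ≥0}

/-- The characteristic function of the centred sum of the factors of one individual. -/
noncomputable def offspringCharFun (P : Measure Ω) (A : List ℕ → Ω → ℕ → ℝ≥0) (s : ℝ) : ℂ :=
  ∫ ω, expI (s * ((childSum A [] ω).toReal - 1)) ∂P

theorem IsCascade.iIndepFun_childSum (hA : IsCascade P A) (n : ℕ) :
    iIndepFun (fun (u : Gen n) ω => childSum A u ω) P :=
  (hA.indep.precomp (g := fun u : Gen n => u.1) Subtype.val_injective).comp
    (fun _ a => ∑' j, (a j : ℝ≥0∞)) fun _ => measurable_tsum_coe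

theorem IsCascade.identDistrib_childSum (hA : IsCascade P A) (u : List ℕ) :
    IdentDistrib (childSum A u) (childSum A []) P P :=
  (hA.ident u).comp (u := fun a : ℕ → ℝ≥0 => ∑' j, (a j : ℝ≥0∞)) measurable_tsum_coe

/-- The difference between the character of the increment of the total weight, given the weights `x`
of a generation and the sums `y` of the factors of their children, and its approximation. -/
noncomputable def stepError {ι : Type*} (α s : ℝ) (z : ℂ) (x : ι → ℝ≥0) (y : ι → ℝ≥0∞) : ℂ :=
  expI (s * ((∑' u, (x u : ℝ≥0∞) * y u).toReal - (∑' u, (x u : ℝ≥0∞)).toReal)) -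
    Complex.exp (z * (∑' u, ((x u ^ α : ℝ≥0) : ℝ≥0∞)).toReal)

theorem norm_stepError_le {ι : Type*} (α s : ℝ) {z : ℂ} (hz : z.re ≤ 0) (x : ι → ℝ≥0)
    (y : ι → ℝ≥0∞) : ‖stepError α s z x y‖ ≤ 2 := by
  refine (norm_sub_le _ _).trans ?_
  rw [norm_expI]
  have := norm_cexp_mul_le_one hz (b := (∑' u, ((x u ^ α : ℝ≥0) : ℝ≥0∞)).toReal)
    ENNReal.toReal_nonneg
  linarith

theorem measurable_stepError {ι : Type*} [Countable ι] (α s : ℝ) (z : ℂ) :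
    Measurable (Function.uncurry (stepError (ι := ι) α s z)) := by
  have m1 : Measurable fun w : (ι → ℝ≥0) × (ι → ℝ≥0∞) => ∑' u, (w.1 u : ℝ≥0∞) * w.2 u :=
    Measurable.tsum fun u => (measurable_coe_nnreal_ennreal.comp
      ((measurable_pi_apply u).comp measurable_fst)).mul
        ((measurable_pi_apply u).comp measurable_snd)
  have m2 : Measurable fun w : (ι → ℝ≥0) × (ι → ℝ≥0∞) => ∑' u, (w.1 u : ℝ≥0∞) :=
    measurable_tsum_coe_nnreal fun u => (measurable_pi_apply u).comp measurable_fst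
  have m3 : Measurable fun w : (ι → ℝ≥0) × (ι → ℝ≥0∞) => ∑' u, ((w.1 u ^ α : ℝ≥0) : ℝ≥0∞) :=
    measurable_tsum_coe_nnreal fun u =>
      ((measurable_pi_apply u).comp measurable_fst).pow_const α
  have m4 : Measurable fun w : (ι → ℝ≥0) × (ι → ℝ≥0∞) =>
      expI (s * ((∑' u, (w.1 u : ℝ≥0∞) * w.2 u).toReal - (∑' u, (w.1 u : ℝ≥0∞)).toReal)) :=
    measurable_expI.comp ((m1.ennreal_toReal.sub m2.ennreal_toReal).const_mul s)
  have m5 : Measurable fun w : (ι → ℝ≥0) × (ι → ℝ≥0∞) =>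
      Complex.exp (z * (∑' u, ((w.1 u ^ α : ℝ≥0) : ℝ≥0∞)).toReal) :=
    Complex.measurable_exp.comp ((Complex.measurable_ofReal.comp m3.ennreal_toReal).const_mul z)
  exact m4.sub m5

/-- The sum of the `α`-th powers of the weights, which scales the stable limit of one step, is a
multiple of the total weight of the tilted cascade. -/
theorem tsum_weight_rpow {α : ℝ} {κ : ℝ≥0} (hκ : κ ≠ 0) (A : List ℕ → Ω → ℕ → ℝ≥0) (n : ℕ)
    (ω : Ω) : ∑' u : Gen n, ((weight A u ω ^ α : ℝ≥0) : ℝ≥0∞) =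
      (κ : ℝ≥0∞) ^ n * total (BRW.tilt α κ A) n ω := by
  rw [total, ← ENNReal.tsum_mul_left]
  refine tsum_congr fun u => ?_
  rw [weight_rpow hκ A ω u]; push_cast; rfl

theorem toReal_tsum_weight_rpow {α : ℝ} {κ : ℝ≥0} (hκ : κ ≠ 0) (A : List ℕ → Ω → ℕ → ℝ≥0) (n : ℕ)
    (ω : Ω) : (∑' u : Gen n, ((weight A u ω ^ α : ℝ≥0) : ℝ≥0∞)).toReal =
      (κ : ℝ) ^ n * (total (BRW.tilt α κ A) n ω).toReal := by
  rw [tsum_weight_rpow hκ, ENNReal.toReal_mul, ENNReal.toReal_pow, ENNReal.coe_toReal]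

theorem IsCascade.integral_total (hA : IsCascade P A) (n : ℕ) :
    ∫ ω, (total A n ω).toReal ∂P = 1 := by
  rw [integral_toReal (hA.measurable_total n).aemeasurable
    (hA.ae_total_lt_top.mono fun ω h => h n), hA.lintegral_total]
  simp

/-- The one-step estimate with the past frozen at `ω` and an independent copy `ω'` of the present. -/
theorem IsCascade.norm_integral_stepError_le (hA : IsCascade P A) {α s : ℝ} {κ : ℝ≥0} (hκ : κ ≠ 0)
    {n : ℕ} {z : ℂ} (hz : z.re ≤ 0) {B : ℝ} {ω : Ω} (h1 : total A n ω ≠ ∞)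
    (h2 : total (BRW.tilt α κ A) n ω ≠ ∞)
    (hB : ∀ u : Gen n, ‖offspringCharFun P A (s * weight A u ω) -
      Complex.exp (z * ((weight A u ω : ℝ) ^ α : ℝ))‖ ≤ B * (weight A u ω : ℝ) ^ α) :
    ‖∫ ω', stepError α s z (fun u : Gen n => weight A u ω) (fun u => childSum A u ω') ∂P‖ ≤
      B * κ ^ n * (total (BRW.tilt α κ A) n ω).toReal := by
  have hne : ∑' u : Gen n, ((weight A u ω ^ α : ℝ≥0) : ℝ≥0∞) ≠ ∞ := by
    rw [tsum_weight_rpow hκ]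
    exact ENNReal.mul_ne_top (ENNReal.pow_ne_top ENNReal.coe_ne_top) h2
  have hts : (∑' u : Gen n, ((weight A u ω ^ α : ℝ≥0) : ℝ≥0∞)).toReal =
      ∑' u : Gen n, (weight A u ω : ℝ) ^ α := by
    rw [ENNReal.tsum_toReal_eq fun i => ENNReal.coe_ne_top]
    simp
  have hsm : Summable fun u : Gen n => (weight A u ω : ℝ) ^ α := by
    have := ENNReal.summable_toReal hne
    simpa using this
  have key := norm_integral_expI_weighted_sum_sub_le (P := P)
    (ξ := fun (u : Gen n) ω' => childSum A u ω') (fun u => hA.measurable_childSum u)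
    (hA.iIndepFun_childSum n)
    (fun u => by rw [(hA.identDistrib_childSum u).lintegral_eq]; exact hA.mean)
    (φ := offspringCharFun P A)
    (fun u s => ((hA.identDistrib_childSum u).comp
      (u := fun x : ℝ≥0∞ => expI (s * (x.toReal - 1))) (measurable_expI.comp
        ((ENNReal.measurable_toReal.sub_const 1).const_mul s))).integral_eq)
    (a := fun u : Gen n => weight A u ω) h1
    (b := fun u : Gen n => (weight A u ω : ℝ) ^ α)
    (fun u => Real.rpow_nonneg (weight A u ω).2 α) hsm hz hB
  have hi1 : Integrable (fun ω' => expI (s * ((∑' u : Gen n, (weight A u ω : ℝ≥0∞) *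
      childSum A u ω').toReal - (∑' u : Gen n, (weight A u ω : ℝ≥0∞)).toReal))) P := by
    refine integrable_expI (Measurable.aemeasurable ?_)
    have : Measurable fun ω' => ∑' u : Gen n, (weight A u ω : ℝ≥0∞) * childSum A u ω' :=
      Measurable.tsum fun u => (hA.measurable_childSum u).const_mul _
    exact (this.ennreal_toReal.sub_const _).const_mul s
  simp only [stepError]
  rw [integral_sub hi1 (integrable_const _), integral_const, probReal_univ, one_smul]
  rw [← hts] at key
  refine key.trans (le_of_eq ?_)
  rw [toReal_tsum_weight_rpow hκ]; ring

/-- One step of the cascade, conditionally on the past: the increment of the total weight is a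
weighted sum of independent centred variables, and its conditional characteristic function is close
to the exponential of a multiple of the tilted total weight.  On the set `D` some weight is too large
for the approximation, and only the trivial bound is used. -/
theorem IsCascade.norm_integral_mul_step_le (hA : IsCascade P A) {α : ℝ} {κ : ℝ≥0} (hκ : κ ≠ 0)
    (hT : IsCascade P (BRW.tilt α κ A)) {n : ℕ} {G : Ω → ℂ} (hG : Measurable[past A n] G)
    (hG1 : ∀ ω, ‖G ω‖ ≤ 1) {s : ℝ} {z : ℂ} (hz : z.re ≤ 0) {B : ℝ} (hB0 : 0 ≤ B) {D : Set Ω}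
    (hD : MeasurableSet D)
    (hB : ∀ ω, ω ∉ D → ∀ u : Gen n, ‖offspringCharFun P A (s * weight A u ω) -
      Complex.exp (z * ((weight A u ω : ℝ) ^ α : ℝ))‖ ≤ B * (weight A u ω : ℝ) ^ α) :
    ‖∫ ω, G ω * (expI (s * ((total A (n + 1) ω).toReal - (total A n ω).toReal)) -
      Complex.exp (z * κ ^ n * (total (BRW.tilt α κ A) n ω).toReal)) ∂P‖ ≤
      B * κ ^ n + 2 * P.real D := by
  set p : Ω → Gen n → ℝ≥0 := fun ω u => weight A u ω with hp
  set q : Ω → Gen n → ℝ≥0∞ := fun ω u => childSum A u ω with hq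
  have hpm : Measurable[past A n] p :=
    measurable_family fun u => measurable_weight_past A u.2.le
  have hqm' : Measurable[⨆ u ∈ {u : List ℕ | u.length = n},
      MeasurableSpace.comap (A u) inferInstance] q :=
    measurable_family fun u => measurable_tsum_coe.comp
      (measurable_present A u.2)
  have hqm : Measurable q := measurable_pi_lambda _ fun u => hA.measurable_childSum u
  have hYint := hT.integrable_total n
  have hDint : Integrable (D.indicator fun _ => (2 : ℝ)) P := (integrable_const 2).indicator hD
  have hbd : ∀ᵐ ω ∂P, ‖∫ ω', stepError α s z (p ω) (q ω') ∂P‖ ≤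
      B * κ ^ n * (total (BRW.tilt α κ A) n ω).toReal + D.indicator (fun _ => 2) ω := by
    filter_upwards [hA.ae_total_lt_top, hT.ae_total_lt_top] with ω h1 h2
    by_cases hω : ω ∈ D
    · rw [Set.indicator_of_mem hω]
      refine (norm_integral_le_of_norm_le_const (C := 2)
        (ae_of_all _ fun ω' => norm_stepError_le α s hz _ _)).trans ?_
      rw [probReal_univ, mul_one]
      have : 0 ≤ B * κ ^ n * (total (BRW.tilt α κ A) n ω).toReal :=
        mul_nonneg (mul_nonneg hB0 (pow_nonneg κ.2 n)) ENNReal.toReal_nonneg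
      linarith
    · rw [Set.indicator_of_notMem hω, add_zero]
      exact hA.norm_integral_stepError_le hκ hz (h1 n).ne (h2 n).ne (hB ω hω)
  have key := norm_integral_mul_le_of_indepFun (hpm.mono (hA.past_le n) le_rfl) hqm
    (hG.mono (hA.past_le n) le_rfl) hG1 (hA.indepFun_past (Measurable.prodMk hG hpm) hqm')
    (measurable_stepError α s z) (norm_stepError_le α s hz) ((hYint.const_mul _).add hDint) hbd
  have e1 : ∀ ω, G ω * (expI (s * ((total A (n + 1) ω).toReal - (total A n ω).toReal)) -
      Complex.exp (z * κ ^ n * (total (BRW.tilt α κ A) n ω).toReal)) =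
      G ω * stepError α s z (p ω) (q ω) := by
    intro ω
    rw [stepError, toReal_tsum_weight_rpow hκ, total_succ, total]
    push_cast
    rw [mul_assoc z]
  simp_rw [e1]
  refine key.trans (le_of_eq ?_)
  have e := integral_add (hYint.const_mul (B * (κ : ℝ) ^ n)) hDint
  rw [integral_const_mul, hT.integral_total, integral_indicator_const _ hD, smul_eq_mul] at e
  refine Eq.trans e ?_
  ring

end OneStep

/-! ### Fluctuations of the martingale -/

section Fluctuations

variable {Ω : Type*} [MeasurableSpace Ω]

theorem past_tilt_le (α : ℝ) (κ : ℝ≥0) (A : List ℕ → Ω → ℕ → ℝ≥0) (n : ℕ) :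
    past (tilt α κ A) n ≤ past A n :=
  iSup₂_le fun _ hu => measurable_iff_comap_le.1
    ((measurable_tilt_map α κ).comp (measurable_past A hu))

theorem measurable_expI_mul_cexp {m : MeasurableSpace Ω} {f g h : Ω → ℝ≥0∞} (hf : Measurable f)
    (hg : Measurable g) (hh : Measurable h) (s : ℝ) (z : ℂ) :
    Measurable fun ω => expI (s * ((f ω).toReal - (g ω).toReal)) *
      Complex.exp (z * (h ω).toReal) :=
  (measurable_expI.comp ((hf.ennreal_toReal.sub hg.ennreal_toReal).const_mul s)).mul
    (Complex.measurable_exp.comp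
      ((Complex.measurable_ofReal.comp hh.ennreal_toReal).const_mul z))

theorem norm_expI_mul_cexp_le {z : ℂ} (hz : z.re ≤ 0) (x : ℝ) {b : ℝ} (hb : 0 ≤ b) :
    ‖expI x * Complex.exp (z * b)‖ ≤ 1 := by
  rw [norm_mul, norm_expI, one_mul]
  exact norm_cexp_mul_le_one hz hb

/-- The normalization `κ ^ (-n / α)` of the fluctuations after generation `n`. -/
noncomputable def scale (α : ℝ) (κ : ℝ≥0) (n : ℕ) : ℝ := (κ : ℝ) ^ (-(n : ℝ) / α)

theorem scale_nonneg (α : ℝ) (κ : ℝ≥0) (n : ℕ) : 0 ≤ scale α κ n := Real.rpow_nonneg κ.2 _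

theorem scale_rpow_mul {α : ℝ} (hα : α ≠ 0) {κ : ℝ≥0} (hκ : 0 < κ) (n K : ℕ) :
    scale α κ n ^ α * (κ : ℝ) ^ (n + K) = (κ : ℝ) ^ K := by
  have hκ' : (0 : ℝ) < κ := by exact_mod_cast hκ
  rw [scale, ← Real.rpow_mul hκ'.le, div_mul_cancel₀ _ hα, Real.rpow_neg hκ'.le,
    Real.rpow_natCast, pow_add, ← mul_assoc, inv_mul_cancel₀ (pow_ne_zero n hκ'.ne'), one_mul]

variable {P : Measure Ω} [IsProbabilityMeasure P] {A : List ℕ → Ω → ℕ → ℝ≥0} {α c : ℝ} {κ : ℝ≥0}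

/-- The almost sure limit of the total weights. -/
noncomputable def limTotal (A : List ℕ → Ω → ℕ → ℝ≥0) (ω : Ω) : ℝ :=
  (limsup (fun n => total A n ω) atTop).toReal

theorem IsCascade.measurable_limTotal (hA : IsCascade P A) : Measurable (limTotal A) :=
  (Measurable.limsup hA.measurable_total).ennreal_toReal

theorem IsCascade.ae_tendsto_toReal_total (hA : IsCascade P A) :
    ∀ᵐ ω ∂P, Tendsto (fun n => (total A n ω).toReal) atTop (𝓝 (limTotal A ω)) := by
  filter_upwards [hA.ae_tendsto_total] with ω h
  exact (ENNReal.tendsto_toReal h.2.ne).comp h.1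

/-- One-step approximation, uniform in the past: at the scale of generation `n`, the conditional
characteristic function of the increment from generation `n + K` is asymptotically that of a stable
law, mixed with the tilted total weight. -/
theorem tendsto_integral_mul_step (hA : IsCascade P A) (hT : IsCascade P (tilt α κ A))
    (hα : α ∈ Set.Ioo (1 : ℝ) 2) (hc : 0 ≤ c) (hκ0 : 0 < κ) (hκ1 : κ < 1)
    (hloc : ∀ ε > 0, ∃ δ > 0, ∀ s : ℝ, |s| ≤ δ →
      ‖offspringCharFun P A s - Complex.exp (stableExponent α c s)‖ ≤ ε * |s| ^ α)
    (hmax : ∀ ε : ℝ≥0, 0 < ε →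
      Tendsto (fun n => P {ω | ∃ u : Gen n, ε ≤ weight (tilt α κ A) u ω}) atTop (𝓝 0))
    (t : ℝ) (K : ℕ) {G : ℕ → Ω → ℂ} (hG : ∀ n, Measurable[past A (n + K)] (G n))
    (hG1 : ∀ n ω, ‖G n ω‖ ≤ 1) :
    Tendsto (fun n => ∫ ω, G n ω * (expI (scale α κ n * t *
        ((total A (n + K + 1) ω).toReal - (total A (n + K) ω).toReal)) -
      Complex.exp (stableExponent α c t * κ ^ K * (total (tilt α κ A) (n + K) ω).toReal)) ∂P)
      atTop (𝓝 0) := by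
  have hα0 : α ≠ 0 := by linarith [hα.1]
  have hαp : 0 < α := by linarith [hα.1]
  have hκ0' : (0 : ℝ) < κ := by exact_mod_cast hκ0
  have hκK : (κ : ℝ) ^ K ≤ 1 := pow_le_one₀ hκ0'.le (by exact_mod_cast hκ1.le)
  have htα : 0 ≤ |t| ^ α := Real.rpow_nonneg (abs_nonneg t) _
  rw [Metric.tendsto_atTop']
  intro η hη
  set ε : ℝ := η / (2 * (|t| ^ α + 1)) with hε
  have hε0 : 0 < ε := by positivity
  obtain ⟨δ, hδ0, hδ⟩ := hloc ε hε0
  -- weights of the tilted cascade below `ε'` keep the argument below `δ`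
  have hδα : 0 < δ ^ α := Real.rpow_pos_of_pos hδ0 _
  set ε' : ℝ≥0 := ⟨δ ^ α / (|t| ^ α + 1), by positivity⟩ with hε'
  have hε'0 : 0 < ε' := by
    have : (0 : ℝ) < δ ^ α / (|t| ^ α + 1) := by positivity
    exact NNReal.coe_pos.1 this
  set D : ℕ → Set Ω := fun n => {ω | ∃ u : Gen (n + K), ε' ≤ weight (tilt α κ A) u ω} with hD
  have hDlim : Tendsto (fun n => P.real (D n)) atTop (𝓝 0) := by
    have h1 := (ENNReal.tendsto_toReal ENNReal.zero_ne_top).comp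
      ((hmax ε' hε'0).comp (tendsto_add_atTop_nat K))
    simpa [Measure.real, hD, Function.comp_def] using h1
  obtain ⟨n0, hn0⟩ := eventually_atTop.1 (hDlim.eventually (Iio_mem_nhds (by positivity :
    (0 : ℝ) < η / 4)))
  refine ⟨n0, fun n hn => ?_⟩
  rw [dist_zero_right]
  have hsc := scale_rpow_mul hα0 hκ0 n K
  have hsn := scale_nonneg α κ n
  have hsabs : |scale α κ n * t| ^ α = scale α κ n ^ α * |t| ^ α := by
    rw [abs_mul, abs_of_nonneg hsn, Real.mul_rpow hsn (abs_nonneg t)]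
  have hkey := hA.norm_integral_mul_step_le hκ0.ne' hT (hG n) (hG1 n)
    (s := scale α κ n * t) (z := stableExponent α c (scale α κ n * t))
    (stableExponent_re_nonpos hα hc _) (B := ε * |scale α κ n * t| ^ α) (by positivity)
    (D := D n) (hT.measurableSet_exists_le_weight _ _) (by
      intro ω hω u
      set w : ℝ := ((weight A (u : List ℕ) ω : ℝ≥0) : ℝ) with hw
      have hw0 : 0 ≤ w := NNReal.coe_nonneg _
      have hlt : weight (tilt α κ A) u ω < ε' := by
        by_contra h
        exact hω ⟨u, not_lt.1 h⟩
      have hlt' : (weight (tilt α κ A) u ω : ℝ) ≤ δ ^ α / (|t| ^ α + 1) :=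
        NNReal.coe_le_coe.2 hlt.le
      have hwα : w ^ α = (κ : ℝ) ^ (n + K) * weight (tilt α κ A) u ω := by
        have := congrArg NNReal.toReal (weight_rpow hκ0.ne' A ω u (α := α))
        simpa using this
      have e1 : |scale α κ n * t * w| = w * |scale α κ n * t| := by
        rw [abs_mul, abs_of_nonneg hw0, mul_comm]
      have e2 : |scale α κ n * t * w| ^ α = |scale α κ n * t| ^ α * w ^ α := by
        rw [e1, Real.mul_rpow hw0 (abs_nonneg _), mul_comm]
      have hle : |scale α κ n * t * w| ≤ δ := by
        refine (Real.rpow_le_rpow_iff (abs_nonneg _) hδ0.le hαp).1 ?_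
        rw [e2, hsabs, hwα]
        calc scale α κ n ^ α * |t| ^ α * ((κ : ℝ) ^ (n + K) * weight (tilt α κ A) u ω)
            = (scale α κ n ^ α * (κ : ℝ) ^ (n + K)) * (|t| ^ α * weight (tilt α κ A) u ω) := by
              ring
          _ = (κ : ℝ) ^ K * (|t| ^ α * weight (tilt α κ A) u ω) := by rw [hsc]
          _ ≤ 1 * (|t| ^ α * (δ ^ α / (|t| ^ α + 1))) := by
              refine mul_le_mul hκK (mul_le_mul_of_nonneg_left hlt' htα) ?_ zero_le_one
              exact mul_nonneg htα (weight (tilt α κ A) u ω).2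
          _ = δ ^ α * (|t| ^ α / (|t| ^ α + 1)) := by ring
          _ ≤ δ ^ α * 1 := by
              refine mul_le_mul_of_nonneg_left ?_ hδα.le
              rw [div_le_one (by positivity)]; linarith
          _ = δ ^ α := mul_one _
      have h3 := hδ _ hle
      have e3 : stableExponent α c (scale α κ n * t * w) =
          stableExponent α c (scale α κ n * t) * ((w ^ α : ℝ) : ℂ) := by
        rw [mul_comm _ w, stableExponent_scale α c hw0 hα0, mul_comm]
      rw [e3, e2, ← mul_assoc] at h3
      exact h3)
  have e4 : stableExponent α c (scale α κ n * t) * (κ : ℂ) ^ (n + K) =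
      stableExponent α c t * (κ : ℂ) ^ K := by
    rw [stableExponent_scale α c hsn hα0]
    have : ((scale α κ n ^ α : ℝ) : ℂ) * ((κ : ℝ) : ℂ) ^ (n + K) = ((κ : ℝ) : ℂ) ^ K := by
      exact_mod_cast congrArg (fun x : ℝ => (x : ℂ)) hsc
    calc _ = stableExponent α c t * (((scale α κ n ^ α : ℝ) : ℂ) * ((κ : ℝ) : ℂ) ^ (n + K)) := by
          ring
      _ = _ := by rw [this]
  rw [e4] at hkey
  refine lt_of_le_of_lt hkey ?_
  have h5 : ε * |scale α κ n * t| ^ α * (κ : ℝ) ^ (n + K) ≤ η / 2 := by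
    rw [hsabs]
    calc ε * (scale α κ n ^ α * |t| ^ α) * (κ : ℝ) ^ (n + K)
        = ε * |t| ^ α * (scale α κ n ^ α * (κ : ℝ) ^ (n + K)) := by ring
      _ = ε * |t| ^ α * (κ : ℝ) ^ K := by rw [hsc]
      _ ≤ ε * (|t| ^ α + 1) * 1 := by
          refine mul_le_mul (mul_le_mul_of_nonneg_left (by linarith) hε0.le) hκK (by positivity)
            (by positivity)
      _ = η / 2 := by rw [hε]; field_simp
  have h6 : P.real (D n) < η / 4 := hn0 n hn.le
  linarith

theorem tendsto_integral_cexp_limTotal (hT : IsCascade P A) {z : ℂ} (hz : z.re ≤ 0) :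
    Tendsto (fun n => ∫ ω, Complex.exp (z * (total A n ω).toReal) ∂P) atTop
      (𝓝 (∫ ω, Complex.exp (z * limTotal A ω) ∂P)) := by
  refine tendsto_integral_of_dominated_convergence (fun _ => 1) (fun n => ?_)
    (integrable_const _) (fun n => ae_of_all _ fun ω => norm_cexp_mul_le_one hz
      ENNReal.toReal_nonneg) ?_
  · exact (Complex.measurable_exp.comp ((Complex.measurable_ofReal.comp
      (hT.measurable_total n).ennreal_toReal).const_mul z)).aestronglyMeasurable
  · filter_upwards [hT.ae_tendsto_toReal_total] with ω h
    exact (Complex.continuous_exp.tendsto _).comp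
      (((Complex.continuous_ofReal.tendsto _).comp h).const_mul z)

/-- Joint limit law of the normalized increment over `K` generations and of the tilted total weight,
by induction on `K`: the last increment is integrated out conditionally on the past, and its
conditional characteristic function is absorbed in the exponential of the tilted total weight. -/
theorem tendsto_integral_expI_increment (hA : IsCascade P A) (hT : IsCascade P (tilt α κ A))
    (hα : α ∈ Set.Ioo (1 : ℝ) 2) (hc : 0 ≤ c) (hκ0 : 0 < κ) (hκ1 : κ < 1)
    (hloc : ∀ ε > 0, ∃ δ > 0, ∀ s : ℝ, |s| ≤ δ →
      ‖offspringCharFun P A s - Complex.exp (stableExponent α c s)‖ ≤ ε * |s| ^ α)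
    (hmax : ∀ ε : ℝ≥0, 0 < ε →
      Tendsto (fun n => P {ω | ∃ u : Gen n, ε ≤ weight (tilt α κ A) u ω}) atTop (𝓝 0))
    (t : ℝ) (K : ℕ) {z : ℂ} (hz : z.re ≤ 0) :
    Tendsto (fun n => ∫ ω, expI (scale α κ n * t *
        ((total A (n + K) ω).toReal - (total A n ω).toReal)) *
        Complex.exp (z * (total (tilt α κ A) n ω).toReal) ∂P) atTop
      (𝓝 (∫ ω, Complex.exp ((z + stableExponent α c t * ∑ k ∈ Finset.range K, (κ : ℂ) ^ k) *
        limTotal (tilt α κ A) ω) ∂P)) := by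
  induction K generalizing z with
  | zero =>
    simp only [add_zero, sub_self, mul_zero, expI_zero, one_mul, Finset.range_zero,
      Finset.sum_empty]
    exact tendsto_integral_cexp_limTotal hT hz
  | succ K ih =>
    set ψ : ℂ := stableExponent α c t * (κ : ℂ) ^ K with hψ
    have hψre : ψ.re ≤ 0 := by
      have h1 : ψ = stableExponent α c t * (((κ : ℝ) ^ K : ℝ) : ℂ) := by
        rw [hψ]; push_cast; rfl
      rw [h1, Complex.re_mul_ofReal]
      exact mul_nonpos_of_nonpos_of_nonneg (stableExponent_re_nonpos hα hc t) (pow_nonneg κ.2 K)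
    have hzψ : (z + ψ).re ≤ 0 := by rw [Complex.add_re]; linarith
    set Y : ℕ → Ω → ℝ := fun n ω => (total (tilt α κ A) n ω).toReal with hY
    set G : ℕ → Ω → ℂ := fun n ω => expI (scale α κ n * t *
        ((total A (n + K) ω).toReal - (total A n ω).toReal)) * Complex.exp (z * Y n ω) with hG
    have hG1 : ∀ n ω, ‖G n ω‖ ≤ 1 := fun n ω =>
      norm_expI_mul_cexp_le hz _ ENNReal.toReal_nonneg
    have hGp : ∀ n, Measurable[past A (n + K)] (G n) := fun n =>
      measurable_expI_mul_cexp (measurable_total_past A le_rfl)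
        (measurable_total_past A (Nat.le_add_right n K))
        ((measurable_total_past (tilt α κ A) (Nat.le_add_right n K)).mono
          (past_tilt_le α κ A _) le_rfl) _ _
    have hGm : ∀ n, Measurable (G n) := fun n => (hGp n).mono (hA.past_le _) le_rfl
    have hYm : ∀ n, Measurable (Y n) := fun n => (hT.measurable_total n).ennreal_toReal
    have hY0 : ∀ n ω, 0 ≤ Y n ω := fun n ω => ENNReal.toReal_nonneg
    have hEm : ∀ n, Measurable fun ω => Complex.exp (ψ * Y n ω) := fun n =>
      Complex.measurable_exp.comp ((Complex.measurable_ofReal.comp (hYm n)).const_mul ψ)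
    have hE1 : ∀ n ω, ‖Complex.exp (ψ * Y n ω)‖ ≤ 1 := fun n ω =>
      norm_cexp_mul_le_one hψre (hY0 n ω)
    have hstep := tendsto_integral_mul_step hA hT hα hc hκ0 hκ1 hloc hmax t K hGp hG1
    have hdiff : Tendsto (fun n => ∫ ω, G n ω * (Complex.exp (ψ * Y (n + K) ω) -
        Complex.exp (ψ * Y n ω)) ∂P) atTop (𝓝 0) := by
      have h0 : (0 : ℂ) = ∫ _, (0 : ℂ) ∂P := by simp
      rw [h0]
      refine tendsto_integral_of_dominated_convergence (fun _ => 2)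
        (fun n => ((hGm n).mul ((hEm (n + K)).sub (hEm n))).aestronglyMeasurable)
        (integrable_const _) (fun n => ae_of_all _ fun ω => ?_) ?_
      · rw [norm_mul]
        refine (mul_le_of_le_one_left (norm_nonneg _) (hG1 n ω)).trans ?_
        refine (norm_sub_le _ _).trans ?_
        linarith [hE1 n ω, hE1 (n + K) ω]
      · filter_upwards [hT.ae_tendsto_toReal_total] with ω h
        have h1 : Tendsto (fun n => Complex.exp (ψ * Y n ω)) atTop
            (𝓝 (Complex.exp (ψ * limTotal (tilt α κ A) ω))) :=
          (Complex.continuous_exp.tendsto _).comp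
            (((Complex.continuous_ofReal.tendsto _).comp h).const_mul ψ)
        have h2 := (h1.comp (tendsto_add_atTop_nat K)).sub h1
        rw [sub_self] at h2
        refine squeeze_zero_norm (fun n => ?_) (tendsto_zero_iff_norm_tendsto_zero.1 h2)
        rw [norm_mul]
        exact mul_le_of_le_one_left (norm_nonneg _) (hG1 n ω)
    have hih := ih hzψ
    have hsum := (hstep.add hdiff).add hih
    rw [zero_add, zero_add] at hsum
    have e1 : z + ψ + stableExponent α c t * ∑ k ∈ Finset.range K, (κ : ℂ) ^ k =
        z + stableExponent α c t * ∑ k ∈ Finset.range (K + 1), (κ : ℂ) ^ k := by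
      rw [Finset.sum_range_succ, hψ]; ring
    rw [e1] at hsum
    refine hsum.congr fun n => ?_
    have hSm : Measurable fun ω => expI (scale α κ n * t *
        ((total A (n + K + 1) ω).toReal - (total A (n + K) ω).toReal)) :=
      measurable_expI.comp (((hA.measurable_total _).ennreal_toReal.sub
        (hA.measurable_total _).ennreal_toReal).const_mul _)
    have i1 : Integrable (fun ω => G n ω * (expI (scale α κ n * t *
        ((total A (n + K + 1) ω).toReal - (total A (n + K) ω).toReal)) -
        Complex.exp (ψ * Y (n + K) ω))) P := by
      refine (integrable_const (2 : ℝ)).mono'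
        ((hGm n).mul (hSm.sub (hEm (n + K)))).aestronglyMeasurable (ae_of_all _ fun ω => ?_)
      rw [norm_mul]
      refine (mul_le_of_le_one_left (norm_nonneg _) (hG1 n ω)).trans ?_
      refine (norm_sub_le _ _).trans ?_
      rw [norm_expI]
      linarith [hE1 (n + K) ω]
    have i2 : Integrable (fun ω => G n ω * (Complex.exp (ψ * Y (n + K) ω) -
        Complex.exp (ψ * Y n ω))) P := by
      refine (integrable_const (2 : ℝ)).mono'
        ((hGm n).mul ((hEm (n + K)).sub (hEm n))).aestronglyMeasurable (ae_of_all _ fun ω => ?_)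
      rw [norm_mul]
      refine (mul_le_of_le_one_left (norm_nonneg _) (hG1 n ω)).trans ?_
      refine (norm_sub_le _ _).trans ?_
      linarith [hE1 n ω, hE1 (n + K) ω]
    have i3 : Integrable (fun ω => expI (scale α κ n * t *
        ((total A (n + K) ω).toReal - (total A n ω).toReal)) *
        Complex.exp ((z + ψ) * Y n ω)) P := by
      refine (integrable_const (1 : ℝ)).mono' ?_
        (ae_of_all _ fun ω => norm_expI_mul_cexp_le hzψ _ (hY0 n ω))
      exact (measurable_expI_mul_cexp (hA.measurable_total _) (hA.measurable_total _)
        (hT.measurable_total n) _ _).aestronglyMeasurable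
    rw [← integral_add i1 i2]
    refine (integral_add (i1.add i2) i3).symm.trans ?_
    refine integral_congr_ae (ae_of_all _ fun ω => ?_)
    have e2 : expI (scale α κ n * t *
        ((total A (n + (K + 1)) ω).toReal - (total A n ω).toReal)) =
        expI (scale α κ n * t * ((total A (n + K) ω).toReal - (total A n ω).toReal)) *
        expI (scale α κ n * t *
          ((total A (n + K + 1) ω).toReal - (total A (n + K) ω).toReal)) := by
      rw [← expI_add, ← add_assoc]; congr 1; ring
    have e3 : Complex.exp ((z + ψ) * Y n ω) =
        Complex.exp (z * Y n ω) * Complex.exp (ψ * Y n ω) := by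
      rw [add_mul, Complex.exp_add]
    simp only [Pi.add_apply]
    rw [e2, e3]
    simp only [hG]
    ring

/-- The contribution of the generations after `n + K` to the normalized fluctuation is small,
uniformly in `n`: the increment at generation `n + J` changes the characteristic function by at most
a constant times `κ ^ J`. -/
theorem norm_integral_expI_limTotal_sub_le (hA : IsCascade P A) (hT : IsCascade P (tilt α κ A))
    (hα : α ∈ Set.Ioo (1 : ℝ) 2) (hκ0 : 0 < κ) (hκ1 : κ < 1) {C : ℝ} (hC0 : 0 ≤ C)
    (hC : ∀ s : ℝ, ‖offspringCharFun P A s - 1‖ ≤ C * |s| ^ α) (t : ℝ) (n K : ℕ) :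
    ‖∫ ω, expI (scale α κ n * t * (limTotal A ω - (total A n ω).toReal)) ∂P -
      ∫ ω, expI (scale α κ n * t * ((total A (n + K) ω).toReal - (total A n ω).toReal)) ∂P‖ ≤
      C * |t| ^ α * (κ : ℝ) ^ K / (1 - κ) := by
  have hα0 : α ≠ 0 := by linarith [hα.1]
  have hκ0' : (0 : ℝ) < κ := by exact_mod_cast hκ0
  have hκ1' : (κ : ℝ) < 1 := by exact_mod_cast hκ1
  have hsn := scale_nonneg α κ n
  set f : ℕ → ℂ := fun J => ∫ ω, expI (scale α κ n * t *
    ((total A (n + J) ω).toReal - (total A n ω).toReal)) ∂P with hf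
  have hint : ∀ J, Integrable (fun ω => expI (scale α κ n * t *
      ((total A (n + J) ω).toReal - (total A n ω).toReal))) P := fun J =>
    integrable_expI (((hA.measurable_total _).ennreal_toReal.sub
      (hA.measurable_total _).ennreal_toReal).const_mul _).aemeasurable
  have hstep : ∀ J, ‖f (J + 1) - f J‖ ≤ C * |t| ^ α * (κ : ℝ) ^ J := by
    intro J
    -- the crude approximation by one holds at all arguments: no exceptional set, and `z = 0`
    have h := hA.norm_integral_mul_step_le hκ0.ne' hT (n := n + J)
      (G := fun ω => expI (scale α κ n * t *
        ((total A (n + J) ω).toReal - (total A n ω).toReal)))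
      (by
        have := measurable_expI_mul_cexp (m := past A (n + J))
          (measurable_total_past A le_rfl) (measurable_total_past A (Nat.le_add_right n J))
          (h := fun _ => 0) measurable_const (scale α κ n * t) 0
        simpa using this)
      (fun ω => by simp) (s := scale α κ n * t) (z := 0) (by simp)
      (B := C * |scale α κ n * t| ^ α) (by positivity) (D := ∅) MeasurableSet.empty (by
        intro ω _ u
        rw [zero_mul, Complex.exp_zero]
        refine (hC _).trans (le_of_eq ?_)
        rw [abs_mul, abs_of_nonneg (NNReal.coe_nonneg (weight A u ω)),
          Real.mul_rpow (abs_nonneg _) (NNReal.coe_nonneg _), ← mul_assoc])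
    have e1 : f (J + 1) - f J = ∫ ω, expI (scale α κ n * t *
        ((total A (n + J) ω).toReal - (total A n ω).toReal)) *
        (expI (scale α κ n * t * ((total A (n + J + 1) ω).toReal -
          (total A (n + J) ω).toReal)) - Complex.exp (0 * (κ : ℂ) ^ (n + J) *
          (total (tilt α κ A) (n + J) ω).toReal)) ∂P := by
      simp only [hf]
      rw [← integral_sub (hint _) (hint _)]
      refine integral_congr_ae (ae_of_all _ fun ω => ?_)
      simp only [zero_mul, Complex.exp_zero]
      rw [mul_sub (expI _), mul_one, ← expI_add, ← add_assoc]
      congr 2; ring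
    rw [e1]
    refine h.trans (le_of_eq ?_)
    rw [measureReal_empty, mul_zero, add_zero, abs_mul, abs_of_nonneg hsn,
      Real.mul_rpow hsn (abs_nonneg t)]
    calc _ = C * |t| ^ α * (scale α κ n ^ α * (κ : ℝ) ^ (n + J)) := by ring
      _ = _ := by rw [scale_rpow_mul hα0 hκ0]
  have htel : ∀ J, ‖f (K + J) - f K‖ ≤ C * |t| ^ α * (κ : ℝ) ^ K / (1 - κ) := by
    intro J
    have h1 : ‖f (K + J) - f K‖ ≤ ∑ j ∈ Finset.range J, C * |t| ^ α * (κ : ℝ) ^ (K + j) := by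
      induction J with
      | zero => simp
      | succ J ih =>
        rw [Finset.sum_range_succ]
        calc _ = ‖(f (K + J) - f K) + (f (K + J + 1) - f (K + J))‖ := by
              congr 1; rw [← add_assoc]; ring
          _ ≤ _ := (norm_add_le _ _).trans (add_le_add ih (hstep _))
    refine h1.trans ?_
    have e : ∑ j ∈ Finset.range J, C * |t| ^ α * (κ : ℝ) ^ (K + j) =
        C * |t| ^ α * (κ : ℝ) ^ K * ∑ j ∈ Finset.range J, (κ : ℝ) ^ j := by
      rw [Finset.mul_sum]
      exact Finset.sum_congr rfl fun j _ => by rw [pow_add]; ring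
    rw [e, div_eq_mul_inv]
    refine mul_le_mul_of_nonneg_left ?_ (by positivity)
    have hg := hasSum_geometric_of_lt_one hκ0'.le hκ1'
    exact sum_le_hasSum _ (fun i _ => pow_nonneg hκ0'.le i) hg
  have hlim : Tendsto (fun J => f (K + J)) atTop (𝓝 (∫ ω, expI (scale α κ n * t *
      (limTotal A ω - (total A n ω).toReal)) ∂P)) := by
    refine tendsto_integral_of_dominated_convergence (fun _ => 1)
      (fun J => (hint (K + J)).aestronglyMeasurable) (integrable_const _)
      (fun J => ae_of_all _ fun ω => by simp) ?_
    filter_upwards [hA.ae_tendsto_toReal_total] with ω h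
    have h1 : Tendsto (fun J => (total A (n + (K + J)) ω).toReal) atTop (𝓝 (limTotal A ω)) := by
      have := h.comp (tendsto_add_atTop_nat (n + K))
      refine this.congr fun J => ?_
      simp only [Function.comp]
      congr 2; ring
    exact (continuous_expI.tendsto _).comp ((h1.sub_const _).const_mul _)
  exact le_of_tendsto (hlim.sub_const _).norm (Eventually.of_forall htel)

/-- The characteristic function of the normalized fluctuation converges to that of a mixture of
stable laws. -/
theorem tendsto_integral_expI_fluctuation (hA : IsCascade P A) (hT : IsCascade P (tilt α κ A))
    (hα : α ∈ Set.Ioo (1 : ℝ) 2) (hc : 0 ≤ c) (hκ0 : 0 < κ) (hκ1 : κ < 1)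
    (hloc : ∀ ε > 0, ∃ δ > 0, ∀ s : ℝ, |s| ≤ δ →
      ‖offspringCharFun P A s - Complex.exp (stableExponent α c s)‖ ≤ ε * |s| ^ α)
    {C : ℝ} (hC0 : 0 ≤ C) (hC : ∀ s : ℝ, ‖offspringCharFun P A s - 1‖ ≤ C * |s| ^ α)
    (hmax : ∀ ε : ℝ≥0, 0 < ε →
      Tendsto (fun n => P {ω | ∃ u : Gen n, ε ≤ weight (tilt α κ A) u ω}) atTop (𝓝 0))
    (t : ℝ) :
    Tendsto (fun n => ∫ ω, expI (scale α κ n * t * (limTotal A ω - (total A n ω).toReal)) ∂P)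
      atTop (𝓝 (∫ ω, Complex.exp (stableExponent α
        (c * limTotal (tilt α κ A) ω / (1 - κ)) t) ∂P)) := by
  have hκ0' : (0 : ℝ) < κ := by exact_mod_cast hκ0
  have hκ1' : (κ : ℝ) < 1 := by exact_mod_cast hκ1
  set g : ℕ → ℂ := fun K => ∫ ω, Complex.exp ((0 + stableExponent α c t *
    ∑ k ∈ Finset.range K, (κ : ℂ) ^ k) * limTotal (tilt α κ A) ω) ∂P with hg
  have hY0 : ∀ ω, 0 ≤ limTotal (tilt α κ A) ω := fun ω => ENNReal.toReal_nonneg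
  have hgeo : Tendsto (fun K => ∑ k ∈ Finset.range K, (κ : ℂ) ^ k) atTop
      (𝓝 (((1 - κ : ℝ) : ℂ)⁻¹)) := by
    have h := (hasSum_geometric_of_lt_one hκ0'.le hκ1').tendsto_sum_nat
    have h2 := (Complex.continuous_ofReal.tendsto _).comp h
    rw [Complex.ofReal_inv] at h2
    refine h2.congr fun K => ?_
    simp only [Function.comp]
    push_cast; rfl
  have hglim : Tendsto g atTop (𝓝 (∫ ω, Complex.exp (stableExponent α
        (c * limTotal (tilt α κ A) ω / (1 - κ)) t) ∂P)) := by
    refine tendsto_integral_of_dominated_convergence (fun _ => 1) (fun K => ?_)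
      (integrable_const _) (fun K => ae_of_all _ fun ω => ?_) (ae_of_all _ fun ω => ?_)
    · exact (Complex.measurable_exp.comp ((Complex.measurable_ofReal.comp
        hT.measurable_limTotal).const_mul _)).aestronglyMeasurable
    · refine norm_cexp_mul_le_one ?_ (hY0 ω)
      have e : (∑ k ∈ Finset.range K, (κ : ℂ) ^ k) =
          ((∑ k ∈ Finset.range K, (κ : ℝ) ^ k : ℝ) : ℂ) := by push_cast; rfl
      rw [zero_add, e, Complex.re_mul_ofReal]
      exact mul_nonpos_of_nonpos_of_nonneg (stableExponent_re_nonpos hα hc t)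
        (Finset.sum_nonneg fun k _ => pow_nonneg hκ0'.le k)
    · refine (Complex.continuous_exp.tendsto _).comp ?_
      have h := ((hgeo.const_mul (stableExponent α c t)).const_add 0).mul_const
        (limTotal (tilt α κ A) ω : ℂ)
      convert h using 2
      rw [mul_div_assoc, stableExponent_mul]
      push_cast
      rw [div_eq_mul_inv]; ring
  have hK : Tendsto (fun K : ℕ => C * |t| ^ α * (κ : ℝ) ^ K / (1 - κ)) atTop (𝓝 0) := by
    have := ((tendsto_pow_atTop_nhds_zero_of_lt_one hκ0'.le hκ1').const_mul
      (C * |t| ^ α)).div_const (1 - (κ : ℝ))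
    simpa using this
  rw [Metric.tendsto_atTop']
  intro η hη
  -- choose `K` first, uniformly in `n`, and only then let `n` tend to infinity
  obtain ⟨K, hK1, hK2⟩ := ((hK.eventually (Iio_mem_nhds (by positivity : (0 : ℝ) < η / 3))).and
    (Metric.tendsto_nhds.1 hglim (η / 3) (by positivity))).exists
  have hinc := tendsto_integral_expI_increment hA hT hα hc hκ0 hκ1 hloc hmax t K (z := 0) (by simp)
  obtain ⟨n0, hn0⟩ := eventually_atTop.1 (Metric.tendsto_nhds.1 hinc (η / 3) (by positivity))
  refine ⟨n0, fun n hn => ?_⟩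
  have h1 := norm_integral_expI_limTotal_sub_le hA hT hα hκ0 hκ1 hC0 hC t n K
  have h2 := hn0 n hn.le
  simp only [zero_mul, Complex.exp_zero, mul_one] at h2
  have hK1' : C * |t| ^ α * (κ : ℝ) ^ K / (1 - κ) < η / 3 := hK1
  rw [← dist_eq_norm] at h1
  calc _ ≤ _ := dist_triangle4 _ _ _ _
    _ < η / 3 + η / 3 + η / 3 := add_lt_add (add_lt_add (h1.trans_lt hK1') h2) hK2
    _ = η := by ring

end Fluctuations

/-! ### The stationary autoregressive process -/

section Autoregression

variable {Ω' : Type*} [MeasurableSpace Ω'] {P' : Measure Ω'} [IsProbabilityMeasure P']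
  {α c κ : ℝ} {U Q : ℕ → Ω' → ℝ}

/-- The stationary law of the autoregressive process is stable: its characteristic function `χ`
satisfies `χ(t) = χ(κ^{1/α} t) exp(Ψ(t))`, which is iterated down to the origin. -/
theorem IsStationaryStableAR.charFun_zero (hU : IsStationaryStableAR P' α c (κ ^ (1 / α)) U Q)
    (hα : 0 < α) (hκ0 : 0 < κ) (hκ1 : κ < 1) (t : ℝ) :
    charFun (P'.map (U 0)) t = Complex.exp (stableExponent α (c / (1 - κ)) t) := by
  have hα0 : α ≠ 0 := hα.ne'
  have hev : Measurable fun x : ℕ → ℝ => x 0 := measurable_pi_apply 0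
  set r : ℝ := κ ^ (1 / α) with hr
  have hr0 : 0 ≤ r := Real.rpow_nonneg hκ0.le _
  have hr1 : r < 1 := Real.rpow_lt_one hκ0.le hκ1 (by positivity)
  have hrα : r ^ α = κ := by
    rw [hr, ← Real.rpow_mul hκ0.le, one_div_mul_cancel hα0, Real.rpow_one]
  set χ : ℝ → ℂ := fun t => charFun (P'.map (U 0)) t with hχ
  have hrec : ∀ t, χ t = χ (r * t) * Complex.exp (stableExponent α c t) := by
    intro t
    have hid : IdentDistrib (U 1) (U 0) P' P' := by
      have := (hU.stationary 1).comp (u := fun x : ℕ → ℝ => x 0) (measurable_pi_apply 0)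
      simpa [Function.comp_def] using this
    have hind : IndepFun (U 0) (Q 0) P' := by
      have := hU.indep_U_zero.comp (φ := id) (ψ := fun x : ℕ → ℝ => x 0) measurable_id hev
      simpa [Function.comp_def] using this
    have hind' : IndepFun (fun ω => r * U 0 ω) (Q 0) P' :=
      hind.comp (φ := fun x => r * x) (ψ := id) (measurable_const_mul r) measurable_id
    have h2 : χ t = charFun (P'.map fun ω => r * U 0 ω + Q 0 ω) t := by
      simp only [hχ]
      rw [← hid.map_eq, Measure.map_congr (hU.recursion 0)]
    have h1 := congrFun (hind'.charFun_map_fun_add_eq_mul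
      ((hU.measurable_U 0).const_mul r).aemeasurable (hU.measurable_Q 0).aemeasurable) t
    rw [h2, h1, Pi.mul_apply, hU.charFun_Q]
    congr 1
    simp only [hχ]
    rw [charFun_map_eq_integral_expI ((hU.measurable_U 0).const_mul r).aemeasurable,
      charFun_map_eq_integral_expI (hU.measurable_U 0).aemeasurable]
    refine integral_congr_ae (ae_of_all _ fun ω => ?_)
    simp only
    congr 1; ring
  have hiter : ∀ n : ℕ, χ t = χ (r ^ n * t) *
      Complex.exp (stableExponent α c t * ((∑ k ∈ Finset.range n, κ ^ k : ℝ) : ℂ)) := by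
    intro n
    induction n with
    | zero => simp
    | succ n ih =>
      have hpow : (r ^ n) ^ α = κ ^ n := by
        rw [← Real.rpow_natCast, ← Real.rpow_mul hr0, mul_comm, Real.rpow_mul hr0, hrα,
          Real.rpow_natCast]
      rw [ih, hrec (r ^ n * t), stableExponent_scale α c (pow_nonneg hr0 n) hα0, hpow,
        Finset.sum_range_succ, mul_assoc, ← Complex.exp_add, ← mul_assoc r, ← pow_succ']
      congr 2
      push_cast; ring
  have hcont : Tendsto (fun n : ℕ => χ (r ^ n * t)) atTop (𝓝 1) := by
    have e0 : χ 0 = 1 := by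
      have := Measure.isProbabilityMeasure_map (μ := P') (hU.measurable_U 0).aemeasurable
      simp [hχ]
    have e1 : χ = fun t => ∫ ω, expI (t * U 0 ω) ∂P' :=
      funext fun t => charFun_map_eq_integral_expI (hU.measurable_U 0).aemeasurable t
    rw [← e0, e1]
    refine tendsto_integral_of_dominated_convergence (fun _ => 1) (fun n => ?_)
      (integrable_const _) (fun n => ae_of_all _ fun ω => by simp) (ae_of_all _ fun ω => ?_)
    · exact (measurable_expI.comp ((hU.measurable_U 0).const_mul _)).aestronglyMeasurable
    · refine (continuous_expI.tendsto _).comp ?_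
      have := ((tendsto_pow_atTop_nhds_zero_of_lt_one hr0 hr1).mul_const t).mul_const (U 0 ω)
      simpa using this
  have hexp : Tendsto (fun n : ℕ => Complex.exp (stableExponent α c t *
      ((∑ k ∈ Finset.range n, κ ^ k : ℝ) : ℂ))) atTop
      (𝓝 (Complex.exp (stableExponent α c t * (((1 - κ)⁻¹ : ℝ) : ℂ)))) :=
    (Complex.continuous_exp.tendsto _).comp (((Complex.continuous_ofReal.tendsto _).comp
      (hasSum_geometric_of_lt_one hκ0.le hκ1).tendsto_sum_nat).const_mul _)
  have hlim := (hcont.mul hexp).congr fun n => (hiter n).symm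
  have := tendsto_nhds_unique tendsto_const_nhds hlim
  rw [show charFun (P'.map (U 0)) t = χ t from rfl, this, one_mul, div_eq_mul_inv,
    stableExponent_mul, mul_comm]

/-- The characteristic function of `V^{1/α} U₀`, where `U₀` has the stationary law and `V ≥ 0` is
independent of it. -/
theorem IsStationaryStableAR.integral_expI_rpow_mul
    (hU : IsStationaryStableAR P' α c (κ ^ (1 / α)) U Q)
    (hα : 0 < α) (hκ0 : 0 < κ) (hκ1 : κ < 1) {V : Ω' → ℝ} (hV : AEMeasurable V P')
    (hV0 : ∀ᵐ ω ∂P', 0 ≤ V ω) (hVU : IndepFun V (fun ω k => U k ω) P') (t : ℝ) :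
    ∫ ω, expI (t * (V ω ^ (1 / α) * U 0 ω)) ∂P' =
      ∫ ω, Complex.exp (stableExponent α (c * V ω / (1 - κ)) t) ∂P' := by
  set V' : Ω' → ℝ := hV.mk V with hV'
  have hVV' : V =ᵐ[P'] V' := hV.ae_eq_mk
  have hV'm : Measurable V' := hV.measurable_mk
  have hind : IndepFun V' (U 0) P' := by
    have hev : Measurable fun x : ℕ → ℝ => x 0 := measurable_pi_apply 0
    have h1 := hVU.comp (φ := id) (ψ := fun x : ℕ → ℝ => x 0) measurable_id hev
    exact h1.congr hVV' EventuallyEq.rfl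
  have hH : Measurable (Function.uncurry fun v x : ℝ => expI (t * (v ^ (1 / α) * x))) := by
    refine measurable_expI.comp (Measurable.const_mul ?_ t)
    exact (measurable_fst.pow_const _).mul measurable_snd
  calc ∫ ω, expI (t * (V ω ^ (1 / α) * U 0 ω)) ∂P'
      = ∫ ω, expI (t * (V' ω ^ (1 / α) * U 0 ω)) ∂P' := by
        refine integral_congr_ae ?_
        filter_upwards [hVV'] with ω h
        rw [h]
    _ = ∫ ω, ∫ ω', expI (t * (V' ω ^ (1 / α) * U 0 ω')) ∂P' ∂P' :=
        integral_indepFun hV'm (hU.measurable_U 0) hind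
          (H := fun v x => expI (t * (v ^ (1 / α) * x))) hH (M := 1) fun v x => by simp
    _ = ∫ ω, Complex.exp (stableExponent α (c * V ω / (1 - κ)) t) ∂P' := by
        refine integral_congr_ae ?_
        filter_upwards [hVV', hV0] with ω h h0
        have e1 : ∫ ω', expI (t * (V' ω ^ (1 / α) * U 0 ω')) ∂P' =
            charFun (P'.map (U 0)) (V' ω ^ (1 / α) * t) := by
          rw [charFun_map_eq_integral_expI (hU.measurable_U 0).aemeasurable]
          refine integral_congr_ae (ae_of_all _ fun ω' => ?_)
          simp only
          congr 1; ring
        rw [e1, hU.charFun_zero hα hκ0 hκ1, ← h,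
          stableExponent_scale α _ (Real.rpow_nonneg h0 _) hα.ne', ← Real.rpow_mul h0,
          one_div_mul_cancel hα.ne', Real.rpow_one, ← stableExponent_mul]
        congr 2; ring

end Autoregression

/-! ### Branching random walks as cascades -/

section Reduction

/-- The factors `e^{-θ x_j} / M`, `j < k`, of the children, as a function of the reproduction data
`(k, x)` of one individual.  Children that are not born get the factor zero. -/
noncomputable def factorOfMark (θ : ℝ) (M : ℝ≥0) (y : ℕ∞ × (ℕ → ℝ)) (j : ℕ) : ℝ≥0 :=
  open Classical in if (j : ℕ∞) < y.1 then (Real.exp (-θ * y.2 j)).toNNReal / M else 0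

theorem measurable_factorOfMark (θ : ℝ) (M : ℝ≥0) : Measurable (factorOfMark θ M) := by
  refine measurable_pi_lambda _ fun j => ?_
  unfold factorOfMark
  refine Measurable.ite ?_ ?_ measurable_const
  · exact measurable_fst (MeasurableSet.of_discrete (s := {k : ℕ∞ | (j : ℕ∞) < k}))
  · refine Measurable.div_const ?_ M
    exact Measurable.real_toNNReal (by fun_prop)

theorem tsum_ite_lt (k : ℕ∞) :
    ∑' j : ℕ, (open Classical in if (j : ℕ∞) < k then (1 : ℝ≥0∞) else 0) = (k : ℝ≥0∞) := by
  classical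
  induction k using ENat.recTopCoe with
  | top => simp
  | coe n =>
    rw [tsum_eq_sum (s := Finset.range n)]
    · rw [Finset.sum_congr rfl (g := fun _ => (1 : ℝ≥0∞))]
      · simp
      · intro j hj
        rw [if_pos (by exact_mod_cast Finset.mem_range.1 hj)]
    · intro j hj
      rw [if_neg]
      simpa using hj

variable {Ω : Type*} [MeasurableSpace Ω] {P : Measure Ω}
  {N : List ℕ → Ω → ℕ∞} {X : List ℕ → ℕ → Ω → ℝ}

/-- The factors `e^{-θ X_j(u)} / m(θ)` of the additive martingale with parameter `θ`. -/
noncomputable def factor (P : Measure Ω) (N : List ℕ → Ω → ℕ∞) (X : List ℕ → ℕ → Ω → ℝ) (θ : ℝ)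
    (u : List ℕ) (ω : Ω) : ℕ → ℝ≥0 :=
  factorOfMark θ (m P N X θ).toNNReal (mark N X u ω)

theorem factor_apply (θ : ℝ) (u : List ℕ) (ω : Ω) (j : ℕ) :
    factor P N X θ u ω j = open Classical in if (j : ℕ∞) < N u ω then
      (Real.exp (-θ * X u j ω)).toNNReal / (m P N X θ).toNNReal else 0 := by
  classical
  simp only [factor, factorOfMark, mark]
  by_cases h : (j : ℕ∞) < N u ω <;> simp [h]

theorem weight_factor (θ : ℝ) (ω : Ω) : ∀ u : List ℕ, weight (factor P N X θ) u ω =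
    open Classical in if Born N u ω then
      (Real.exp (-θ * S X u ω)).toNNReal / (m P N X θ).toNNReal ^ u.length else 0
  | [] => by simp [weight, Born, S]
  | j :: u => by
    classical
    rw [weight, weight_factor θ ω u, factor_apply]
    by_cases h1 : Born N u ω
    · by_cases h2 : (j : ℕ∞) < N u ω
      · have h3 : Born N (j :: u) ω := ⟨h1, h2⟩
        rw [if_pos h1, if_pos h2, if_pos h3, div_mul_div_comm, ← pow_succ, List.length_cons,
          ← Real.toNNReal_mul (Real.exp_nonneg _), ← Real.exp_add, S]
        congr 3; ring
      · have h3 : ¬ Born N (j :: u) ω := fun h => h2 h.2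
        rw [if_neg h2, if_neg h3, mul_zero]
    · have h3 : ¬ Born N (j :: u) ω := fun h => h1 h.1
      rw [if_neg h1, if_neg h3, zero_mul]

theorem lintegral_offspring (θ : ℝ) (u : List ℕ) (ω : Ω) :
    ∫⁻ x, ENNReal.ofReal (Real.exp (-θ * x)) ∂(offspring N X u ω) =
      ∑' j : ℕ, open Classical in
        if (j : ℕ∞) < N u ω then ENNReal.ofReal (Real.exp (-θ * X u j ω)) else 0 := by
  classical
  have hm : Measurable fun x : ℝ => ENNReal.ofReal (Real.exp (-θ * x)) := by fun_prop
  rw [offspring, lintegral_sum_measure]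
  simp_rw [lintegral_dirac' _ hm]
  refine (tsum_subtype {j : ℕ | (j : ℕ∞) < N u ω}
    fun j => ENNReal.ofReal (Real.exp (-θ * X u j ω))).trans ?_
  refine tsum_congr fun j => ?_
  simp [Set.indicator_apply]

theorem lintegral_generation (θ : ℝ) (n : ℕ) (ω : Ω) :
    ∫⁻ x, ENNReal.ofReal (Real.exp (-θ * x)) ∂(generation N X n ω) =
      ∑' u : Gen n, open Classical in
        if Born N u ω then ENNReal.ofReal (Real.exp (-θ * S X u ω)) else 0 := by
  classical
  have hm : Measurable fun x : ℝ => ENNReal.ofReal (Real.exp (-θ * x)) := by fun_prop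
  rw [generation, lintegral_sum_measure]
  simp_rw [lintegral_dirac' _ hm]
  refine (tsum_subtype {u : List ℕ | u.length = n ∧ Born N u ω}
    fun u => ENNReal.ofReal (Real.exp (-θ * S X u ω))).trans (Eq.trans ?_
    (tsum_subtype {u : List ℕ | u.length = n}
      fun u => if Born N u ω then ENNReal.ofReal (Real.exp (-θ * S X u ω)) else 0).symm)
  refine tsum_congr fun u => ?_
  by_cases h1 : u.length = n <;> by_cases h2 : Born N u ω <;> simp [h1, h2]

theorem coe_toNNReal_div {x : ℝ} {M : ℝ≥0∞} (hM0 : M ≠ 0) (hM : M ≠ ∞) (n : ℕ) :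
    ((x.toNNReal / M.toNNReal ^ n : ℝ≥0) : ℝ≥0∞) = ENNReal.ofReal x / M ^ n := by
  have h : M.toNNReal ≠ 0 := (ENNReal.toNNReal_pos hM0 hM).ne'
  rw [ENNReal.coe_div (pow_ne_zero n h), ENNReal.coe_pow, ENNReal.coe_toNNReal hM]
  rfl

/-- The additive martingale is the total weight of the cascade of the normalized exponentials. -/
theorem Wext_eq_total {θ : ℝ} (h0 : m P N X θ ≠ 0) (hfin : m P N X θ ≠ ∞) (n : ℕ) (ω : Ω) :
    Wext P N X θ n ω = total (factor P N X θ) n ω := by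
  classical
  rw [Wext, lintegral_generation, total, div_eq_mul_inv, ← ENNReal.tsum_mul_right]
  refine tsum_congr fun u => ?_
  rw [weight_factor]
  by_cases h : Born N u ω
  · rw [if_pos h, if_pos h, coe_toNNReal_div h0 hfin, u.2, div_eq_mul_inv]
  · rw [if_neg h, if_neg h]; simp

theorem childSum_factor {θ : ℝ} (h0 : m P N X θ ≠ 0) (hfin : m P N X θ ≠ ∞) (u : List ℕ) (ω : Ω) :
    childSum (factor P N X θ) u ω =
      (∫⁻ x, ENNReal.ofReal (Real.exp (-θ * x)) ∂(offspring N X u ω)) * (m P N X θ)⁻¹ := by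
  classical
  rw [lintegral_offspring, childSum, ← ENNReal.tsum_mul_right]
  refine tsum_congr fun j => ?_
  rw [factor_apply]
  by_cases h : (j : ℕ∞) < N u ω
  · rw [if_pos h, if_pos h]
    have := coe_toNNReal_div (x := Real.exp (-θ * X u j ω)) h0 hfin 1
    rwa [pow_one, pow_one, div_eq_mul_inv (ENNReal.ofReal _)] at this
  · rw [if_neg h, if_neg h]; simp

/-- The normalized exponentials `e^{-θ X_j(u)} / m(θ)` of the displacements form a cascade. -/
theorem IsBranchingRandomWalk.isCascade_factor (hBRW : IsBranchingRandomWalk P N X) {θ : ℝ}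
    (h0 : m P N X θ ≠ 0) (hfin : m P N X θ ≠ ∞) : IsCascade P (factor P N X θ) where
  measurable u := (measurable_factorOfMark _ _).comp (hBRW.measurable_mark u)
  indep := hBRW.indep_mark.comp (fun _ => factorOfMark θ (m P N X θ).toNNReal)
    fun _ => measurable_factorOfMark _ _
  ident u := (hBRW.identDistrib_mark u).comp (measurable_factorOfMark _ _)
  mean := by
    simp_rw [childSum_factor h0 hfin]
    rw [lintegral_mul_const' _ _ (ENNReal.inv_ne_top.2 h0)]
    exact ENNReal.mul_inv_cancel h0 hfin

/-- If `m(θ)` vanished, there would be almost surely no children. -/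
theorem IsBranchingRandomWalk.m_ne_zero (hBRW : IsBranchingRandomWalk P N X)
    (hsuper : 1 < ∫⁻ ω, (N [] ω : ℝ≥0∞) ∂P) (θ : ℝ) : m P N X θ ≠ 0 := by
  classical
  intro h
  have hms : Measurable fun ω => ∑' j : ℕ,
      if (j : ℕ∞) < N [] ω then ENNReal.ofReal (Real.exp (-θ * X [] j ω)) else 0 := by
    have h1 : Measurable fun ω => ∑' j, (factorOfMark θ 1 (mark N X [] ω) j : ℝ≥0∞) :=
      measurable_tsum_coe.comp
        ((measurable_factorOfMark θ 1).comp (hBRW.measurable_mark []))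
    convert h1 using 4 with ω j
    simp only [factorOfMark, mark, div_one]
    split_ifs <;> rfl
  rw [m] at h
  simp_rw [lintegral_offspring] at h
  rw [lintegral_eq_zero_iff hms] at h
  have h2 : ∫⁻ ω, (N [] ω : ℝ≥0∞) ∂P = 0 := by
    rw [← lintegral_zero (μ := P)]
    refine lintegral_congr_ae ?_
    filter_upwards [h] with ω hω
    rw [← tsum_ite_lt]
    refine ENNReal.tsum_eq_zero.2 fun j => ?_
    have h3 := ENNReal.tsum_eq_zero.1 hω j
    by_cases h4 : (j : ℕ∞) < N [] ω
    · rw [if_pos h4] at h3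
      exact absurd h3 (ENNReal.ofReal_pos.2 (Real.exp_pos _)).ne'
    · rw [if_neg h4]
  rw [h2] at hsuper
  exact absurd hsuper (by simp)

theorem one_lt_lintegral_count_factor {θ : ℝ} (h0 : m P N X θ ≠ 0) (hfin : m P N X θ ≠ ∞)
    (hsuper : 1 < ∫⁻ ω, (N [] ω : ℝ≥0∞) ∂P) :
    1 < ∫⁻ ω, ∑' j, (if factor P N X θ [] ω j = 0 then 0 else 1 : ℝ≥0∞) ∂P := by
  classical
  refine hsuper.trans_le (le_of_eq (lintegral_congr fun ω => ?_))
  rw [← tsum_ite_lt]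
  refine tsum_congr fun j => ?_
  have hM : (m P N X θ).toNNReal ≠ 0 := (ENNReal.toNNReal_pos h0 hfin).ne'
  rw [factor_apply]
  by_cases h : (j : ℕ∞) < N [] ω
  · rw [if_pos h, if_pos h, if_neg]
    exact div_ne_zero (Real.toNNReal_pos.2 (Real.exp_pos _)).ne' hM
  · rw [if_neg h, if_neg h, if_pos rfl]

/-- Tilting the cascade with parameter `θ` gives the cascade with parameter `α θ`. -/
theorem tilt_factor {θ α : ℝ} (hα : 0 < α) (h0 : m P N X θ ≠ 0) (hfin : m P N X θ ≠ ∞)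
    (h0' : m P N X (α * θ) ≠ 0) (hfin' : m P N X (α * θ) ≠ ∞) :
    tilt α (kappa P N X α θ).toNNReal (factor P N X θ) = factor P N X (α * θ) := by
  classical
  funext u ω j
  have hM : (m P N X θ).toNNReal ≠ 0 := (ENNReal.toNNReal_pos h0 hfin).ne'
  have hM' : (m P N X (α * θ)).toNNReal ≠ 0 := (ENNReal.toNNReal_pos h0' hfin').ne'
  have hκ : (kappa P N X α θ).toNNReal =
      (m P N X (α * θ)).toNNReal / (m P N X θ).toNNReal ^ α := by
    rw [kappa, ENNReal.toNNReal_div, ENNReal.toNNReal_rpow]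
  rw [tilt, factor_apply, factor_apply]
  by_cases h : (j : ℕ∞) < N u ω
  · rw [if_pos h, if_pos h, hκ, NNReal.div_rpow, div_div_div_cancel_right₀]
    · congr 1
      rw [← Real.toNNReal_rpow_of_nonneg (Real.exp_nonneg _), ← Real.exp_mul]
      congr 2; ring
    · exact (NNReal.rpow_pos (pos_iff_ne_zero.2 hM)).ne'
  · rw [if_neg h, if_neg h, NNReal.zero_rpow hα.ne', zero_div]

end Reduction

end BRW

theorem corollary1 {Ω : Type*} [MeasurableSpace Ω] (P : Measure Ω) [IsProbabilityMeasure P]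
    (N : List ℕ → Ω → ℕ∞) (X : List ℕ → ℕ → Ω → ℝ)
    (hBRW : BRW.IsBranchingRandomWalk P N X)
    -- supercriticality: the mean number of children is larger than one
    (hsuper : 1 < ∫⁻ ω, (N [] ω : ℝ≥0∞) ∂P)
    (θ α c : ℝ) (hα : α ∈ Set.Ioo (1 : ℝ) 2) (hc : 0 < c)
    (hm : BRW.m P N X θ < ∞)
    (hκ : BRW.kappa P N X α θ < 1)
    (htail : Asymptotics.IsEquivalent atTop
      (fun x : ℝ => P.real {ω | x < BRW.W P N X θ 1 ω}) (fun x : ℝ => c * x ^ (-α)))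
    -- the limit objects: a copy `V` of `W(αθ)` and the autoregressive process `U`, independent of `V`
    {Ω' : Type*} [MeasurableSpace Ω'] (P' : Measure Ω') [IsProbabilityMeasure P']
    (V : Ω' → ℝ) (U Q : ℕ → Ω' → ℝ)
    (hV : IdentDistrib V (BRW.Wlim P N X (α * θ)) P' P)
    (hU : BRW.IsStationaryStableAR P' α c ((BRW.kappa P N X α θ).toReal ^ (1 / α)) U Q)
    (hVU : IndepFun V (fun ω k => U k ω) P') :
    -- `W(θ)` and `W(αθ)` are the almost sure limits of the respective martingales
    (∀ᵐ ω ∂P, Tendsto (fun n => BRW.W P N X θ n ω) atTop (𝓝 (BRW.Wlim P N X θ ω))) ∧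
    (∀ᵐ ω ∂P, Tendsto (fun n => BRW.W P N X (α * θ) n ω) atTop
      (𝓝 (BRW.Wlim P N X (α * θ) ω))) ∧
    TendstoInDistribution
      (fun (n : ℕ) ω => (BRW.kappa P N X α θ).toReal ^ (-(n : ℝ) / α) *
        (BRW.Wlim P N X θ ω - BRW.W P N X θ n ω))
      atTop (fun ω => V ω ^ (1 / α) * U 0 ω) (fun _ => P) P' ∧
    ∀ t : ℝ, charFun (P'.map (fun ω => V ω ^ (1 / α) * U 0 ω)) t =
      ∫ ω, Complex.exp (BRW.stableExponent α
        (c * BRW.Wlim P N X (α * θ) ω / (1 - (BRW.kappa P N X α θ).toReal)) t) ∂P := by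
  open BRW in
  have hαp : 0 < α := by linarith [hα.1]
  have h0 := hBRW.m_ne_zero hsuper θ
  have h0' := hBRW.m_ne_zero hsuper (α * θ)
  have hpow0 : m P N X θ ^ α ≠ 0 := by
    simp [ENNReal.rpow_eq_zero_iff, h0, hm.ne]
  have hpowtop : m P N X θ ^ α ≠ ∞ := ENNReal.rpow_ne_top_of_nonneg hαp.le hm.ne
  have hfin' : m P N X (α * θ) ≠ ∞ := by
    intro h
    rw [kappa, h, ENNReal.top_div_of_ne_top hpowtop] at hκ
    simp at hκ
  set κ : NNReal := (kappa P N X α θ).toNNReal with hκdef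
  have hκtop : kappa P N X α θ ≠ ∞ := (hκ.trans ENNReal.one_lt_top).ne
  have hκ0 : 0 < κ := ENNReal.toNNReal_pos (ENNReal.div_pos h0' hpowtop).ne' hκtop
  have hκ1 : κ < 1 := by
    rw [← ENNReal.coe_lt_coe, hκdef, ENNReal.coe_toNNReal hκtop]
    exact_mod_cast hκ
  have hκR : (kappa P N X α θ).toReal = (κ : ℝ) := rfl
  have hκ0' : (0 : ℝ) < κ := by exact_mod_cast hκ0
  have hκ1' : (κ : ℝ) < 1 := by exact_mod_cast hκ1
  set A := factor P N X θ with hAdef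
  have hA : IsCascade P A := hBRW.isCascade_factor h0 hm.ne
  have htilt : tilt α κ A = factor P N X (α * θ) := tilt_factor hαp h0 hm.ne h0' hfin'
  have hT' : IsCascade P (factor P N X (α * θ)) := hBRW.isCascade_factor h0' hfin'
  have hT : IsCascade P (tilt α κ A) := by rw [htilt]; exact hT'
  have hW : ∀ n ω, W P N X θ n ω = (total A n ω).toReal := fun n ω => by
    rw [W, Wext_eq_total h0 hm.ne]
  have hW' : ∀ n ω, W P N X (α * θ) n ω = (total (tilt α κ A) n ω).toReal := fun n ω => by
    rw [W, Wext_eq_total h0' hfin', htilt]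
  have hWl : ∀ ω, Wlim P N X θ ω = limTotal A ω := fun ω => by
    simp only [Wlim, limTotal, Wext_eq_total h0 hm.ne]; rfl
  have hWl' : ∀ ω, Wlim P N X (α * θ) ω = limTotal (tilt α κ A) ω := fun ω => by
    simp only [Wlim, limTotal, Wext_eq_total h0' hfin', htilt]
  -- the characteristic function of the sum of the factors of one individual
  set ξ : Ω → ℝ := fun ω => (childSum A [] ω).toReal with hξdef
  have hξm : Measurable ξ := (hA.measurable_childSum []).ennreal_toReal
  have hξ0 : ∀ ω, 0 ≤ ξ ω := fun ω => ENNReal.toReal_nonneg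
  have hξtot : ∀ ω, ξ ω = (total A 1 ω).toReal := fun ω => by rw [total_one]
  have hξint : Integrable ξ P := by
    simp_rw [funext hξtot]; exact hA.integrable_total 1
  have hξmean : ∫ ω, ξ ω ∂P = 1 := by
    simp_rw [hξtot]; exact hA.integral_total 1
  have htail' : Tendsto (fun x : ℝ => P.real {ω | x < ξ ω} * x ^ α) atTop (𝓝 c) := by
    have h := tendsto_mul_rpow_of_isEquivalent hc htail
    simp_rw [hW, ← hξtot] at h
    exact h
  obtain ⟨C, hC0, hC⟩ :=
    exists_norm_integral_expI_sub_one_le hα hc.le hξm hξ0 hξint hξmean htail'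
  have hfluct := tendsto_integral_expI_fluctuation hA hT hα hc.le hκ0 hκ1
    (fun ε hε => norm_integral_expI_sub_exp_stableExponent_le hα hξm hξ0 hξint hξmean htail' hε)
    hC0 hC (fun ε hε => by
      rw [htilt]
      exact hT'.tendsto_exists_le_weight
        (one_lt_lintegral_count_factor h0' hfin' hsuper) hε)
  -- the law of the limit
  have hV0 : ∀ᵐ ω ∂P', 0 ≤ V ω :=
    hV.symm.ae_snd measurableSet_Ici (ae_of_all _ fun ω => ENNReal.toReal_nonneg)
  have hlimm : AEMeasurable (fun ω => V ω ^ (1 / α) * U 0 ω) P' :=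
    (hV.aemeasurable_fst.pow_const _).mul (hU.measurable_U 0).aemeasurable
  have hlaw : ∀ t : ℝ, charFun (P'.map (fun ω => V ω ^ (1 / α) * U 0 ω)) t =
      ∫ ω, Complex.exp (stableExponent α
        (c * Wlim P N X (α * θ) ω / (1 - (kappa P N X α θ).toReal)) t) ∂P := by
    intro t
    rw [charFun_map_eq_integral_expI hlimm,
      hU.integral_expI_rpow_mul hαp hκ0' hκ1' hV.aemeasurable_fst hV0 hVU]
    have hm1 : Measurable fun v : ℝ => Complex.exp (stableExponent α (c * v / (1 - κ)) t) := by
      simp only [stableExponent]; fun_prop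
    exact (hV.comp hm1).integral_eq
  have hXm : ∀ n : ℕ, Measurable fun ω => (kappa P N X α θ).toReal ^ (-(n : ℝ) / α) *
      (Wlim P N X θ ω - W P N X θ n ω) := by
    intro n
    simp_rw [hWl, hW]
    exact (hA.measurable_limTotal.sub (hA.measurable_total n).ennreal_toReal).const_mul _
  refine ⟨?_, ?_, ?_, hlaw⟩
  · simp_rw [hWl, hW]; exact hA.ae_tendsto_toReal_total
  · simp_rw [hWl', hW']; exact hT.ae_tendsto_toReal_total
  · refine ⟨fun n => (hXm n).aemeasurable, hlimm, ?_⟩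
    refine ProbabilityMeasure.tendsto_iff_tendsto_charFun.2 fun t => ?_
    simp only [ProbabilityMeasure.coe_mk]
    rw [hlaw t]
    simp_rw [hWl']
    refine (hfluct t).congr fun n => ?_
    rw [charFun_map_eq_integral_expI (hXm n).aemeasurable]
    refine integral_congr_ae (ae_of_all _ fun ω => ?_)
    simp only [hWl, hW, scale, hκR]
    congr 1; ring
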